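/- A (finite, symmetric) \emph{binary bidding game} $G$ consists of a finite set $S$ of states with initial state $s_0$, terminal states $T\subseteq S$, a set $g(s)$ of one or two successors of every $s\in S\setminus T$ (with no cycles), and utilities $u_1,u_2:T\to\mathbb R$. Budgets sum to one; a budget partition is given by the budget $B\in[0,1]$ of player 1. In state $s\notin T$ each player names a bid, at most his budget, and a successor of $s$; the higher bidder (player 1 on a tie) pays his bid to the other player and moves to the successor he named. Player $i$ strictly prefers $t$ to $t'$ ($t\succ_i t'$) if $u_i(t)>u_i(t')$, or $u_i(t)=u_i(t')$ and $u_{-i}(t)>u_{-i}(t')$; terminals with the same pair of utilities are regarded as the same outcome. Let $\varepsilon=2^{-\mathrm{height}(G)-2}$, where the height is the maximal number of moves from $s_0$ to a terminal, and let bids be multiples of $\varepsilon$. The \emph{Lower PSPE} $\gamma$ of $G$ is the pure subgame perfect equilibrium in which, in every state and at every budget partition (and given the equilibrium in the successor states), the bids $(b_1,b_2)$ are the lowest among the equilibrium bids with $b_1=b_2$ (player 1 wins) or $b_2=b_1+\varepsilon$ (player 2 wins). Its budget-to-outcome map $\mu_\gamma$ sends $B\in[0,1]$ to the terminal reached from $s_0$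 at partition $B$. \textbf{Proposition.} For every binary bidding game $G$ the Lower PSPE exists, its map $\mu_\gamma:[0,1]\to T$ is unique as a map to outcomes, and the algorithm \textsc{Find-PSPE-fast} described below computes $\mu_\gamma$ (and likewise the map of the subgame at every state reachable from $s_0$), as a step function given by its list of cutoffs and outcomes. Each of these step functions has at most $|T|$ intervals. Counting every arithmetic operation and comparison on budgets and utilities, and every table access, as one step, the algorithm runs in time at most $|S|\cdot p(|T|)$, hence at most $q(|S|)$, for polynomials $p,q$ that do not depend on $G$ (in particular not on its height). \textsc{Find-PSPE-fast} treats the states reachable from $s_0$ in post-order, and stores for each state $s$ an increasing list $F_s$ of cutoffs from $0$ to $1$ and the outcome $T^*_s(a)$ at each cutoff $F_s(a)$; let $f_s(B)=\max\{a:F_s(a)\le B\}$. For a terminal $t$, $F_t=(0,1)$ and $T^*_t=(t,t)$. For a state $s$ with children $l,r$ (where $l=r$ if there is only one), the ascending auction below is run at every $B$ among the numbers $(F_l(a)+F_r(a'))/2$, $F_l(a)$, $F_r(a')$, in increasing order; of the resulting list, the entries whose outcome differs from that of the preceding entry are kept, together with the first and the last entry. \emph{Auction at $B$:} let $s_i$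 be the child that is best for player $i$ at budget $B$ according to the stored outcomes. If $s_1=s_2$, the outcome is $T^*_{s_1}(f_{s_1}(B))$. Otherwise start with $b_1=0$ and repeat: let $a_1=f_{s_1}(B-b_1)$, $a_2=f_{s_2}(B+b_1)$, $t_1=T^*_{s_1}(a_1)$ and $t_2=T^*_{s_2}(f_{s_2}(B+b_1+\varepsilon))$. If $b_1+\varepsilon>1-B$ or not $t_2\succ_2 t_1$, stop with outcome $t_1$. Otherwise let $b=\min\{B-F_{s_1}(a_1-1),\,F_{s_2}(a_2+1)-B\}$ (without the first term if $a_1$ is the first index). If $b>B$ or not $T^*_{s_1}(f_{s_1}(B-b))\succ_1 t_2$, stop with outcome $t_2$. Otherwise set $b_1=b$. -/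

import Mathlib

/-! ### Bidding games -/

/-- The two players. -/
inductive Player where
  | white : Player
  | black : Player

namespace Player

/-- The opponent of a player. -/
def other : Player → Player
  | white => black
  | black => white

end Player

/-- A (symmetric) bidding game on the set of states `S` (finite wherever it matters): initial state, terminal states, the moves
`g s` available in `s` to whoever wins the turn, and the utilities of the two players.  Only the
values of `u i` at terminal states are ever used.  There are no cycles, and the terminal states are
exactly the states without moves. -/
structure BiddingGame (S : Type) where
  s₀ : S
  T : Finset S
  g : S → Finset S
  u : Player → S → ℝ
  mem_T_iff : ∀ s, s ∈ T ↔ g s = ∅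
  acyclic : ∀ s, ¬ Relation.TransGen (fun a b => b ∈ g a) s s

namespace BiddingGame

variable {S : Type}

/-- Binary games: at most two moves in every state. -/
def IsBinary (G : BiddingGame S) : Prop := ∀ s, s ∉ G.T → (G.g s).card ≤ 2

/-- `s` can occur in a play of the game. -/
def Reachable (G : BiddingGame S) (s : S) : Prop :=
  Relation.ReflTransGen (fun a b => b ∈ G.g a) G.s₀ s

theorem wellFounded [Finite S] (G : BiddingGame S) :
    WellFounded (fun b a : S => b ∈ G.g a) := by
  have hirr : Std.Irrefl (Relation.TransGen (fun b a : S => b ∈ G.g a)) :=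
    ⟨fun s h => G.acyclic s (by
      have h' := Relation.transGen_swap.mp h
      exact h')⟩
  have hwf : WellFounded (Relation.TransGen (fun b a : S => b ∈ G.g a)) :=
    Finite.wellFounded_of_trans_of_irrefl _
  exact Subrelation.wf (fun h => Relation.TransGen.single h) hwf

/-- The height of a state: the maximal number of moves from it to a terminal state. -/
noncomputable def height [Finite S] (G : BiddingGame S) : S → ℕ :=
  G.wellFounded.fix (fun s ih => (G.g s).attach.sup (fun c => ih c.1 c.2 + 1))

theorem height_eq [Finite S] (G : BiddingGame S) (s : S) :
    G.height s = (G.g s).sup (fun c => G.height c + 1) := by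
  unfold height
  rw [WellFounded.fix_eq]
  exact Finset.sup_attach (G.g s) (fun c => G.height c + 1)

/-- `G.Prefers i t t'`: player `i` strictly prefers `t` to `t'`.  A player who is indifferent in
utility strictly prefers what is better for the opponent. -/
def Prefers (G : BiddingGame S) (i : Player) (t t' : S) : Prop :=
  G.u i t' < G.u i t ∨ (G.u i t = G.u i t' ∧ G.u i.other t' < G.u i.other t)

/-- Two terminal states are the same outcome if they give each player the same utility; these
are the terminals between which no player has a strict preference. -/
def SameOutcome (G : BiddingGame S) (t t' : S) : Prop := ∀ i, G.u i t = G.u i t'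

/-! ### Equilibria

Budgets are normalised to total one and a budget partition is given by the budget
`B ∈ [0, 1]` of white. -/

/-- The budget of player `i` when white has `B`. -/
def budget (B : ℝ) : Player → ℝ
  | Player.white => B
  | Player.black => 1 - B

/-- What a player does in one turn: a bid, and the state to move to if the bid wins. -/
structure Action (S : Type) where
  bid : ℝ
  next : S

/-- The terminal reached when the actions `a` are taken at budget partition `B` and `μ c B'` is the
terminal reached from state `c` at partition `B'`.  The higher bidder (white on a tie)
moves, and pays the bid to the other player. -/
noncomputable def stageOutcome (μ : S → ℝ → S) (B : ℝ) (a : Player → Action S) : S :=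
  if (a Player.black).bid ≤ (a Player.white).bid then
    μ (a Player.white).next (B - (a Player.white).bid)
  else
    μ (a Player.black).next (B + (a Player.black).bid)

/-- Legal actions of player `i`, when bids have to belong to `bids`. -/
structure IsLegal (G : BiddingGame S) (bids : Set ℝ) (s : S) (B : ℝ) (i : Player)
    (x : Action S) : Prop where
  bid_mem : x.bid ∈ bids
  bid_nonneg : 0 ≤ x.bid
  bid_le : x.bid ≤ budget B i
  next_mem : x.next ∈ G.g s

/-- The actions `a` are a pure Nash equilibrium of the turn at `(s, B)`, when play continues
according to `μ`: a unilateral deviation to another bid, another move, or both, is never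
strictly preferred by the deviating player. -/
def IsStageEquilibrium (G : BiddingGame S) (bids : Set ℝ) (μ : S → ℝ → S) (s : S) (B : ℝ)
    (a : Player → Action S) : Prop :=
  (∀ i, G.IsLegal bids s B i (a i)) ∧
    ∀ (i : Player) (a' : Player → Action S), G.IsLegal bids s B i (a' i) →
      a' i.other = a i.other → ¬ G.Prefers i (stageOutcome μ B a') (stageOutcome μ B a)

/-- A strategy profile, together with the terminal `outcome s B` that it reaches from every state
and budget partition. -/
structure Profile (S : Type) where
  act : S → ℝ → Player → Action S
  outcome : S → ℝ → S

/-- Pure subgame perfect equilibria of the game with bids in `bids`. -/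
structure IsPSPE (G : BiddingGame S) (bids : Set ℝ) (γ : Profile S) : Prop where
  outcome_terminal : ∀ t, G.Reachable t → t ∈ G.T → ∀ B ∈ Set.Icc (0 : ℝ) 1, γ.outcome t B = t
  outcome_eq : ∀ s, G.Reachable s → s ∉ G.T → ∀ B ∈ Set.Icc (0 : ℝ) 1,
    γ.outcome s B = stageOutcome γ.outcome B (γ.act s B)
  equilibrium : ∀ s, G.Reachable s → s ∉ G.T → ∀ B ∈ Set.Icc (0 : ℝ) 1,
    G.IsStageEquilibrium bids γ.outcome s B (γ.act s B)

/-- The minimal bid increment `2 ^ (- height G - 2)`. -/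
noncomputable def increment [Finite S] (G : BiddingGame S) : ℝ :=
  (1 / 2 : ℝ) ^ (G.height G.s₀ + 2)

/-- Bids are multiples of the minimal increment. -/
def gridBids [Finite S] (G : BiddingGame S) : Set ℝ :=
  {x | ∃ m : ℕ, x = m * G.increment}

/-- The two bids are as close as the winner of the turn allows: they are equal if white takes
the turn, and differ by one increment if black takes it. -/
def Tight [Finite S] (G : BiddingGame S) (a : Player → Action S) : Prop :=
  (a Player.white).bid = (a Player.black).bid ∨
    (a Player.black).bid = (a Player.white).bid + G.increment

/-- The Lower PSPE: in every state and at every budget partition, the two bids are the lowest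
pair of equilibrium bids, given the equilibrium chosen in the successor states. -/
structure IsLowerPSPE [Finite S] (G : BiddingGame S) (γ : Profile S) : Prop where
  isPSPE : G.IsPSPE G.gridBids γ
  tight : ∀ s, G.Reachable s → s ∉ G.T → ∀ B ∈ Set.Icc (0 : ℝ) 1, G.Tight (γ.act s B)
  lowest : ∀ s, G.Reachable s → s ∉ G.T → ∀ B ∈ Set.Icc (0 : ℝ) 1, ∀ a : Player → Action S,
    G.IsStageEquilibrium G.gridBids γ.outcome s B a → G.Tight a →
      ∀ i, (γ.act s B i).bid ≤ (a i).bid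

/-- The map from (initial) budget partitions to outcomes that a profile induces. -/
def outcomeMap (G : BiddingGame S) (γ : Profile S) (B : ℝ) : S := γ.outcome G.s₀ B

end BiddingGame

/-! ### Computations with a step count -/

/-- A value together with the number of elementary steps spent on computing it. -/
structure Timed (α : Type) where
  val : α
  time : ℕ

namespace Timed

instance : Monad Timed where
  pure a := ⟨a, 0⟩
  bind x f := ⟨(f x.val).val, x.time + (f x.val).time⟩

/-- One elementary step: an arithmetic operation on, or a comparison of, two numbers (budgets,
utilities, indices), a test of a state, one access to a table or an array, or the
extension of an array by one entry. -/
def op {α : Type} (a : α) : Timed α := ⟨a, 1⟩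

end Timed

/-! ### The algorithm -/

namespace FindPSPEFast

open Timed
open scoped Classical

variable {S : Type}

/-- The input format: for every non-terminal state its left and right child (which coincide if
there is only one move). -/
structure Children (G : BiddingGame S) where
  left : S → S
  right : S → S
  mem_iff : ∀ s, s ∉ G.T → ∀ c, c ∈ G.g s ↔ c = left s ∨ c = right s

/-- Binary games are exactly the games that can be presented in this way. -/
theorem isBinary_iff_nonempty_children (G : BiddingGame S) :
    G.IsBinary ↔ Nonempty (Children G) := by
  constructor
  · intro h
    have key : ∀ s, ∃ p : S × S, s ∉ G.T → ∀ c, c ∈ G.g s ↔ c = p.1 ∨ c = p.2 := by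
      intro s
      by_cases hs : s ∈ G.T
      · exact ⟨(s, s), fun h' => absurd hs h'⟩
      · have hne : (G.g s).Nonempty :=
          Finset.nonempty_iff_ne_empty.mpr (fun h0 => hs ((G.mem_T_iff s).mpr h0))
        have hpos := hne.card_pos
        have hle := h s hs
        rcases (by omega : (G.g s).card = 1 ∨ (G.g s).card = 2) with h1 | h2
        · obtain ⟨a, ha⟩ := Finset.card_eq_one.mp h1
          exact ⟨(a, a), fun _ c => by simp [ha]⟩
        · obtain ⟨a, b, _, hab⟩ := Finset.card_eq_two.mp h2
          exact ⟨(a, b), fun _ c => by simp [hab]⟩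
    choose p hp using key
    exact ⟨⟨fun s => (p s).1, fun s => (p s).2, hp⟩⟩
  · rintro ⟨D⟩ s hs
    have : G.g s ⊆ {D.left s, D.right s} := by
      intro c hc
      simpa using (D.mem_iff s hs c).mp hc
    exact (Finset.card_le_card this).trans Finset.card_le_two

/-- One row of the step function of a state `s`: a cutoff `F_s(a)`, the terminal `T*_s(a)` that is
reached for budgets from this cutoff up to the next one, and for each player the chosen child with
the index of the row of that child at which the play continues. -/
structure Row (S : Type) where
  cut : ℝ
  out : S
  actWhite : S × ℕ
  actBlack : S × ℕ

/-- The test `t ≻_i t'`. -/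
noncomputable def prefersTest (G : BiddingGame S) (i : Player) (t t' : S) : Timed Bool := do
  let gt ← op (decide (G.u i t' < G.u i t))
  if gt then pure true
  else
    let eq ← op (decide (G.u i t = G.u i t'))
    if eq then op (decide (G.u i.other t' < G.u i.other t))
    else pure false

/-- The test whether two terminals are different outcomes. -/
noncomputable def differTest (G : BiddingGame S) (t t' : S) : Timed Bool := do
  let eq₁ ← op (decide (G.u Player.white t = G.u Player.white t'))
  if eq₁ then
    let eq₂ ← op (decide (G.u Player.black t = G.u Player.black t'))
    if eq₂ then pure false else pure true
  else pure true

/-- Scan `F` for the last row with cutoff at most `B`; `a` is the index of the first row of the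
list that is still to be scanned, `best` the last row found so far. -/
noncomputable def locateFrom (B : ℝ) : List (Row S) → ℕ → ℕ → Timed ℕ
  | [], _, best => pure best
  | r :: rs, a, best => do
      let le ← op (decide (r.cut ≤ B))
      if le then
        let a' ← op (a + 1)
        locateFrom B rs a' a
      else pure best

/-- `f_s(B) = max {a : F_s(a) ≤ B}` (indices start at zero). -/
noncomputable def locate (F : List (Row S)) (B : ℝ) : Timed ℕ := locateFrom B F 0 0

/-- Read the cutoff with index `a`. -/
def cutAt (F : List (Row S)) (a : ℕ) : Timed ℝ := op ((F[a]?.map Row.cut).getD 1)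

/-- Read the outcome with index `a`; `d` is only a default for indices out of range. -/
def outAt (d : S) (F : List (Row S)) (a : ℕ) : Timed S := op ((F[a]?.map Row.out).getD d)

/-- The ascending auction at white budget `B`, from the bid `b₁` of white on.  White wants to move
to `s₁`, with step function `F₁`, and black to `s₂`, with step function `F₂`.  The first argument
bounds the number of rounds. -/
noncomputable def auctionLoop (G : BiddingGame S) (ε B : ℝ) (s₁ s₂ : S) (F₁ F₂ : List (Row S)) :
    ℕ → ℝ → Timed (Row S)
  | 0, _ => pure ⟨B, s₁, (s₁, 0), (s₂, 0)⟩
  | rounds + 1, b₁ => do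
      let x₁ ← op (B - b₁)
      let a₁ ← locate F₁ x₁
      let t₁ ← outAt s₁ F₁ a₁
      let x₂ ← op (B + b₁)
      let a₂ ← locate F₂ x₂
      -- a deviation of black: raise by the minimal increment
      let b₂' ← op (b₁ + ε)
      let x₂' ← op (B + b₂')
      let a₂' ← locate F₂ x₂'
      let t₂' ← outAt s₂ F₂ a₂'
      let rest ← op (1 - B)
      let cannot ← op (decide (rest < b₂'))
      let gain ← prefersTest G Player.black t₂' t₁
      if cannot || !gain then
        pure ⟨B, t₁, (s₁, a₁), (s₂, a₂)⟩
      else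
        -- black raises as far as neither player reaches a new relevant interval
        let c₂ ← cutAt F₂ (a₂ + 1)
        let y₂ ← op (c₂ - B)
        let bottom ← op (decide (a₁ = 0))
        let y ← (if bottom then pure y₂
          else do
            let c₁ ← cutAt F₁ (a₁ - 1)
            let y₁ ← op (B - c₁)
            op (min y₁ y₂))
        let b₂ ← op (y - ε)
        -- a deviation of white: match the bid of black, up to one increment
        let b₁' ← op (b₂ + ε)
        let x₁' ← op (B - b₁')
        let a₁' ← locate F₁ x₁'
        let t₁' ← outAt s₁ F₁ a₁'
        let cannot' ← op (decide (B < b₁'))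
        let gain' ← prefersTest G Player.white t₁' t₂'
        if cannot' || !gain' then
          pure ⟨B, t₂', (s₁, a₁), (s₂, a₂')⟩
        else auctionLoop G ε B s₁ s₂ F₁ F₂ rounds b₁'

/-- The lowest equilibrium at white budget `B` in a state with the children `l` and `r`, whose step
functions are `Fl` and `Fr`. -/
noncomputable def ascendingAuction (G : BiddingGame S) (maxRounds : ℕ) (ε : ℝ) (l r : S)
    (Fl Fr : List (Row S)) (B : ℝ) : Timed (Row S) := do
  let al ← locate Fl B
  let ar ← locate Fr B
  let tl ← outAt l Fl al
  let tr ← outAt r Fr ar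
  let whiteRight ← prefersTest G Player.white tr tl
  let blackRight ← prefersTest G Player.black tr tl
  if whiteRight then
    if blackRight then pure ⟨B, tr, (r, ar), (r, ar)⟩
    else auctionLoop G ε B r l Fr Fl maxRounds 0
  else
    if blackRight then auctionLoop G ε B l r Fl Fr maxRounds 0
    else pure ⟨B, tl, (l, al), (l, al)⟩

/-- The numbers `(x + F(a)) / 2`, put in front of the list `acc`. -/
noncomputable def averagesWith (x : ℝ) : List (Row S) → List ℝ → Timed (List ℝ)
  | [], acc => pure acc
  | r :: rs, acc => do
      let y ← op (x + r.cut)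
      let z ← op (y / 2)
      let acc' ← op (z :: acc)
      averagesWith x rs acc'

/-- The numbers `z_{lr} = (F_l(a) + F_r(a')) / 2`, put in front of the list `acc`. -/
noncomputable def averages (Fr : List (Row S)) : List (Row S) → List ℝ → Timed (List ℝ)
  | [], acc => pure acc
  | r :: rs, acc => do
      let x ← op r.cut
      let acc' ← averagesWith x Fr acc
      averages Fr rs acc'

/-- The cutoffs of `F`, put in front of the list `acc`. -/
def cuts : List (Row S) → List ℝ → Timed (List ℝ)
  | [], acc => pure acc
  | r :: rs, acc => do
      let acc' ← op (r.cut :: acc)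
      cuts rs acc'

/-- Insert a number into a sorted list. -/
noncomputable def insertSorted (x : ℝ) : List ℝ → Timed (List ℝ)
  | [] => op [x]
  | y :: ys => do
      let le ← op (decide (x ≤ y))
      if le then op (x :: y :: ys)
      else
        let zs ← insertSorted x ys
        op (y :: zs)

/-- Insertion sort. -/
noncomputable def sort : List ℝ → Timed (List ℝ)
  | [] => pure []
  | x :: xs => do
      let ys ← sort xs
      insertSorted x ys

/-- The critical budgets of a state, in increasing order. -/
noncomputable def criticalBudgets (Fl Fr : List (Row S)) : Timed (List ℝ) := do
  let zs ← averages Fr Fl []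
  let zs' ← cuts Fl zs
  let zs'' ← cuts Fr zs'
  sort zs''

/-- Run the ascending auction at each of the given budgets. -/
noncomputable def runAuctions (G : BiddingGame S) (maxRounds : ℕ) (ε : ℝ) (l r : S)
    (Fl Fr : List (Row S)) : List ℝ → Timed (List (Row S))
  | [] => pure []
  | B :: Bs => do
      let row ← ascendingAuction G maxRounds ε l r Fl Fr B
      let rows ← runAuctions G maxRounds ε l r Fl Fr Bs
      op (row :: rows)

/-- Keep the rows whose outcome differs from the outcome of the row before (`t` for the first
row of the list), and the last row, which marks the right end of the budget range. -/
noncomputable def filterFrom (G : BiddingGame S) : S → List (Row S) → Timed (List (Row S))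
  | _, [] => pure []
  | _, [row] => op [row]
  | t, row :: row' :: rows => do
      let new ← differTest G row.out t
      let kept ← filterFrom G row.out (row' :: rows)
      if new then op (row :: kept) else pure kept

/-- Keep the first row of each block of rows with the same outcome, and the last row. -/
noncomputable def filterRows (G : BiddingGame S) : List (Row S) → Timed (List (Row S))
  | [] => pure []
  | row :: rows => do
      let kept ← filterFrom G row.out rows
      op (row :: kept)

/-- A depth-first search from `s`, which appends the states that it finds to the list `order` in
post-order.  The first argument bounds the depth of the recursion. -/
noncomputable def visit (G : BiddingGame S) (D : Children G) :
    ℕ → S → (S → Bool) × List S → Timed ((S → Bool) × List S)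
  | 0, _, σ => pure σ
  | depth + 1, s, σ => do
      let seen ← op (σ.1 s)
      if seen then pure σ
      else
        let visited ← op (Function.update σ.1 s true)
        let leaf ← op (decide (s ∈ G.T))
        let σ' ← (if leaf then pure (visited, σ.2)
          else do
            let l ← op (D.left s)
            let r ← op (D.right s)
            let τ ← visit G D depth l (visited, σ.2)
            visit G D depth r τ)
        let order ← op (σ'.2 ++ [s])
        pure (σ'.1, order)

/-- Compute the heights of the listed states, children first. -/
noncomputable def heights (G : BiddingGame S) (D : Children G) :
    List S → (S → ℕ) → Timed (S → ℕ)
  | [], H => pure H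
  | s :: ss, H => do
      let leaf ← op (decide (s ∈ G.T))
      let h ← (if leaf then op 0
        else do
          let l ← op (D.left s)
          let r ← op (D.right s)
          let hl ← op (H l)
          let hr ← op (H r)
          let m ← op (max hl hr)
          op (m + 1))
      let H' ← op (Function.update H s h)
      heights G D ss H'

/-- Halve the number `x` as often as the first argument says. -/
noncomputable def halve : ℕ → ℝ → Timed ℝ
  | 0, x => pure x
  | k + 1, x => do
      let y ← op (x / 2)
      halve k y

/-- The main loop: compute the step functions of the listed states, children first. -/
noncomputable def process (G : BiddingGame S) (D : Children G) (maxRounds : ℕ) (ε : ℝ) :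
    List S → (S → List (Row S)) → Timed (S → List (Row S))
  | [], F => pure F
  | s :: ss, F => do
      let leaf ← op (decide (s ∈ G.T))
      let rows ← (if leaf then op [⟨0, s, (s, 0), (s, 0)⟩, ⟨1, s, (s, 1), (s, 1)⟩]
        else do
          let l ← op (D.left s)
          let r ← op (D.right s)
          let Fl ← op (F l)
          let Fr ← op (F r)
          let Bs ← criticalBudgets Fl Fr
          let all ← runAuctions G maxRounds ε l r Fl Fr Bs
          filterRows G all)
      let F' ← op (Function.update F s rows)
      process G D maxRounds ε ss F'

/-- A new table, with the entries `f`; every entry is written once. -/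
def newTable [Fintype S] {α : Type} (f : S → α) : Timed (S → α) := ⟨f, Fintype.card S⟩

/-- The algorithm.  It returns, for every state, the rows of its step function.  Bids rise by at
least `ε = 2 ^ (- h - 2)` from one round of an auction to the next, so an auction never has
more than `2 ^ (h + 2) + 1` rounds; this bound only serves to make the recursion terminate. -/
noncomputable def run [Fintype S] (G : BiddingGame S) (D : Children G) :
    Timed (S → List (Row S)) := do
  let visited ← newTable (fun _ : S => false)
  let σ ← visit G D (Fintype.card S) G.s₀ (visited, [])
  let H₀ ← newTable (fun _ : S => (0 : ℕ))
  let H ← heights G D σ.2 H₀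
  let h ← op (H G.s₀)
  let h' ← op (h + 2)
  let ε ← halve h' 1
  let F₀ ← newTable (fun _ : S => ([] : List (Row S)))
  process G D (2 ^ (h + 2) + 1) ε σ.2 F₀

/-- The value at `B` of the step function given by `rows`: the outcome in the last row whose cutoff
is at most `B`. -/
noncomputable def stepValue (rows : List (Row S)) (B : ℝ) : Option S :=
  ((rows.filter (fun r => decide (r.cut ≤ B))).getLast?).map Row.out

/-- `rows` describes a step function on `[0, 1]` with at most `n` intervals: the cutoffs increase
strictly from `0` to `1`, and there are at most `n + 1` of them. -/
structure IsStepFunction (rows : List (Row S)) (n : ℕ) : Prop where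
  increasing : (rows.map Row.cut).Pairwise (· < ·)
  first : (rows.map Row.cut).head? = some 0
  last : (rows.map Row.cut).getLast? = some 1
  length_le : rows.length ≤ n + 1

end FindPSPEFast

/-!
In units of the bid increment, budgets are integers between `0` and `N`, where `N` is a power of two.
At a state with two children, white ascends in bids `m`, and so descends in the budget `k - m`,
along the step function `X` of the child that white prefers; black moves up in the budget `k + m`
along the step function `Y` of the other one.  The lowest equilibrium of the turn is where this
auction comes to a halt (`Contest`, `Turn`): at every lower pair of bids the player who is outbid
wants to raise.

*Monotonicity.*  If the outcomes at the children get weakly better for white and weakly worse for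
black with the budget of white, then so do the results of the auction (`Turn.mono`).  In particular
the result is unique as an outcome, and a step function with monotone outcomes has at most as many
steps as there are terminal states.

*Critical budgets.*  Two auctions at neighbouring budgets can only have different results if one of
the players meets a cutoff in only one of them, or if the players meet a cutoff `x` of `X` and a
cutoff `y` of `Y` in different orders.  In the second case `(x + y) / 2` lies between the budgets.
So it suffices to run the auction at the cutoffs of the children and at these averages
(`Turn.const`).  Each level of the game halves the cutoffs once, so with the increment
`2 ^ (-height - 2)` all cutoffs at a state and at its children are even.  Thus a single increment
above an even budget crosses no cutoff, and budgets off the grid behave like those on it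
(`Turn.enlarge`, `Turn.top`).

*Acceleration.*  While both players stay in their intervals, nothing changes in the auction, so it
may skip to the next bid at which one of them crosses a cutoff; the invariant `Skipped` compares the
accelerated auction with the one without skips.  An auction has at most as many rounds as there are
intervals (`Setting.exists_skip`), independently of the number of bids.

*The game.*  A family of step functions that satisfies the recursion of the auction at every state
(`BiddingGame.IsValuation`) gives rise to a Lower PSPE, and every Lower PSPE has the outcomes of that
family (`BiddingGame.exists_isLowerPSPE`, `BiddingGame.represents_of_isLowerPSPE`).  The tables of
the algorithm form such a family (`FindPSPEFast.process_spec`).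
-/

/-! ### The ascending auction on the grid -/

namespace Auction

variable {α Λ : Type*} [LinearOrder Λ]

/-- Along `X`, outcomes get weakly better for white and weakly worse for black; `w` and `b` rank
the outcomes for white and for black. -/
structure Mono (w b : α → Λ) (X : ℤ → α) : Prop where
  white : ∀ x y, x ≤ y → w (X x) ≤ w (X y)
  black : ∀ x y, x ≤ y → b (X y) ≤ b (X x)

/-- The auction at white budget `k`, in which white wants to move to `X` and black to `Y`, comes to
the point where both players bid `m`.  The budget of black is `K`.  Every earlier raise of black
and every earlier match of white was profitable; by monotonicity, it suffices to say so
for the last ones. -/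
structure Reached (w b : α → Λ) (X Y : ℤ → α) (k K m : ℤ) : Prop where
  nonneg : 0 ≤ m
  le_white : m ≤ k
  le_black : m ≤ K
  accepts : w (Y (k + m)) < w (X (k - m))
  raises : 0 < m → b (X (k - m + 1)) < b (Y (k + m))

/-- The outcomes of the auction: either black does not raise the bid `m` of white, or black raises
it to `m + 1` and white does not match. -/
inductive Contest (w b : α → Λ) (X Y : ℤ → α) (k K : ℤ) : α → Prop where
  | white (m : ℤ) (reached : Reached w b X Y k K m)
      (halt : m + 1 ≤ K → b (Y (k + m + 1)) ≤ b (X (k - m))) : Contest w b X Y k K (X (k - m))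
  | black (m : ℤ) (reached : Reached w b X Y k K m) (le : m + 1 ≤ K)
      (gain : b (X (k - m)) < b (Y (k + m + 1)))
      (halt : m + 1 ≤ k → w (X (k - m - 1)) ≤ w (Y (k + m + 1))) :
      Contest w b X Y k K (Y (k + m + 1))

/-- The outcome of a turn in a state with the children `L` and `R`: the players agree on a child,
or they compete for the move. -/
inductive Turn (w b : α → Λ) (L R : ℤ → α) (k K : ℤ) (t : α) : Prop where
  | agree (mem : t = L k ∨ t = R k) (wl : w (L k) ≤ w t) (wr : w (R k) ≤ w t)
      (bl : b (L k) ≤ b t) (br : b (R k) ≤ b t) : Turn w b L R k K t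
  | left (hw : w (R k) < w (L k)) (hb : b (L k) < b (R k))
      (contest : Contest w b L R k K t) : Turn w b L R k K t
  | right (hw : w (L k) < w (R k)) (hb : b (R k) < b (L k))
      (contest : Contest w b R L k K t) : Turn w b L R k K t

section

variable {w b : α → Λ} {L R X Y : ℤ → α} {k K k' N : ℤ} {t t' : α}

theorem Contest.exists (hw : w (Y k) < w (X k)) (hk : 0 ≤ k) (hK : 0 ≤ K) :
    ∃ t, Contest w b X Y k K t := by
  classical
  -- the first bid of white that is not followed by another one
  have hex : ∃ j : ℕ, ¬ ((j : ℤ) + 1 ≤ k ∧ (j : ℤ) + 1 ≤ K ∧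
      b (X (k - j)) < b (Y (k + j + 1)) ∧ w (Y (k + j + 1)) < w (X (k - j - 1))) :=
    ⟨k.toNat, fun h => by omega⟩
  set m := Nat.find hex with hm
  have hlast := Nat.find_spec hex
  rw [← hm] at hlast
  have hr : Reached w b X Y k K m := by
    rcases Nat.eq_zero_or_pos m with h0 | h0
    · rw [h0]
      exact ⟨le_rfl, hk, hK, by simpa using hw, fun h => by simp at h⟩
    · obtain ⟨j, hj⟩ : ∃ j, m = j + 1 := ⟨m - 1, by omega⟩
      have hjm : j < m := by omega
      have := Nat.find_min hex hjm
      rw [not_not] at this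
      obtain ⟨h1, h2, h3, h4⟩ := this
      rw [hj]
      push_cast
      refine ⟨by omega, h1, h2, ?_, fun _ => ?_⟩
      · rw [show k + ((j : ℤ) + 1) = k + j + 1 by ring, show k - ((j : ℤ) + 1) = k - j - 1 by ring]
        exact h4
      · rw [show k + ((j : ℤ) + 1) = k + j + 1 by ring, show k - ((j : ℤ) + 1) + 1 = k - j by ring]
        exact h3
  by_cases hP : (m : ℤ) + 1 ≤ K ∧ b (X (k - m)) < b (Y (k + m + 1))
  · refine ⟨_, .black m hr hP.1 hP.2 fun h => ?_⟩
    by_contra! hlt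
    exact hlast ⟨h, hP.1, hP.2, hlt⟩
  · exact ⟨_, .white m hr fun h => not_lt.mp fun hlt => hP ⟨h, hlt⟩⟩

theorem Turn.exists (hinj : ∀ x y, w x = w y → b x = b y)
    (hk : 0 ≤ k) (hK : 0 ≤ K) : ∃ t, Turn w b L R k K t := by
  by_cases hw : w (L k) < w (R k)
  · by_cases hb : b (R k) < b (L k)
    · obtain ⟨t, ht⟩ := Contest.exists hw hk hK
      exact ⟨t, .right hw hb ht⟩
    · exact ⟨R k, .agree (.inr rfl) hw.le le_rfl (not_lt.mp hb) le_rfl⟩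
  · rcases (not_lt.mp hw).eq_or_lt with heq | hlt
    · have := hinj _ _ heq
      exact ⟨L k, .agree (.inl rfl) le_rfl heq.le le_rfl this.le⟩
    · by_cases hb : b (L k) < b (R k)
      · obtain ⟨t, ht⟩ := Contest.exists hlt hk hK
        exact ⟨t, .left hlt hb ht⟩
      · exact ⟨L k, .agree (.inl rfl) le_rfl hlt.le le_rfl (not_lt.mp hb)⟩

/-! Monotonicity in the budget.  In each case the claim either holds at once, or one of the
auctions has gone on beyond the point where the other one stopped, and at the shifted bids the
players of both auctions face the same comparison. -/

theorem Contest.mono_same (hX : Mono w b X) (hY : Mono w b Y) (hkk : k ≤ k')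
    (h : Contest w b X Y k (N - k) t) (h' : Contest w b X Y k' (N - k') t') :
    w t ≤ w t' ∧ b t' ≤ b t := by
  cases h with
  | white m h halt =>
    cases h' with
    | white m' h' halt' =>
      by_cases hc : k - m ≤ k' - m'
      · exact ⟨hX.white _ _ hc, hX.black _ _ hc⟩
      · exfalso
        have := h.nonneg; have := h'.le_black
        have h1 := h'.raises (by omega)
        have h2 := halt (by omega)
        have h3 := hY.black (k + m + 1) (k' + m') (by omega)
        have h4 := hX.black (k' - m' + 1) (k - m) (by omega)
        order
    | black m' h' le' gain' halt' =>
      by_cases hc : k' - m' ≤ k - m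
      · exfalso
        have h2 := halt (by omega)
        have h3 := hY.black (k + m + 1) (k' + m' + 1) (by omega)
        have h4 := hX.black (k' - m') (k - m) (by omega)
        order
      · constructor
        · have := h.le_white
          have h1 := halt' (by omega)
          have h2 := hX.white (k - m) (k' - m' - 1) (by omega)
          order
        · by_cases hd : k + m + 1 ≤ k' + m' + 1
          · have h2 := halt (by omega)
            have h3 := hY.black (k + m + 1) (k' + m' + 1) (by omega)
            order
          · exfalso
            have := h.le_white
            have h1 := h.accepts
            have h2 := halt' (by omega)
            have h3 := hY.white (k' + m' + 1) (k + m) (by omega)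
            have h4 := hX.white (k - m) (k' - m' - 1) (by omega)
            order
  | black m h le gain halt =>
    cases h' with
    | white m' h' halt' =>
      constructor
      · by_cases hc : k + m + 1 ≤ k' + m'
        · have h1 := hY.white _ _ hc
          have h2 := h'.accepts
          order
        · exfalso
          have h1 := halt' (by omega)
          have h2 := hY.black (k' + m' + 1) (k + m + 1) (by omega)
          have h3 := hX.black (k - m) (k' - m') (by omega)
          order
      · by_cases hc : k - m ≤ k' - m'
        · have h1 := hX.black _ _ hc
          order
        · exfalso
          have := h'.le_white
          have h1 := halt (by omega)
          have h2 := h'.accepts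
          have h3 := hX.white (k' - m') (k - m - 1) (by omega)
          have h4 := hY.white (k + m + 1) (k' + m') (by omega)
          order
    | black m' h' le' gain' halt' =>
      by_cases hc : k + m ≤ k' + m'
      · have hc' : k + m + 1 ≤ k' + m' + 1 := by omega
        exact ⟨hY.white _ _ hc', hY.black _ _ hc'⟩
      · exfalso
        have := h.le_white
        have h1 := h.accepts
        have h2 := halt' (by omega)
        have h3 := hY.white (k' + m' + 1) (k + m) (by omega)
        have h4 := hX.white (k - m) (k' - m' - 1) (by omega)
        order

/-- Monotonicity when the players exchange their favourite children between the two budgets. -/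
theorem Contest.mono_swap (hX : Mono w b X) (hY : Mono w b Y) (hkk : k ≤ k')
    (hb' : b (Y k') < b (X k'))
    (h : Contest w b X Y k (N - k) t) (h' : Contest w b Y X k' (N - k') t') :
    w t ≤ w t' ∧ b t' ≤ b t := by
  cases h with
  | white m h halt =>
    have := h.nonneg
    cases h' with
    | white m' h' halt' =>
      have := h'.nonneg
      have h1 := h'.accepts
      have h2 := hX.white (k - m) (k' + m') (by omega)
      refine ⟨by order, ?_⟩
      by_cases hc : k + m + 1 ≤ k' - m'
      · have := h'.le_black
        have h3 := halt (by omega)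
        have h4 := hY.black _ _ hc
        order
      · exfalso
        have h3 := h.accepts
        have h4 := hY.white (k' - m') (k + m) (by omega)
        order
    | black m' h' le' gain' halt' =>
      have := h'.nonneg
      have hc : k - m ≤ k' + m' + 1 := by omega
      exact ⟨hX.white _ _ hc, hX.black _ _ hc⟩
  | black m h le gain halt =>
    have := h.nonneg
    cases h' with
    | white m' h' halt' =>
      have := h'.nonneg
      by_cases hc : k + m + 1 ≤ k' - m'
      · exact ⟨hY.white _ _ hc, hY.black _ _ hc⟩
      · exfalso
        by_cases hd : k' ≤ k + m + 1
        · have h1 := hY.black k' (k + m + 1) hd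
          have h2 := hX.black (k - m) k' (by omega)
          order
        · have h1 := h'.raises (by omega)
          have h2 := hY.black (k' - m' + 1) (k + m + 1) (by omega)
          have h3 := hX.black (k - m) (k' + m') (by omega)
          order
    | black m' h' le' gain' halt' =>
      have := h'.nonneg
      have h0 := hX.black (k - m) (k' + m' + 1) (by omega)
      refine ⟨?_, by order⟩
      by_contra! hlt
      have h1 := hX.black (k - m) k' (by omega)
      have hd : k + m + 1 < k' := by
        by_contra hd
        have := hY.black k' (k + m + 1) (by omega)
        order
      have hc : k' - m' ≤ k + m + 1 := by
        by_contra hc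
        have := h.le_white
        have h2 := halt' (by omega)
        have h3 := hY.white (k + m + 1) (k' - m' - 1) (by omega)
        order
      have h2 := hY.black _ _ hc
      order

theorem Contest.mono_of_agree (hX : Mono w b X) (hY : Mono w b Y) (hk : 0 ≤ k) (hkk : k ≤ k')
    (mem : t = X k ∨ t = Y k) (wx : w (X k) ≤ w t) (bx : b (X k) ≤ b t) (bY : b (Y k) ≤ b t)
    (h' : Contest w b X Y k' (N - k') t') : w t ≤ w t' ∧ b t' ≤ b t := by
  cases h' with
  | white m' h' halt' =>
    have := h'.nonneg
    have h1 := h'.accepts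
    have h2 := hY.white k (k' + m') (by omega)
    have h3 := hY.black k (k' + m') (by omega)
    by_cases hc : k ≤ k' - m'
    · have h4 := hX.white _ _ hc
      have h5 := hX.black _ _ hc
      rcases mem with rfl | rfl <;> constructor <;> order
    · have h4 := h'.raises (by omega)
      have h5 := hX.black (k' - m' + 1) k (by omega)
      have h6 := hX.white (k' - m') k (by omega)
      rcases mem with rfl | rfl <;> exfalso <;> order
  | black m' h' le' gain' halt' =>
    have := h'.nonneg
    have h2 := hY.white k (k' + m' + 1) (by omega)
    have h3 := hY.black k (k' + m' + 1) (by omega)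
    refine ⟨?_, by order⟩
    rcases mem with rfl | rfl
    · by_cases hc : k ≤ k' - m' - 1
      · have h4 := halt' (by omega)
        have h5 := hX.white _ _ hc
        order
      · have h5 := hX.black (k' - m') k (by omega)
        order
    · exact h2

theorem Contest.mono_agree (hX : Mono w b X) (hY : Mono w b Y) (hkk : k ≤ k')
    (mem : t' = X k' ∨ t' = Y k') (wx : w (X k') ≤ w t') (wY : w (Y k') ≤ w t')
    (bY : b (Y k') ≤ b t') (h : Contest w b X Y k (N - k) t) (hN : k' ≤ N) :
    w t ≤ w t' ∧ b t' ≤ b t := by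
  cases h with
  | white m h halt =>
    have := h.nonneg
    have h1 := hX.white (k - m) k' (by omega)
    have h2 := hX.black (k - m) k' (by omega)
    refine ⟨by order, ?_⟩
    rcases mem with rfl | rfl
    · exact h2
    · by_cases hc : k + m + 1 ≤ k'
      · have h3 := halt (by omega)
        have h4 := hY.black _ _ hc
        order
      · exfalso
        have h3 := hY.white k' (k + m) (by omega)
        have h4 := h.accepts
        order
  | black m h le gain halt =>
    have := h.nonneg
    have h1 := hX.white (k - m) k' (by omega)
    have h2 := hX.black (k - m) k' (by omega)
    by_cases hc : k + m + 1 ≤ k'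
    · have h3 := hY.white _ _ hc
      have h4 := hY.black _ _ hc
      rcases mem with rfl | rfl <;> constructor <;> order
    · exfalso
      have h3 := hY.white k' (k + m) (by omega)
      have h4 := h.accepts
      have h5 := hY.black k' (k + m + 1) (by omega)
      rcases mem with rfl | rfl <;> order

/-- The outcome of a turn gets weakly better for white, and weakly worse for black, with the budget
of white. -/
theorem Turn.mono (hL : Mono w b L) (hR : Mono w b R) (hk : 0 ≤ k) (hkk : k ≤ k') (hN : k' ≤ N)
    (h : Turn w b L R k (N - k) t) (h' : Turn w b L R k' (N - k') t') :
    w t ≤ w t' ∧ b t' ≤ b t := by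
  cases h with
  | agree mem wl wr bl br =>
    cases h' with
    | agree mem' wl' wr' bl' br' =>
      have h1 := hL.white _ _ hkk
      have h2 := hR.white _ _ hkk
      have h3 := hL.black _ _ hkk
      have h4 := hR.black _ _ hkk
      rcases mem with rfl | rfl <;> rcases mem' with rfl | rfl <;> constructor <;> order
    | left hw' hb' c' => exact Contest.mono_of_agree hL hR hk hkk mem wl bl br c'
    | right hw' hb' c' => exact Contest.mono_of_agree hR hL hk hkk mem.symm wr br bl c'
  | left hw hb c =>
    cases h' with
    | agree mem' wl' wr' bl' br' => exact Contest.mono_agree hL hR hkk mem' wl' wr' br' c hN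
    | left hw' hb' c' => exact Contest.mono_same hL hR hkk c c'
    | right hw' hb' c' => exact Contest.mono_swap hL hR hkk hb' c c'
  | right hw hb c =>
    cases h' with
    | agree mem' wl' wr' bl' br' => exact Contest.mono_agree hR hL hkk mem'.symm wr' wl' bl' c hN
    | left hw' hb' c' => exact Contest.mono_swap hR hL hkk hb' c c'
    | right hw' hb' c' => exact Contest.mono_same hR hL hkk c c'

theorem Turn.unique (hL : Mono w b L) (hR : Mono w b R) (hk : 0 ≤ k) (hN : k ≤ N)
    (h : Turn w b L R k (N - k) t) (h' : Turn w b L R k (N - k) t') : w t = w t' :=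
  le_antisymm (Turn.mono hL hR hk le_rfl hN h h').1 (Turn.mono hL hR hk le_rfl hN h' h).1

end

end Auction

/-! ### Constancy between critical budgets -/

namespace Auction

/-- `X` is a step function on `[0, N]`, extended by constants, with the set of cutoffs `C`; `0` and
`N` count as cutoffs.  Every `c` lies in an interval of constancy from a cutoff on (`floor`) and
up to the next cutoff, which is not included (`next`). -/
structure IsStep {α : Type*} (N : ℤ) (C : ℤ → Prop) (X : ℤ → α) : Prop where
  zero : C 0
  top : C N
  floor : ∀ c, 0 ≤ c → ∃ x, C x ∧ 0 ≤ x ∧ x ≤ c ∧ ∀ z, x ≤ z → z ≤ c → X z = X c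
  next : ∀ c, c < N → ∃ y, C y ∧ c < y ∧ ∀ z, c ≤ z → z < y → X z = X c
  below : ∀ z, z ≤ 0 → X z = X 0

section

variable {α Λ : Type*} [LinearOrder Λ] {w b : α → Λ} {L R X Y : ℤ → α} {C D : ℤ → Prop}
  {k K k' N : ℤ} {t t' : α}

theorem IsStep.odd_eq (hX : IsStep N C X) (hC : ∀ x, C x → Even x) {z : ℤ} (hz : Odd z) :
    X z = X (z - 1) := by
  by_cases h : 0 ≤ z
  · obtain ⟨x, hx, _, hxz, hconst⟩ := hX.floor z h
    have hne : x ≠ z := by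
      rintro rfl
      exact (Int.not_even_iff_odd.mpr hz) (hC _ hx)
    exact (hconst (z - 1) (by omega) (by omega)).symm
  · rw [hX.below z (by omega), hX.below (z - 1) (by omega)]

/-- No cutoff of `X` or `Y` and no average of a cutoff of `X` and a cutoff of `Y` lies in the
interval `(k, k']`. -/
structure NoCritical (C D : ℤ → Prop) (k k' : ℤ) : Prop where
  left : ∀ x, C x → k < x → k' < x
  right : ∀ y, D y → k < y → k' < y
  average : ∀ x y, C x → D y → 2 * k < x + y → 2 * k' < x + y

theorem NoCritical.swap (h : NoCritical C D k k') : NoCritical D C k k' :=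
  ⟨h.right, h.left, fun x y hx hy hlt => by
    have := h.average y x hy hx (by omega)
    omega⟩

/-- Between critical budgets the result of the auction is constant.  If white did strictly better
at `k'` than at `k`, then there would be a cutoff `x` of `X` that is crossed in the descent of
white from `k` but not in the descent from `k'`, and a cutoff `y` of `Y` for which it is the other
way round; so white would meet `x` before black meets `y` at `k`, and after that at `k'`,
and `(x + y) / 2` would lie between `k` and `k'`. -/
theorem Contest.const (hX : Mono w b X) (hY : Mono w b Y) (sX : IsStep N C X) (sY : IsStep N D Y)
    (hC : ∀ x, C x → Even x) (hD : ∀ x, D x → Even x) (hcrit : NoCritical C D k k')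
    (h : Contest w b X Y k (N - k) t) (h' : Contest w b X Y k' (N - k') t') :
    w t' ≤ w t ∨ b t ≤ b t' := by
  by_contra! hlt
  obtain ⟨hw, hb⟩ := hlt
  -- the contradiction that is reached in all cases
  have key : ∀ x y, C x → D y → 2 * k < x + y → x + y ≤ 2 * k' + 1 → False := by
    intro x y hx hy h1 h2
    have h3 := hcrit.average x y hx hy h1
    obtain ⟨p, hp⟩ := hC x hx
    obtain ⟨q, hq⟩ := hD y hy
    omega
  cases h with
  | white m h halt =>
    have := h.nonneg; have := h.le_black
    cases h' with
    | white m' h' halt' =>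
      have := h'.nonneg; have := h'.le_black; have := h'.le_white
      obtain ⟨x, hx, _, hxc, hxe⟩ := sX.floor (k' - m') (by omega)
      have hlow : k - m < x := by
        by_contra hlow
        by_cases hc : k - m ≤ k' - m'
        · rw [hxe _ (by omega) hc] at hw
          order
        · have := hX.white (k' - m') (k - m) (by omega)
          order
      have hxk : x ≤ k := by
        by_contra hxk
        have := hcrit.left x hx (by omega)
        omega
      have h1 := h.raises (by omega)
      have h2 := hX.black (k - m + 1) x (by omega)
      have h3 := hY.black (2 * k - x + 1) (k + m) (by omega)
      have h4 : X x = X (k' - m') := hxe x le_rfl hxc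
      by_cases hK : m' + 1 ≤ N - k'
      · have h5 := halt' hK
        rw [h4] at h2
        have hlt : 2 * k - x + 1 < k' + m' + 1 := by
          by_contra hge
          have := hY.black (k' + m' + 1) (2 * k - x + 1) (by omega)
          order
        obtain ⟨y, hy, hyc, hye⟩ := sY.next (2 * k - x + 1) (by omega)
        have hyle : y ≤ k' + m' + 1 := by
          by_contra hyle
          rw [hye (k' + m' + 1) (by omega) (by omega)] at h5
          order
        exact key x y hx hy (by omega) (by omega)
      · exact key x N hx sY.top (by omega) (by omega)
    | black m' h' le' gain' halt' =>
      have := h'.nonneg; have := h'.le_black; have := h'.le_white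
      obtain ⟨x, hx, _, hxc, hxe⟩ := sX.floor (k' - m') (by omega)
      have hlow : k - m < x := by
        by_contra hlow
        by_cases hc : k - m ≤ k' - m'
        · rw [hxe _ (by omega) hc] at hb
          order
        · have := hX.black (k' - m') (k - m) (by omega)
          order
      have h1 := h.accepts
      have hlt : k + m < k' + m' + 1 := by
        by_contra hge
        have := hY.white (k' + m' + 1) (k + m) (by omega)
        order
      obtain ⟨y, hy, hyc, hye⟩ := sY.next (k + m) (by omega)
      have hyle : y ≤ k' + m' + 1 := by
        by_contra hyle
        rw [hye (k' + m' + 1) (by omega) (by omega)] at hw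
        order
      exact key x y hx hy (by omega) (by omega)
  | black m h le gain halt =>
    have := h.nonneg; have := h.le_white
    cases h' with
    | white m' h' halt' =>
      have := h'.nonneg; have := h'.le_black; have := h'.le_white
      obtain ⟨x, hx, hxc, hxl⟩ : ∃ x, C x ∧ x ≤ k' - m' ∧ k - m ≤ x := by
        by_cases hk : m + 1 ≤ k
        · have h1 := halt hk
          obtain ⟨x, hx, _, hxc, hxe⟩ := sX.floor (k' - m') (by omega)
          refine ⟨x, hx, hxc, ?_⟩
          by_contra hlow
          by_cases hc : k - m - 1 ≤ k' - m'
          · rw [hxe _ (by omega) hc] at h1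
            order
          · have := hX.white (k' - m') (k - m - 1) (by omega)
            order
        · exact ⟨0, sX.zero, by omega, by omega⟩
      by_cases hK : m' + 1 ≤ N - k'
      · have h5 := halt' hK
        have hlt : k + m + 1 < k' + m' + 1 := by
          by_contra hge
          have := hY.black (k' + m' + 1) (k + m + 1) (by omega)
          order
        obtain ⟨y, hy, hyc, hye⟩ := sY.next (k + m + 1) (by omega)
        have hyle : y ≤ k' + m' + 1 := by
          by_contra hyle
          rw [hye (k' + m' + 1) (by omega) (by omega)] at h5
          order
        exact key x y hx hy (by omega) (by omega)
      · exact key x N hx sY.top (by omega) (by omega)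
    | black m' h' le' gain' halt' =>
      have := h'.nonneg; have := h'.le_white
      have hlt : k + m + 1 < k' + m' + 1 := by
        by_contra hge
        have := hY.white (k' + m' + 1) (k + m + 1) (by omega)
        order
      obtain ⟨y, hy, hyc, hye⟩ := sY.next (k + m + 1) (by omega)
      have hyle : y ≤ k' + m' + 1 := by
        by_contra hyle
        rw [hye (k' + m' + 1) (by omega) (by omega)] at hw
        order
      have hyk := hcrit.right y hy (by omega)
      by_cases hk : m + 1 ≤ k
      · have h1 := halt hk
        have h2 := h'.accepts
        have h3 := hX.white (k' - m') (2 * k' - y + 1) (by omega)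
        have h4 := hY.white (y - 1) (k' + m') (by omega)
        have h5 := hye (y - 1) (by omega) (by omega)
        rw [h5] at h4
        obtain ⟨x, hx, _, hxc, hxe⟩ := sX.floor (2 * k' - y + 1) (by omega)
        have hlow : k - m - 1 < x := by
          by_contra hlow
          by_cases hc : k - m - 1 ≤ 2 * k' - y + 1
          · rw [hxe _ (by omega) hc] at h1
            order
          · have := hX.white (2 * k' - y + 1) (k - m - 1) (by omega)
            order
        exact key x y hx hy (by omega) (by omega)
      · exact key 0 y sX.zero hy (by omega) (by omega)

/-- Between critical budgets the result of a turn is constant. -/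
theorem Turn.const (hinj : ∀ x y, w x = w y ↔ b x = b y)
    (hL : Mono w b L) (hR : Mono w b R) (sL : IsStep N C L) (sR : IsStep N D R)
    (hC : ∀ x, C x → Even x) (hD : ∀ x, D x → Even x) (hcrit : NoCritical C D k k')
    (hk : 0 ≤ k) (hkk : k ≤ k') (hN : k' ≤ N)
    (h : Turn w b L R k (N - k) t) (h' : Turn w b L R k' (N - k') t') : w t = w t' := by
  have hconst : ∀ {X : ℤ → α} {C : ℤ → Prop}, IsStep N C X → (∀ x, C x → k < x → k' < x) →
      X k' = X k := by
    intro X C sX hno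
    obtain ⟨x, hx, _, hxk, hxe⟩ := sX.floor k' (by omega)
    have : x ≤ k := by
      by_contra hlt
      have := hno x hx (by omega)
      omega
    exact (hxe k this hkk).symm
  have eL := hconst sL hcrit.left
  have eR := hconst sR hcrit.right
  have hmono := Turn.mono hL hR hk hkk hN h h'
  have finish : (w t' ≤ w t ∨ b t ≤ b t') → w t = w t' := by
    rintro (h1 | h1)
    · exact le_antisymm hmono.1 h1
    · exact (hinj _ _).mpr (le_antisymm h1 hmono.2)
  cases h with
  | agree mem wl wr bl br =>
    cases h' with
    | agree mem' wl' wr' bl' br' =>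
      rw [eL, eR] at mem'
      rcases mem' with rfl | rfl
      · exact finish (.inl wl)
      · exact finish (.inl wr)
    | left hw' hb' c' =>
      rw [eL, eR] at hw' hb'
      rcases mem with rfl | rfl <;> order
    | right hw' hb' c' =>
      rw [eL, eR] at hw' hb'
      rcases mem with rfl | rfl <;> order
  | left hw hb c =>
    cases h' with
    | agree mem' wl' wr' bl' br' =>
      rw [eL] at wl' bl'
      rw [eR] at wr' br'
      rw [eL, eR] at mem'
      rcases mem' with rfl | rfl <;> order
    | left hw' hb' c' => exact finish (Contest.const hL hR sL sR hC hD hcrit c c')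
    | right hw' hb' c' =>
      rw [eL, eR] at hw'
      order
  | right hw hb c =>
    cases h' with
    | agree mem' wl' wr' bl' br' =>
      rw [eL] at wl' bl'
      rw [eR] at wr' br'
      rw [eL, eR] at mem'
      rcases mem' with rfl | rfl <;> order
    | left hw' hb' c' =>
      rw [eL, eR] at hw'
      order
    | right hw' hb' c' => exact finish (Contest.const hR hL sR sL hD hC hcrit.swap c c')

/-- Black cannot gain from bidding all of a budget that is a multiple of the increment.  So it
does not matter whether the total number `k + K` of increments that the players can bid is `N` or,
as for budgets off the grid, `N - 1`. -/
theorem Contest.enlarge (sX : IsStep N C X)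
    (hC : ∀ x, C x → Even x) (hN : Even N) (yw : w (Y N) = w (Y (N - 1)))
    (h : Contest w b X Y k (N - k - 1) t) : ∃ t', Contest w b X Y k (N - k) t' ∧ w t = w t' := by
  cases h with
  | black m h le gain halt =>
    exact ⟨_, .black m ⟨h.nonneg, h.le_white, by have := h.le_black; omega, h.accepts, h.raises⟩
      (by omega) gain halt, rfl⟩
  | white m h halt =>
    have hr : Reached w b X Y k (N - k) m :=
      ⟨h.nonneg, h.le_white, by have := h.le_black; omega, h.accepts, h.raises⟩
    by_cases hm : m + 1 ≤ N - k - 1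
    · exact ⟨_, .white m hr fun _ => halt hm, rfl⟩
    · have hmk : m = N - k - 1 := by have := h.le_black; omega
      have hNe : k + m + 1 = N := by omega
      by_cases hP : b (Y (k + m + 1)) ≤ b (X (k - m))
      · exact ⟨_, .white m hr fun _ => hP, rfl⟩
      · -- white matches, and then black cannot raise any more
        obtain ⟨n, hn⟩ := hN
        have hX : X (k - m) = X (k - (m + 1)) := by
          rw [show k - (m + 1) = k - m - 1 by ring]
          exact sX.odd_eq hC ⟨k - n, by omega⟩
        have h1 := h.accepts
        have := h.nonneg
        have := h.le_white
        refine ⟨_, .white (m + 1) ⟨by omega, by omega, by omega, ?_, fun _ => ?_⟩ fun h => by omega,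
          by rw [hX]⟩
        · rw [show k + (m + 1) = N by omega, yw, ← hX, show N - 1 = k + m by omega]
          exact h1
        · rw [show k - (m + 1) + 1 = k - m by ring, show k + (m + 1) = k + m + 1 by ring]
          exact not_le.mp hP

theorem Turn.enlarge (sL : IsStep N C L) (sR : IsStep N D R)
    (hC : ∀ x, C x → Even x) (hD : ∀ x, D x → Even x) (hN : Even N)
    (lw : w (L N) = w (L (N - 1))) (rw : w (R N) = w (R (N - 1)))
    (h : Turn w b L R k (N - k - 1) t) : ∃ t', Turn w b L R k (N - k) t' ∧ w t = w t' := by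
  cases h with
  | agree mem wl wr bl br => exact ⟨t, .agree mem wl wr bl br, rfl⟩
  | left hw hb c =>
    obtain ⟨t', c', h⟩ := c.enlarge sL hC hN rw
    exact ⟨t', .left hw hb c', h⟩
  | right hw hb c =>
    obtain ⟨t', c', h⟩ := c.enlarge sR hD hN lw
    exact ⟨t', .right hw hb c', h⟩

theorem Contest.top (sX : IsStep N C X) (hC : ∀ x, C x → Even x) (hN : Even N) (hN2 : 2 ≤ N)
    (xw : w (X N) = w (X (N - 1))) (hb : b (X (N - 1)) < b (Y N)) (hw : w (Y N) < w (X N))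
    (h : Contest w b X Y N 0 t) : ∃ t', Contest w b X Y (N - 1) 1 t' ∧ w t = w t' := by
  have hX : X (N - 1) = X (N - 1 - 1) := by
    obtain ⟨n, hn⟩ := hN
    exact sX.odd_eq hC ⟨n - 1, by omega⟩
  cases h with
  | black m h le => have := h.nonneg; omega
  | white m h halt =>
    have : m = 0 := le_antisymm h.le_black h.nonneg
    subst this
    refine ⟨_, .white 1 ⟨by omega, by omega, le_rfl, ?_, fun _ => ?_⟩ fun h => by omega, ?_⟩
    · rw [show N - 1 + 1 = N by ring, ← hX, ← xw]
      exact hw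
    · simpa using hb
    · rw [sub_zero, xw, hX]

/-- The outcome of a turn at `N` is that at `N - 1`: white does not gain from a budget of everything
instead of almost everything. -/
theorem Turn.top (hinj : ∀ x y, w x = w y ↔ b x = b y) (hL : Mono w b L) (hR : Mono w b R)
    (sL : IsStep N C L) (sR : IsStep N D R)
    (hC : ∀ x, C x → Even x) (hD : ∀ x, D x → Even x) (hN : Even N) (hN2 : 2 ≤ N)
    (lw : w (L N) = w (L (N - 1))) (rw : w (R N) = w (R (N - 1)))
    (h : Turn w b L R (N - 1) 1 t) (h' : Turn w b L R N 0 t') : w t = w t' := by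
  have lb := (hinj _ _).mp lw
  have rb := (hinj _ _).mp rw
  have huniq : ∀ t'', Turn w b L R (N - 1) 1 t'' → w t = w t'' := fun t'' h'' => by
    have h1 : N - (N - 1) = 1 := by ring
    exact Turn.unique (k := N - 1) (N := N) hL hR (by omega) (by omega)
      (h1.symm ▸ h) (h1.symm ▸ h'')
  cases h' with
  | agree mem wl wr bl br =>
    rw [lw] at wl
    rw [rw] at wr
    rw [lb] at bl
    rw [rb] at br
    rcases mem with rfl | rfl
    · rw [lw]
      rw [lw] at wl wr
      rw [lb] at bl br
      exact huniq _ (.agree (.inl rfl) wl wr bl br)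
    · rw [rw]
      rw [rw] at wl wr
      rw [rb] at bl br
      exact huniq _ (.agree (.inr rfl) wl wr bl br)
  | left hw hb c =>
    obtain ⟨t'', c', h'⟩ := c.top sL hC hN hN2 lw (by rwa [← lb]) hw
    rw [h']
    exact huniq _ (.left (by rwa [← lw, ← rw]) (by rwa [← lb, ← rb]) c')
  | right hw hb c =>
    obtain ⟨t'', c', h'⟩ := c.top sR hD hN hN2 rw (by rwa [← rb]) hw
    rw [h']
    exact huniq _ (.right (by rwa [← lw, ← rw]) (by rwa [← lb, ← rb]) c')

end

end Auction

/-! ### Equilibria of a turn -/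

namespace BiddingGame

open Auction

section Scores

variable {S : Type} (G : BiddingGame S)

/-- The rank of an outcome for player `i`: utilities are compared first, and ties are broken in
favour of the opponent. -/
noncomputable def score (i : Player) (t : S) : ℝ ×ₗ ℝ := toLex (G.u i t, G.u i.other t)

/-- The rank of an outcome for white. -/
noncomputable abbrev wScore : S → ℝ ×ₗ ℝ := G.score Player.white

/-- The rank of an outcome for black. -/
noncomputable abbrev bScore : S → ℝ ×ₗ ℝ := G.score Player.black

theorem prefers_iff (i : Player) (t t' : S) : G.Prefers i t t' ↔ G.score i t' < G.score i t := by
  unfold Prefers score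
  rw [Prod.Lex.toLex_lt_toLex]
  simp only [eq_comm]

theorem score_eq_iff (i : Player) (t t' : S) : G.score i t = G.score i t' ↔ G.SameOutcome t t' := by
  unfold score SameOutcome
  rw [EmbeddingLike.apply_eq_iff_eq, Prod.mk.injEq]
  constructor
  · rintro ⟨h1, h2⟩ j
    cases i <;> cases j <;> assumption
  · intro h
    exact ⟨h _, h _⟩

theorem wScore_eq_iff (t t' : S) : G.wScore t = G.wScore t' ↔ G.bScore t = G.bScore t' :=
  (G.score_eq_iff _ t t').trans (G.score_eq_iff _ t t').symm

/-- Monotonicity of the outcome in the budget of white. -/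
abbrev MonoOutcome (X : ℤ → S) : Prop := Mono G.wScore G.bScore X

end Scores

variable {S : Type} [Finite S] {G : BiddingGame S}

/-- The number of bid increments in the total budget. -/
noncomputable def gridSize (G : BiddingGame S) : ℤ := 2 ^ (G.height G.s₀ + 2)

theorem increment_pos : 0 < G.increment := by unfold increment; positivity

theorem gridSize_mul_increment : (G.gridSize : ℝ) * G.increment = 1 := by
  unfold gridSize increment
  push_cast
  rw [← mul_pow]
  norm_num

theorem gridSize_pos : 0 < G.gridSize := by unfold gridSize; positivity

/-- The number of whole increments in the budget `B`. -/
noncomputable def units (G : BiddingGame S) (B : ℝ) : ℤ := ⌊B * G.gridSize⌋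

theorem le_units {B : ℝ} {m : ℤ} : m ≤ G.units B ↔ m * G.increment ≤ B := by
  have h := G.gridSize_mul_increment
  have hN : (0 : ℝ) < G.gridSize := by exact_mod_cast G.gridSize_pos
  rw [units, Int.le_floor, ← mul_le_mul_iff_left₀ hN (b := m * G.increment), mul_assoc,
    mul_comm G.increment, h, mul_one]

theorem units_sub (B : ℝ) (m : ℤ) : G.units (B - m * G.increment) = G.units B - m := by
  have h := G.gridSize_mul_increment
  have : (B - m * G.increment) * G.gridSize = B * G.gridSize - m := by linear_combination -m * h
  rw [units, this, Int.floor_sub_intCast, units]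

theorem units_add (B : ℝ) (m : ℤ) : G.units (B + m * G.increment) = G.units B + m := by
  have := G.units_sub B (-m)
  push_cast at this
  rw [show B + m * G.increment = B - -m * G.increment by ring, this]
  ring

theorem units_nonneg {B : ℝ} (hB : 0 ≤ B) : 0 ≤ G.units B := le_units.mpr (by simpa using hB)

theorem units_le {B : ℝ} (hB : B ≤ 1) : G.units B ≤ G.gridSize := by
  have h := G.gridSize_mul_increment
  by_contra! hlt
  have h1 := le_units.mp (Int.add_one_le_iff.mpr hlt)
  push_cast at h1
  have := G.increment_pos
  nlinarith

theorem units_one_sub (B : ℝ) :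
    G.units (1 - B) = G.gridSize - G.units B ∨ G.units (1 - B) = G.gridSize - G.units B - 1 := by
  have h1 : G.units B * G.increment ≤ B := le_units.mp le_rfl
  have h2 : ¬ (G.units B + 1 : ℤ) * G.increment ≤ B := fun h => by
    have := le_units.mpr h
    omega
  have h3 : G.units (1 - B) * G.increment ≤ 1 - B := le_units.mp le_rfl
  have h := G.gridSize_mul_increment
  have hp := G.increment_pos
  have h4 : G.units (1 - B) ≤ G.gridSize - G.units B := by
    by_contra! hlt
    have : ((G.gridSize - G.units B + 1 : ℤ) : ℝ) ≤ G.units (1 - B) := by exact_mod_cast hlt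
    push_cast at this h2
    nlinarith
  have h5 : G.gridSize - G.units B - 1 ≤ G.units (1 - B) := by
    rw [le_units]
    push_cast at h2 ⊢
    nlinarith
  omega

/-- On the unit interval, the outcomes of play in `c` according to `μ` are the values of the step
function `X` at the number of whole increments of the budget. -/
def Represents (G : BiddingGame S) (μ : ℝ → S) (X : ℤ → S) : Prop :=
  ∀ B ∈ Set.Icc (0 : ℝ) 1, ∀ i, G.score i (μ B) = G.score i (X (G.units B))

theorem IsLegal.exists_units {s : S} {B : ℝ} {i : Player} {x : Action S}
    (h : G.IsLegal G.gridBids s B i x) :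
    ∃ m : ℤ, 0 ≤ m ∧ m ≤ G.units (budget B i) ∧ x.bid = m * G.increment := by
  obtain ⟨m, hm⟩ := h.bid_mem
  refine ⟨m, by omega, ?_, by rw [hm]; simp⟩
  rw [le_units]
  have := h.bid_le
  rw [hm] at this
  simpa using this

theorem isLegal_of_units {s c : S} {B : ℝ} {i : Player} {m : ℤ} (h0 : 0 ≤ m)
    (hm : m ≤ G.units (budget B i)) (hc : c ∈ G.g s) :
    G.IsLegal G.gridBids s B i ⟨m * G.increment, c⟩ where
  bid_mem := ⟨m.toNat, by
    have : ((m.toNat : ℤ) : ℝ) = m := by rw [Int.toNat_of_nonneg h0]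
    rw [← this, Int.cast_natCast]⟩
  bid_nonneg := mul_nonneg (by exact_mod_cast h0) increment_pos.le
  bid_le := le_units.mp hm
  next_mem := hc

/-- The pair of an action of white and an action of black. -/
def actions (x y : Action S) : Player → Action S
  | Player.white => x
  | Player.black => y

section Turn

variable {μ : S → ℝ → S} {V : S → ℤ → S} {s : S} {B : ℝ} {a : Player → Action S}

theorem score_stageOutcome_white (hB : B ∈ Set.Icc (0 : ℝ) 1)
    (hμ : ∀ c ∈ G.g s, G.Represents (μ c) (V c))
    (ha : G.IsLegal G.gridBids s B Player.white (a Player.white)) {p q : ℤ}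
    (hp : (a Player.white).bid = p * G.increment) (hq : (a Player.black).bid = q * G.increment)
    (hqp : q ≤ p) (i : Player) :
    G.score i (stageOutcome μ B a) = G.score i (V (a Player.white).next (G.units B - p)) := by
  have hle : (a Player.black).bid ≤ (a Player.white).bid := by
    rw [hp, hq]
    exact mul_le_mul_of_nonneg_right (by exact_mod_cast hqp) increment_pos.le
  rw [stageOutcome, if_pos hle, ← units_sub, ← hp]
  have h1 := ha.bid_le
  have h2 := ha.bid_nonneg
  simp only [budget] at h1
  exact hμ _ ha.next_mem _ ⟨by linarith, by linarith [hB.2]⟩ i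

theorem score_stageOutcome_black (hB : B ∈ Set.Icc (0 : ℝ) 1)
    (hμ : ∀ c ∈ G.g s, G.Represents (μ c) (V c))
    (ha : G.IsLegal G.gridBids s B Player.black (a Player.black)) {p q : ℤ}
    (hp : (a Player.white).bid = p * G.increment) (hq : (a Player.black).bid = q * G.increment)
    (hpq : p < q) (i : Player) :
    G.score i (stageOutcome μ B a) = G.score i (V (a Player.black).next (G.units B + q)) := by
  have hle : ¬ (a Player.black).bid ≤ (a Player.white).bid := by
    rw [hp, hq, not_le]
    exact mul_lt_mul_of_pos_right (by exact_mod_cast hpq) increment_pos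
  rw [stageOutcome, if_neg hle, ← units_add, ← hq]
  have h1 := ha.bid_le
  have h2 := ha.bid_nonneg
  simp only [budget] at h1
  exact hμ _ ha.next_mem _ ⟨by linarith [hB.1], by linarith⟩ i

/-- Sufficient conditions for an equilibrium in which white takes the turn. -/
theorem isStageEquilibrium_white (hB : B ∈ Set.Icc (0 : ℝ) 1)
    (hμ : ∀ c ∈ G.g s, G.Represents (μ c) (V c)) {p : ℤ} {c c' : S} (hc : c ∈ G.g s)
    (hc' : c' ∈ G.g s) (hp : 0 ≤ p) (hpk : p ≤ G.units B) (hpK : p ≤ G.units (1 - B))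
    (raise : ∀ d ∈ G.g s, ∀ p', p ≤ p' →
      G.wScore (V d (G.units B - p')) ≤ G.wScore (V c (G.units B - p)))
    (lower : 0 < p → G.wScore (V c' (G.units B + p)) ≤ G.wScore (V c (G.units B - p)))
    (outbid : ∀ d ∈ G.g s, ∀ q', p < q' → q' ≤ G.units (1 - B) →
      G.bScore (V d (G.units B + q')) ≤ G.bScore (V c (G.units B - p))) :
    G.IsStageEquilibrium G.gridBids μ s B
      (actions ⟨p * G.increment, c⟩ ⟨p * G.increment, c'⟩) := by
  have hw : G.IsLegal G.gridBids s B Player.white ⟨p * G.increment, c⟩ :=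
    isLegal_of_units hp hpk hc
  have hb : G.IsLegal G.gridBids s B Player.black ⟨p * G.increment, c'⟩ :=
    isLegal_of_units hp hpK hc'
  refine ⟨fun i => by cases i; exacts [hw, hb], ?_⟩
  intro i a' ha' hother
  rw [prefers_iff, not_lt, score_stageOutcome_white (p := p) (q := p)
    (a := actions ⟨p * G.increment, c⟩ ⟨p * G.increment, c'⟩) hB hμ hw rfl rfl le_rfl]
  obtain ⟨m, hm0, hm, hbid⟩ := ha'.exists_units
  cases i with
  | white =>
    have hob : a' Player.black = ⟨p * G.increment, c'⟩ := hother
    have hbb : (a' Player.black).bid = p * G.increment := by rw [hob]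
    by_cases hpm : p ≤ m
    · rw [score_stageOutcome_white hB hμ ha' hbid hbb hpm]
      exact raise _ ha'.next_mem _ hpm
    · rw [score_stageOutcome_black hB hμ (by rw [hob]; exact hb) hbid hbb (by omega), hob]
      exact lower (by omega)
  | black =>
    have how : a' Player.white = ⟨p * G.increment, c⟩ := hother
    have hbw : (a' Player.white).bid = p * G.increment := by rw [how]
    by_cases hpm : m ≤ p
    · rw [score_stageOutcome_white hB hμ (by rw [how]; exact hw) hbw hbid hpm, how]
      rfl
    · rw [score_stageOutcome_black hB hμ ha' hbw hbid (by omega)]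
      exact outbid _ ha'.next_mem _ (by omega) hm

/-- Sufficient conditions for an equilibrium in which black takes the turn. -/
theorem isStageEquilibrium_black (hB : B ∈ Set.Icc (0 : ℝ) 1)
    (hμ : ∀ c ∈ G.g s, G.Represents (μ c) (V c)) {p : ℤ} {c c' : S} (hc : c ∈ G.g s)
    (hc' : c' ∈ G.g s) (hp : 0 ≤ p) (hpk : p ≤ G.units B) (hpK : p + 1 ≤ G.units (1 - B))
    (raise : ∀ d ∈ G.g s, ∀ p', p + 1 ≤ p' → p' ≤ G.units B →
      G.wScore (V d (G.units B - p')) ≤ G.wScore (V c' (G.units B + (p + 1))))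
    (lower : G.bScore (V c (G.units B - p)) ≤ G.bScore (V c' (G.units B + (p + 1))))
    (outbid : ∀ d ∈ G.g s, ∀ q', p < q' →
      G.bScore (V d (G.units B + q')) ≤ G.bScore (V c' (G.units B + (p + 1)))) :
    G.IsStageEquilibrium G.gridBids μ s B
      (actions ⟨p * G.increment, c⟩ ⟨(p + 1 : ℤ) * G.increment, c'⟩) := by
  have hw : G.IsLegal G.gridBids s B Player.white ⟨p * G.increment, c⟩ :=
    isLegal_of_units hp hpk hc
  have hb : G.IsLegal G.gridBids s B Player.black ⟨(p + 1 : ℤ) * G.increment, c'⟩ :=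
    isLegal_of_units (by omega) hpK hc'
  refine ⟨fun i => by cases i; exacts [hw, hb], ?_⟩
  intro i a' ha' hother
  rw [prefers_iff, not_lt,
    score_stageOutcome_black (p := p) (q := p + 1)
      (a := actions ⟨p * G.increment, c⟩ ⟨(p + 1 : ℤ) * G.increment, c'⟩)
      hB hμ hb rfl rfl (by omega)]
  obtain ⟨m, hm0, hm, hbid⟩ := ha'.exists_units
  cases i with
  | white =>
    have hob : a' Player.black = ⟨(p + 1 : ℤ) * G.increment, c'⟩ := hother
    have hbb : (a' Player.black).bid = (p + 1 : ℤ) * G.increment := by rw [hob]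
    by_cases hpm : p + 1 ≤ m
    · rw [score_stageOutcome_white hB hμ ha' hbid hbb hpm]
      exact raise _ ha'.next_mem _ hpm hm
    · rw [score_stageOutcome_black hB hμ (by rw [hob]; exact hb) hbid hbb (by omega), hob]
      rfl
  | black =>
    have how : a' Player.white = ⟨p * G.increment, c⟩ := hother
    have hbw : (a' Player.white).bid = p * G.increment := by rw [how]
    by_cases hpm : m ≤ p
    · rw [score_stageOutcome_white hB hμ (by rw [how]; exact hw) hbw hbid hpm, how]
      exact lower
    · rw [score_stageOutcome_black hB hμ ha' hbw hbid (by omega)]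
      exact outbid _ ha'.next_mem _ (by omega)

/-- In an equilibrium in which white takes the turn, white moves to the best child for this bid, and
black cannot gain by outbidding white. -/
theorem IsStageEquilibrium.white_wins (h : G.IsStageEquilibrium G.gridBids μ s B a)
    (hB : B ∈ Set.Icc (0 : ℝ) 1) (hμ : ∀ c ∈ G.g s, G.Represents (μ c) (V c)) {p q : ℤ}
    (hp : (a Player.white).bid = p * G.increment) (hq : (a Player.black).bid = q * G.increment)
    (hqp : q ≤ p) {d : S} (hd : d ∈ G.g s) :
    G.wScore (V d (G.units B - p)) ≤ G.wScore (V (a Player.white).next (G.units B - p)) ∧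
    (p + 1 ≤ G.units (1 - B) → G.bScore (V d (G.units B + (p + 1))) ≤
      G.bScore (V (a Player.white).next (G.units B - p))) := by
  obtain ⟨m, hm0, hm, hbid⟩ := (h.1 Player.white).exists_units
  have hpm : p = m := by
    rw [hp] at hbid
    exact_mod_cast mul_right_cancel₀ increment_pos.ne' hbid
  subst hpm
  have hout := score_stageOutcome_white hB hμ (h.1 _) hp hq hqp
  constructor
  · have hl : G.IsLegal G.gridBids s B Player.white ⟨p * G.increment, d⟩ :=
      isLegal_of_units hm0 hm hd
    have h1 := h.2 Player.white (actions ⟨p * G.increment, d⟩ (a Player.black)) hl rfl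
    rw [prefers_iff, not_lt, hout] at h1
    have h2 := score_stageOutcome_white (a := actions ⟨p * G.increment, d⟩ (a Player.black))
      hB hμ hl rfl hq hqp Player.white
    rw [h2] at h1
    exact h1
  · intro hK
    have hl : G.IsLegal G.gridBids s B Player.black ⟨(p + 1 : ℤ) * G.increment, d⟩ :=
      isLegal_of_units (by omega) hK hd
    have h1 := h.2 Player.black (actions (a Player.white) ⟨(p + 1 : ℤ) * G.increment, d⟩) hl rfl
    rw [prefers_iff, not_lt, hout] at h1
    have h2 := score_stageOutcome_black
      (a := actions (a Player.white) ⟨(p + 1 : ℤ) * G.increment, d⟩)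
      hB hμ hl hp rfl (by omega) Player.black
    rw [h2] at h1
    exact h1

/-- In an equilibrium in which black takes the turn, black moves to the best child for this bid, and
white cannot gain by matching it. -/
theorem IsStageEquilibrium.black_wins (h : G.IsStageEquilibrium G.gridBids μ s B a)
    (hB : B ∈ Set.Icc (0 : ℝ) 1) (hμ : ∀ c ∈ G.g s, G.Represents (μ c) (V c)) {p q : ℤ}
    (hp : (a Player.white).bid = p * G.increment) (hq : (a Player.black).bid = q * G.increment)
    (hpq : p < q) {d : S} (hd : d ∈ G.g s) :
    G.bScore (V d (G.units B + q)) ≤ G.bScore (V (a Player.black).next (G.units B + q)) ∧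
    (q ≤ G.units B → G.wScore (V d (G.units B - q)) ≤
      G.wScore (V (a Player.black).next (G.units B + q))) := by
  obtain ⟨m, hm0, hm, hbid⟩ := (h.1 Player.black).exists_units
  have hpm : q = m := by
    rw [hq] at hbid
    exact_mod_cast mul_right_cancel₀ increment_pos.ne' hbid
  subst hpm
  have hout := score_stageOutcome_black hB hμ (h.1 _) hp hq hpq
  constructor
  · have hl : G.IsLegal G.gridBids s B Player.black ⟨q * G.increment, d⟩ :=
      isLegal_of_units hm0 hm hd
    have h1 := h.2 Player.black (actions (a Player.white) ⟨q * G.increment, d⟩) hl rfl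
    rw [prefers_iff, not_lt, hout] at h1
    have h2 := score_stageOutcome_black (a := actions (a Player.white) ⟨q * G.increment, d⟩)
      hB hμ hl hp rfl hpq Player.black
    rw [h2] at h1
    exact h1
  · intro hk
    have hl : G.IsLegal G.gridBids s B Player.white ⟨q * G.increment, d⟩ :=
      isLegal_of_units hm0 hk hd
    have h1 := h.2 Player.white (actions ⟨q * G.increment, d⟩ (a Player.black)) hl rfl
    rw [prefers_iff, not_lt, hout] at h1
    have h2 := score_stageOutcome_white (a := actions ⟨q * G.increment, d⟩ (a Player.black))
      hB hμ hl rfl hq le_rfl Player.white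
    rw [h2] at h1
    exact h1

/-- Two equilibria with the same bids have the same outcome. -/
theorem IsStageEquilibrium.score_eq {a' : Player → Action S}
    (h : G.IsStageEquilibrium G.gridBids μ s B a) (h' : G.IsStageEquilibrium G.gridBids μ s B a')
    (hB : B ∈ Set.Icc (0 : ℝ) 1) (hμ : ∀ c ∈ G.g s, G.Represents (μ c) (V c))
    (hbid : ∀ i, (a i).bid = (a' i).bid) (i : Player) :
    G.score i (stageOutcome μ B a) = G.score i (stageOutcome μ B a') := by
  obtain ⟨p, -, -, hp⟩ := (h.1 Player.white).exists_units
  obtain ⟨q, -, -, hq⟩ := (h.1 Player.black).exists_units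
  have hp' := (hbid Player.white).symm.trans hp
  have hq' := (hbid Player.black).symm.trans hq
  by_cases hqp : q ≤ p
  · have h1 := (h.white_wins hB hμ hp hq hqp (h'.1 Player.white).next_mem).1
    have h2 := (h'.white_wins hB hμ hp' hq' hqp (h.1 Player.white).next_mem).1
    rw [score_stageOutcome_white hB hμ (h.1 _) hp hq hqp,
      score_stageOutcome_white hB hμ (h'.1 _) hp' hq' hqp, score_eq_iff,
      ← G.score_eq_iff Player.white]
    exact le_antisymm h2 h1
  · have h1 := (h.black_wins hB hμ hp hq (by omega) (h'.1 Player.black).next_mem).1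
    have h2 := (h'.black_wins hB hμ hp' hq' (by omega) (h.1 Player.black).next_mem).1
    rw [score_stageOutcome_black hB hμ (h.1 _) hp hq (by omega),
      score_stageOutcome_black hB hμ (h'.1 _) hp' hq' (by omega), score_eq_iff,
      ← G.score_eq_iff Player.black]
    exact le_antisymm h2 h1

theorem Tight.units {p q : ℤ} (h : G.Tight a)
    (hp : (a Player.white).bid = p * G.increment) (hq : (a Player.black).bid = q * G.increment) :
    q = p ∨ q = p + 1 := by
  have hne := (G.increment_pos).ne'
  rcases h with h | h
  · left
    rw [hp, hq] at h
    exact_mod_cast (mul_right_cancel₀ hne h).symm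
  · right
    rw [hp, hq, show p * G.increment + G.increment = ((p + 1 : ℤ) : ℝ) * G.increment by
      push_cast; ring] at h
    exact_mod_cast mul_right_cancel₀ hne h

/-- The bids of a tight equilibrium are not lower than the bids that the ascending auction reaches:
at each lower pair of bids, the player who is outbid wants to raise. -/
theorem IsStageEquilibrium.le_of_reached (h : G.IsStageEquilibrium G.gridBids μ s B a)
    (htight : G.Tight a)
    (hB : B ∈ Set.Icc (0 : ℝ) 1) (hμ : ∀ c ∈ G.g s, G.Represents (μ c) (V c)) {p q m : ℤ}
    (hp : (a Player.white).bid = p * G.increment) (hq : (a Player.black).bid = q * G.increment)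
    {x y : S} (hg : ∀ c, c ∈ G.g s ↔ c = x ∨ c = y)
    (hX : G.MonoOutcome (V x)) (hY : G.MonoOutcome (V y))
    (hr : Reached G.wScore G.bScore (V x) (V y) (G.units B) (G.units (1 - B)) m) :
    m ≤ p ∧ m ≤ q := by
  have hx : x ∈ G.g s := (hg x).mpr (.inl rfl)
  have hy : y ∈ G.g s := (hg y).mpr (.inr rfl)
  have hk := hr.le_white
  have hK := hr.le_black
  have hp0 : 0 ≤ p := by
    obtain ⟨p', h0, -, hp'⟩ := (h.1 Player.white).exists_units
    rw [hp] at hp'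
    have : p = p' := by exact_mod_cast mul_right_cancel₀ increment_pos.ne' hp'
    omega
  suffices hmp : m ≤ p by
    rcases htight.units hp hq with hqp | hqp <;> omega
  by_contra! hlt
  have acc := hr.accepts
  have rai := hr.raises (by omega)
  set k := G.units B
  rcases htight.units hp hq with hqp | hqp
  · have h1 := (h.white_wins hB hμ hp hq hqp.le hx).1
    have h2 := (h.white_wins hB hμ hp hq hqp.le hy).2 (by omega)
    rcases (hg _).mp (h.1 Player.white).next_mem with hn | hn <;> rw [hn] at h1 h2
    · have h3 := hX.black (k - m + 1) (k - p) (by omega)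
      have h4 := hY.black (k + (p + 1)) (k + m) (by omega)
      order
    · have h3 := hX.white (k - m) (k - p) (by omega)
      have h4 := hY.white (k - p) (k + m) (by omega)
      order
  · have h1 := (h.black_wins hB hμ hp hq (by omega) hy).1
    have h2 := (h.black_wins hB hμ hp hq (by omega) hx).2 (by omega)
    rcases (hg _).mp (h.1 Player.black).next_mem with hn | hn <;> rw [hn] at h1 h2
    · have h3 := hX.black (k - m + 1) (k + q) (by omega)
      have h4 := hY.black (k + q) (k + m) (by omega)
      order
    · have h3 := hX.white (k - m) (k - q) (by omega)
      have h4 := hY.white (k + q) (k + m) (by omega)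
      order

/-- `a` is the lowest equilibrium of the turn. -/
structure IsLowest (G : BiddingGame S) (μ : S → ℝ → S) (s : S) (B : ℝ) (a : Player → Action S) :
    Prop where
  equilibrium : G.IsStageEquilibrium G.gridBids μ s B a
  tight : G.Tight a
  lowest : ∀ a' : Player → Action S, G.IsStageEquilibrium G.gridBids μ s B a' → G.Tight a' →
    ∀ i, (a i).bid ≤ (a' i).bid

theorem IsLowest.score_eq {a' : Player → Action S} (h : G.IsLowest μ s B a)
    (h' : G.IsLowest μ s B a')
    (hB : B ∈ Set.Icc (0 : ℝ) 1) (hμ : ∀ c ∈ G.g s, G.Represents (μ c) (V c)) (i : Player) :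
    G.score i (stageOutcome μ B a) = G.score i (stageOutcome μ B a') :=
  h.equilibrium.score_eq h'.equilibrium hB hμ (fun j => le_antisymm
    (h.lowest _ h'.equilibrium h'.tight j) (h'.lowest _ h.equilibrium h.tight j)) i

theorem exists_isLowest_of_contest (hB : B ∈ Set.Icc (0 : ℝ) 1)
    (hμ : ∀ c ∈ G.g s, G.Represents (μ c) (V c)) {x y t : S}
    (hg : ∀ c, c ∈ G.g s ↔ c = x ∨ c = y)
    (hX : G.MonoOutcome (V x)) (hY : G.MonoOutcome (V y))
    (ht : Contest G.wScore G.bScore (V x) (V y) (G.units B) (G.units (1 - B)) t) :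
    ∃ a, G.IsLowest μ s B a ∧ ∀ i, G.score i (stageOutcome μ B a) = G.score i t := by
  have hx : x ∈ G.g s := (hg x).mpr (.inl rfl)
  have hy : y ∈ G.g s := (hg y).mpr (.inr rfl)
  have hi := (G.increment_pos).le
  cases ht with
  | white m hr halt =>
    have h0 := hr.nonneg
    have acc := hr.accepts
    have heq : G.IsStageEquilibrium G.gridBids μ s B
        (actions ⟨m * G.increment, x⟩ ⟨m * G.increment, y⟩) := by
      refine isStageEquilibrium_white hB hμ hx hy h0 hr.le_white hr.le_black ?_ ?_ ?_
      · intro d hd p' hp'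
        rcases (hg d).mp hd with rfl | rfl
        · exact hX.white _ _ (by omega)
        · have := hY.white (G.units B - p') (G.units B + m) (by omega)
          order
      · intro _
        exact acc.le
      · intro d hd q' hq' hK
        rcases (hg d).mp hd with rfl | rfl
        · exact hX.black _ _ (by omega)
        · have h1 := halt (by omega)
          have := hY.black (G.units B + m + 1) (G.units B + q') (by omega)
          order
    refine ⟨_, ⟨heq, .inl rfl, fun a' ha' ht' i => ?_⟩, fun i =>
      score_stageOutcome_white (p := m) (q := m) hB hμ (heq.1 _) rfl rfl le_rfl i⟩
    obtain ⟨p, -, -, hp⟩ := (ha'.1 Player.white).exists_units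
    obtain ⟨q, -, -, hq⟩ := (ha'.1 Player.black).exists_units
    obtain ⟨h1, h2⟩ := ha'.le_of_reached ht' hB hμ hp hq hg hX hY hr
    cases i
    · rw [hp]
      exact mul_le_mul_of_nonneg_right (by exact_mod_cast h1) hi
    · rw [hq]
      exact mul_le_mul_of_nonneg_right (by exact_mod_cast h2) hi
  | black m hr le gain halt =>
    have h0 := hr.nonneg
    have acc := hr.accepts
    simp only [add_assoc] at gain halt
    have heq : G.IsStageEquilibrium G.gridBids μ s B
        (actions ⟨m * G.increment, x⟩ ⟨(m + 1 : ℤ) * G.increment, y⟩) := by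
      refine isStageEquilibrium_black hB hμ hx hy h0 hr.le_white le ?_ gain.le ?_
      · intro d hd p' hp' hk
        rcases (hg d).mp hd with rfl | rfl
        · have h1 := halt (by omega)
          have := hX.white (G.units B - p') (G.units B - m - 1) (by omega)
          order
        · exact hY.white _ _ (by omega)
      · intro d hd q' hq'
        rcases (hg d).mp hd with rfl | rfl
        · have := hX.black (G.units B - m) (G.units B + q') (by omega)
          order
        · exact hY.black _ _ (by omega)
    refine ⟨_, ⟨heq, .inr ?_, fun a' ha' ht' i => ?_⟩, fun i => ?_⟩
    · simp only [actions]
      push_cast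
      ring
    · obtain ⟨p, -, -, hp⟩ := (ha'.1 Player.white).exists_units
      obtain ⟨q, -, -, hq⟩ := (ha'.1 Player.black).exists_units
      obtain ⟨h1, h2⟩ := ha'.le_of_reached ht' hB hμ hp hq hg hX hY hr
      cases i
      · rw [hp]
        exact mul_le_mul_of_nonneg_right (by exact_mod_cast h1) hi
      · rw [hq]
        have h3 : m + 1 ≤ q := by
          by_contra hlt
          have hqm : q = m := by omega
          have hpm : p = m := by
            rcases ht'.units hp hq with h | h <;> omega
          subst hpm
          have h4 := (ha'.white_wins hB hμ hp hq hqm.le hy).2 le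
          have h5 := (ha'.white_wins hB hμ hp hq hqm.le hx).1
          rcases (hg _).mp (ha'.1 Player.white).next_mem with hn | hn <;> rw [hn] at h4 h5
          · order
          · have := hY.white (G.units B - p) (G.units B + p) (by omega)
            order
        exact mul_le_mul_of_nonneg_right (by exact_mod_cast h3) hi
    · rw [add_assoc]
      exact score_stageOutcome_black (p := m) (q := m + 1) hB hμ (heq.1 _) rfl rfl (by omega) i

/-- The lowest equilibrium of a turn exists, and its outcome is that of the ascending auction. -/
theorem exists_isLowest (hB : B ∈ Set.Icc (0 : ℝ) 1)
    (hμ : ∀ c ∈ G.g s, G.Represents (μ c) (V c)) {l r : S}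
    (hg : ∀ c, c ∈ G.g s ↔ c = l ∨ c = r)
    (hL : G.MonoOutcome (V l)) (hR : G.MonoOutcome (V r)) :
    ∃ a t, G.IsLowest μ s B a ∧
      Turn G.wScore G.bScore (V l) (V r) (G.units B) (G.units (1 - B)) t ∧
      ∀ i, G.score i (stageOutcome μ B a) = G.score i t := by
  have hk := G.units_nonneg hB.1
  have hK := G.units_nonneg (B := 1 - B) (by linarith [hB.2])
  have hg' : ∀ c, c ∈ G.g s ↔ c = r ∨ c = l := fun c => (hg c).trans or_comm
  obtain ⟨t, ht⟩ := Turn.exists (L := V l) (R := V r) (fun x y => (G.wScore_eq_iff x y).mp) hk hK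
  cases ht with
  | left hw hb c =>
    obtain ⟨a, ha, hat⟩ := exists_isLowest_of_contest hB hμ hg hL hR c
    exact ⟨a, t, ha, .left hw hb c, hat⟩
  | right hw hb c =>
    obtain ⟨a, ha, hat⟩ := exists_isLowest_of_contest hB hμ hg' hR hL c
    exact ⟨a, t, ha, .right hw hb c, hat⟩
  | agree mem wl wr bl br =>
    obtain ⟨c, hc, rfl⟩ : ∃ c, c ∈ G.g s ∧ t = V c (G.units B) := by
      rcases mem with rfl | rfl
      · exact ⟨l, (hg l).mpr (.inl rfl), rfl⟩
      · exact ⟨r, (hg r).mpr (.inr rfl), rfl⟩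
    have heq : G.IsStageEquilibrium G.gridBids μ s B
        (actions ⟨(0 : ℤ) * G.increment, c⟩ ⟨(0 : ℤ) * G.increment, c⟩) := by
      refine isStageEquilibrium_white hB hμ hc hc le_rfl hk hK ?_ (fun h => (lt_irrefl _ h).elim) ?_
      · intro d hd p' hp'
        rw [sub_zero]
        rcases (hg d).mp hd with rfl | rfl
        · have := hL.white (G.units B - p') (G.units B) (by omega)
          order
        · have := hR.white (G.units B - p') (G.units B) (by omega)
          order
      · intro d hd q' hq' _
        rw [sub_zero]
        rcases (hg d).mp hd with rfl | rfl
        · have := hL.black (G.units B) (G.units B + q') (by omega)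
          order
        · have := hR.black (G.units B) (G.units B + q') (by omega)
          order
    refine ⟨_, _, ⟨heq, .inl rfl, fun a' ha' _ i => ?_⟩, .agree mem wl wr bl br, fun i => ?_⟩
    · have := (ha'.1 i).bid_nonneg
      cases i <;> simpa [actions] using this
    · have := score_stageOutcome_white (p := 0) (q := 0) hB hμ (heq.1 _) rfl rfl le_rfl i
      rw [sub_zero] at this
      exact this

end Turn

end BiddingGame

/-! ### The Lower PSPE -/

namespace BiddingGame

open Auction

section

variable {S : Type} {G : BiddingGame S}

theorem Reachable.child {s c : S} (h : G.Reachable s) (hc : c ∈ G.g s) : G.Reachable c :=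
  Relation.ReflTransGen.tail h hc

theorem stageOutcome_congr {μ μ' : S → ℝ → S} {s : S} {B : ℝ} {a : Player → Action S}
    (hμ : ∀ c ∈ G.g s, μ c = μ' c) (ha : ∀ i, (a i).next ∈ G.g s) :
    stageOutcome μ B a = stageOutcome μ' B a := by
  unfold stageOutcome
  rw [hμ _ (ha Player.white), hμ _ (ha Player.black)]

end

variable {S : Type} [Finite S] {G : BiddingGame S}

/-- The step functions `V s`, in units of the bid increment, satisfy the recursion of the ascending
auction at all states that can occur.  That the cutoffs are even makes it immaterial whether a
budget is a multiple of the increment or lies strictly between two multiples. -/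
structure IsValuation (G : BiddingGame S) (V : S → ℤ → S) : Prop where
  terminal : ∀ t, G.Reachable t → t ∈ G.T → ∀ z, V t z = t
  mono : ∀ s, G.Reachable s → G.MonoOutcome (V s)
  step : ∀ s, G.Reachable s → s ∉ G.T → ∀ c ∈ G.g s,
    ∃ C, IsStep G.gridSize C (V c) ∧ ∀ x, C x → Even x
  top : ∀ s, G.Reachable s → G.wScore (V s G.gridSize) = G.wScore (V s (G.gridSize - 1))
  turn : ∀ s, G.Reachable s → s ∉ G.T → ∃ l r, (∀ c, c ∈ G.g s ↔ c = l ∨ c = r) ∧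
    ∀ k, 0 ≤ k → k ≤ G.gridSize →
      ∃ t, Turn G.wScore G.bScore (V l) (V r) k (G.gridSize - k) t ∧ G.wScore t = G.wScore (V s k)

theorem gridSize_even : Even G.gridSize := by
  unfold gridSize
  exact ⟨2 ^ (G.height G.s₀ + 1), by ring⟩

theorem height_lt {s c : S} (hc : c ∈ G.g s) : G.height c < G.height s := by
  rw [G.height_eq s]
  exact Finset.le_sup (f := fun c => G.height c + 1) hc

/-- The conditions on a Lower PSPE that concern the state `s`. -/
structure IsLowerAt (G : BiddingGame S) (γ : Profile S) (s : S) : Prop where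
  terminal : s ∈ G.T → ∀ B ∈ Set.Icc (0 : ℝ) 1, γ.outcome s B = s
  outcome_eq : s ∉ G.T → ∀ B ∈ Set.Icc (0 : ℝ) 1,
    γ.outcome s B = stageOutcome γ.outcome B (γ.act s B)
  lowest : s ∉ G.T → ∀ B ∈ Set.Icc (0 : ℝ) 1, G.IsLowest γ.outcome s B (γ.act s B)

theorem isLowerPSPE_iff (γ : Profile S) :
    G.IsLowerPSPE γ ↔ ∀ s, G.Reachable s → G.IsLowerAt γ s := by
  constructor
  · intro h s hs
    exact ⟨fun ht => h.isPSPE.outcome_terminal s hs ht, fun ht => h.isPSPE.outcome_eq s hs ht,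
      fun ht B hB => ⟨h.isPSPE.equilibrium s hs ht B hB, h.tight s hs ht B hB,
        h.lowest s hs ht B hB⟩⟩
  · intro h
    exact ⟨⟨fun s hs ht => (h s hs).terminal ht, fun s hs ht => (h s hs).outcome_eq ht,
      fun s hs ht B hB => ((h s hs).lowest ht B hB).equilibrium⟩,
      fun s hs ht B hB => ((h s hs).lowest ht B hB).tight,
      fun s hs ht B hB => ((h s hs).lowest ht B hB).lowest⟩

theorem IsStageEquilibrium.congr {μ μ' : S → ℝ → S} {s : S} {B : ℝ} {a : Player → Action S}
    (hμ : ∀ c ∈ G.g s, μ c = μ' c) (h : G.IsStageEquilibrium G.gridBids μ s B a) :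
    G.IsStageEquilibrium G.gridBids μ' s B a := by
  refine ⟨h.1, fun i a' ha' hother => ?_⟩
  have h1 := h.2 i a' ha' hother
  rwa [stageOutcome_congr hμ fun j => (h.1 j).next_mem, stageOutcome_congr hμ fun j => ?_] at h1
  have : j = i ∨ j = i.other := by cases i <;> cases j <;> simp [Player.other]
  rcases this with rfl | rfl
  · exact ha'.next_mem
  · rw [hother]
    exact (h.1 _).next_mem

theorem IsLowest.congr {μ μ' : S → ℝ → S} {s : S} {B : ℝ} {a : Player → Action S}
    (hμ : ∀ c ∈ G.g s, μ c = μ' c) (h : G.IsLowest μ s B a) : G.IsLowest μ' s B a :=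
  ⟨h.equilibrium.congr hμ, h.tight, fun a' ha' =>
    h.lowest a' (ha'.congr fun c hc => (hμ c hc).symm)⟩

theorem IsLowerAt.congr {γ γ' : Profile S} {s : S} (h : G.IsLowerAt γ s)
    (hact : γ.act s = γ'.act s) (hs : γ.outcome s = γ'.outcome s)
    (hc : ∀ c ∈ G.g s, γ.outcome c = γ'.outcome c) : G.IsLowerAt γ' s where
  terminal ht B hB := by rw [← hs]; exact h.terminal ht B hB
  outcome_eq ht B hB := by
    rw [← hs, ← hact, h.outcome_eq ht B hB]
    exact stageOutcome_congr hc fun i => ((h.lowest ht B hB).equilibrium.1 i).next_mem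
  lowest ht B hB := by
    rw [← hact]
    exact (h.lowest ht B hB).congr hc

variable {V : S → ℤ → S}

theorem represents_of_terminal (hV : G.IsValuation V) {γ : Profile S} {t : S}
    (ht : G.Reachable t) (htT : t ∈ G.T) (h : G.IsLowerAt γ t) :
    G.Represents (γ.outcome t) (V t) := fun B hB i => by
  rw [h.terminal htT B hB, hV.terminal t ht htT]

/-- In a Lower PSPE, the outcomes at a state are given by the valuation, if they are so at its
children. -/
theorem represents_of_children (hV : G.IsValuation V) {γ : Profile S} {s : S}
    (hs : G.Reachable s) (hsT : s ∉ G.T)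
    (hμ : ∀ c ∈ G.g s, G.Represents (γ.outcome c) (V c)) (h : G.IsLowerAt γ s) :
    G.Represents (γ.outcome s) (V s) := by
  intro B hB i
  obtain ⟨l, r, hg, hturn⟩ := hV.turn s hs hsT
  have hl : l ∈ G.g s := (hg l).mpr (.inl rfl)
  have hr : r ∈ G.g s := (hg r).mpr (.inr rfl)
  have mL := hV.mono l (hs.child hl)
  have mR := hV.mono r (hs.child hr)
  obtain ⟨a, t, ha, ht, hat⟩ := exists_isLowest hB hμ hg mL mR
  have hk := G.units_nonneg hB.1
  have hkN := G.units_le hB.2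
  obtain ⟨t', ht', htt'⟩ : ∃ t', Turn G.wScore G.bScore (V l) (V r) (G.units B)
      (G.gridSize - G.units B) t' ∧ G.wScore t = G.wScore t' := by
    rcases G.units_one_sub B with h1 | h1
    · rw [h1] at ht
      exact ⟨t, ht, rfl⟩
    · rw [h1] at ht
      obtain ⟨C, sL, hC⟩ := hV.step s hs hsT l hl
      obtain ⟨D, sR, hD⟩ := hV.step s hs hsT r hr
      exact ht.enlarge sL sR hC hD G.gridSize_even (hV.top l (hs.child hl))
        (hV.top r (hs.child hr))
  obtain ⟨t'', ht'', htV⟩ := hturn _ hk hkN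
  rw [h.outcome_eq hsT B hB, (h.lowest hsT B hB).score_eq ha hB hμ i, hat i, score_eq_iff,
    ← G.score_eq_iff Player.white]
  exact htt'.trans ((Turn.unique mL mR hk hkN ht' ht'').trans htV)

theorem represents_of_isLowerPSPE (hV : G.IsValuation V) {γ : Profile S} (h : G.IsLowerPSPE γ)
    (s : S) (hs : G.Reachable s) : G.Represents (γ.outcome s) (V s) := by
  rw [isLowerPSPE_iff] at h
  induction s using G.wellFounded.induction with
  | _ s ih =>
    by_cases hsT : s ∈ G.T
    · exact represents_of_terminal hV hs hsT (h s hs)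
    · exact represents_of_children hV hs hsT (fun c hc => ih c hc (hs.child hc)) (h s hs)

/-- A Lower PSPE is built up by height: the lowest equilibria at the states of height `n` depend only
on the outcomes at lower states. -/
theorem exists_isLowerAt (hV : G.IsValuation V) (n : ℕ) :
    ∃ γ : Profile S, ∀ s, G.Reachable s → G.height s < n →
      G.IsLowerAt γ s ∧ G.Represents (γ.outcome s) (V s) := by
  classical
  induction n with
  | zero => exact ⟨⟨fun s _ _ => ⟨0, s⟩, fun s _ => s⟩, fun s _ h => by omega⟩
  | succ n ih =>
    obtain ⟨γ, hγ⟩ := ih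
    have hex : ∀ s B, ∃ a, G.Reachable s → G.height s = n → s ∉ G.T → B ∈ Set.Icc (0 : ℝ) 1 →
        G.IsLowest γ.outcome s B a := by
      intro s B
      by_cases hc : G.Reachable s ∧ G.height s = n ∧ s ∉ G.T ∧ B ∈ Set.Icc (0 : ℝ) 1
      · obtain ⟨hs, hn, hsT, hB⟩ := hc
        obtain ⟨l, r, hg, -⟩ := hV.turn s hs hsT
        obtain ⟨a, t, ha, -, -⟩ := exists_isLowest (μ := γ.outcome) (V := V) hB
          (fun c hc => (hγ c (hs.child hc) (hn ▸ height_lt hc)).2) hg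
          (hV.mono l (hs.child ((hg l).mpr (.inl rfl))))
          (hV.mono r (hs.child ((hg r).mpr (.inr rfl))))
        exact ⟨a, fun _ _ _ _ => ha⟩
      · exact ⟨fun _ => ⟨0, s⟩, fun h1 h2 h3 h4 => (hc ⟨h1, h2, h3, h4⟩).elim⟩
    choose a ha using hex
    let γ' : Profile S :=
      ⟨fun s => if G.height s = n then a s else γ.act s,
        fun s => if G.height s = n then
          (if s ∈ G.T then fun _ => s else fun B => stageOutcome γ.outcome B (a s B))
          else γ.outcome s⟩
    have hout : ∀ s, G.height s ≠ n → γ.outcome s = γ'.outcome s := fun s h => by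
      simp only [γ', if_neg h]
    refine ⟨γ', fun s hs hlt => ?_⟩
    rcases Nat.lt_or_ge (G.height s) n with hn | hn
    · have hne : G.height s ≠ n := by omega
      refine ⟨(hγ s hs hn).1.congr (by simp only [γ', if_neg hne]) (hout s hne) fun c hc =>
        hout c ?_, ?_⟩
      · have := height_lt hc
        omega
      · rw [← hout s hne]
        exact (hγ s hs hn).2
    · have hn : G.height s = n := by omega
      have hchild : ∀ c ∈ G.g s, γ.outcome c = γ'.outcome c := fun c hc => by
        have := height_lt hc
        exact hout c (by omega)
      have hlower : G.IsLowerAt γ' s := by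
        refine ⟨fun hT B _ => ?_, fun hT B hB => ?_, fun hT B hB => ?_⟩
        · simp only [γ', if_pos hn, if_pos hT]
        · have h1 := (ha s B hs hn hT hB).equilibrium
          have h2 : γ'.outcome s B = stageOutcome γ.outcome B (a s B) := by
            simp only [γ', if_pos hn, if_neg hT]
          have h3 : γ'.act s B = a s B := by simp only [γ', if_pos hn]
          rw [h2, h3]
          exact stageOutcome_congr hchild fun i => (h1.1 i).next_mem
        · have h3 : γ'.act s B = a s B := by simp only [γ', if_pos hn]
          rw [h3]
          exact (ha s B hs hn hT hB).congr hchild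
      refine ⟨hlower, ?_⟩
      by_cases hT : s ∈ G.T
      · exact represents_of_terminal hV hs hT hlower
      · refine represents_of_children hV hs hT (fun c hc => ?_) hlower
        rw [← hchild c hc]
        exact (hγ c (hs.child hc) (hn ▸ height_lt hc)).2

theorem exists_isLowerPSPE (hV : G.IsValuation V) : ∃ γ : Profile S, G.IsLowerPSPE γ := by
  obtain ⟨n, hn⟩ := (Set.finite_range G.height).bddAbove
  obtain ⟨γ, hγ⟩ := exists_isLowerAt hV (n + 1)
  refine ⟨γ, (isLowerPSPE_iff γ).mpr fun s hs => (hγ s hs ?_).1⟩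
  have := hn (Set.mem_range_self s)
  omega

end BiddingGame

/-! ### Skipping rounds of the auction -/

namespace Auction

section

variable {α Λ : Type*} [LinearOrder Λ] {w b : α → Λ} {X Y : ℤ → α} {k N j i c d : ℤ} {t : α}

/-- The invariant of the accelerated auction at a common bid `j`.  The bid is a cutoff that one of
the players reaches only with `j`, so the auction without skips is known to have arrived at `j - 1`,
unless it has stopped before with the same outcome. -/
inductive Skipped (w b : α → Λ) (X Y : ℤ → α) (k K j : ℤ) : Prop where
  | start (h : j = 0) (reached : Reached w b X Y k K j) : Skipped w b X Y k K j
  | before (h : 2 ≤ j) (reached : Reached w b X Y k K (j - 1)) : Skipped w b X Y k K j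
  | stopped (m : ℤ) (reached : Reached w b X Y k K m)
      (halt : m + 1 ≤ K → b (Y (k + m + 1)) ≤ b (X (k - m))) (eq : X (k - m) = X (k - j))
      (le : b (Y (k + j + 1)) ≤ b (X (k - j))) : Skipped w b X Y k K j

/-- If black does not raise `j`, then `X (k - j)` is the outcome of the auction without skips. -/
theorem Skipped.contest_white (oX : ∀ z, Odd z → X z = X (z - 1))
    (oY : ∀ z, Odd z → Y z = Y (z - 1)) (top : w (Y N) = w (Y (N - 1))) (hk : Even k) (hj : Even j)
    (hjk : j ≤ k) (hjK : j ≤ N - k) (h : Skipped w b X Y k (N - k) j)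
    (halt : j + 1 ≤ N - k → b (Y (k + j + 1)) ≤ b (X (k - j))) :
    Contest w b X Y k (N - k) (X (k - j)) := by
  cases h with
  | start h hr => exact .white j hr halt
  | stopped m hr st eq le => exact eq ▸ .white m hr st
  | before h hr =>
    obtain ⟨p, rfl⟩ := hk
    obtain ⟨q, rfl⟩ := hj
    have hX : X (p + p - (q + q - 1)) = X (p + p - (q + q)) := by
      rw [oX _ ⟨p - q, by ring⟩]
      congr 1
      ring
    have hY : Y (p + p + (q + q) + 1) = Y (p + p + (q + q)) := by
      rw [oY _ ⟨p + q, by ring⟩]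
      congr 1
      ring
    have hY1 : p + p + (q + q - 1) + 1 = p + p + (q + q) := by ring
    by_cases hP : b (Y (p + p + (q + q))) ≤ b (X (p + p - (q + q)))
    · rw [← hX]
      exact .white _ hr fun _ => by rwa [hX, hY1]
    · -- black can raise once more, with all of the budget
      have hlast : q + q = N - (p + p) := by
        by_contra hne
        exact hP (hY ▸ halt (by omega))
      refine .white (q + q) ⟨by omega, hjk, hjK, ?_, fun _ => ?_⟩ halt
      · have h1 := hr.accepts
        rw [hX, show p + p + (q + q - 1) = N - 1 by omega, ← top] at h1
        rwa [show p + p + (q + q) = N by omega]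
      · rw [show p + p - (q + q) + 1 = p + p - (q + q - 1) by ring, hX]
        exact not_le.mp hP

/-- If black raises `j`, then the auction has reached `j`, or the raise is matched no more. -/
theorem Skipped.reached_or (oX : ∀ z, Odd z → X z = X (z - 1))
    (oY : ∀ z, Odd z → Y z = Y (z - 1)) (hk : Even k) (hj : Even j)
    (hjk : j ≤ k) (h : Skipped w b X Y k (N - k) j)
    (le : j + 1 ≤ N - k) (gain : b (X (k - j)) < b (Y (k + j + 1))) :
    Reached w b X Y k (N - k) j ∨
      (w (X (k - j)) ≤ w (Y (k + j)) ∧ Contest w b X Y k (N - k) (Y (k + j + 1))) := by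
  cases h with
  | start h hr => exact .inl hr
  | stopped m hr st eq le => order
  | before h hr =>
    obtain ⟨p, rfl⟩ := hk
    obtain ⟨q, rfl⟩ := hj
    have hX : X (p + p - (q + q - 1)) = X (p + p - (q + q)) := by
      rw [oX _ ⟨p - q, by ring⟩]
      congr 1
      ring
    have hY : Y (p + p + (q + q) + 1) = Y (p + p + (q + q)) := by
      rw [oY _ ⟨p + q, by ring⟩]
      congr 1
      ring
    have hY1 : p + p + (q + q - 1) + 1 = p + p + (q + q) := by ring
    have hX1 : p + p - (q + q) + 1 = p + p - (q + q - 1) := by ring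
    have hX2 : p + p - (q + q - 1) - 1 = p + p - (q + q) := by ring
    rw [hY] at gain ⊢
    rcases lt_or_ge (w (Y (p + p + (q + q)))) (w (X (p + p - (q + q)))) with hw | hw
    · exact .inl ⟨by omega, hjk, by omega, hw, fun _ => by rwa [hX1, hX]⟩
    · refine .inr ⟨hw, ?_⟩
      rw [← hY1] at gain hw ⊢
      exact .black _ hr (by omega) (by rwa [hX]) fun _ => by rwa [hX2]

/-- `c` is the cutoff of the interval that white occupies at the bid `j`, and black leaves the
present interval at the earliest at the next bid `i`.  Until then white leaves at most the interval
from `c` on, and enters the one below (`white'`). -/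
structure Skip (X Y : ℤ → α) (k N j i c : ℤ) : Prop where
  lt : j < i
  even : Even i
  leK : i ≤ N - k
  even_cut : Even c
  cut_le : c ≤ k - j
  cut_nonneg : 0 ≤ c
  white : ∀ z, c ≤ z → z ≤ k - j → X z = X (k - j)
  white' : ∀ z, k - i ≤ z → z < c → X z = X (c - 1)
  black : ∀ z, k + j ≤ z → z < k + i → Y z = Y (k + j)
  bottom : k < i → c = 0

/-- If white does not match the next bid `i`, then black wins the auction without skips. -/
theorem Skipped.contest_black (hX : Mono w b X) (oX : ∀ z, Odd z → X z = X (z - 1))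
    (oY : ∀ z, Odd z → Y z = Y (z - 1)) (hk : Even k) (hj : Even j)
    (hjk : j ≤ k) (h : Skipped w b X Y k (N - k) j) (hs : Skip X Y k N j i c)
    (le : j + 1 ≤ N - k) (gain : b (X (k - j)) < b (Y (k + j + 1)))
    (halt : k < i ∨ w (X (k - i)) ≤ w (Y (k + j + 1))) :
    Contest w b X Y k (N - k) (Y (k + j + 1)) := by
  rcases h.reached_or oX oY hk hj hjk le gain with hr | ⟨-, hc⟩
  swap
  · exact hc
  have := hr.nonneg
  obtain ⟨lt, even, leK, even_cut, cut_le, cut_nonneg, white, white', black, bottom⟩ := hs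
  obtain ⟨p, rfl⟩ := hk
  obtain ⟨q, rfl⟩ := hj
  obtain ⟨i, rfl⟩ := even
  obtain ⟨c, rfl⟩ := even_cut
  have acc := hr.accepts
  have hY1 := black (p + p + (q + q) + 1) (by omega) (by omega)
  rw [hY1] at gain halt ⊢
  -- black wins with the bid with which white would have to leave the interval
  set m := p + p - (c + c) with hm
  have hcut : p + p < i + i ∨ p + p - (i + i) < c + c := by
    rcases halt with h | h
    · exact .inl h
    · right
      by_contra hge
      rw [white (p + p - (i + i)) (by omega) (by omega)] at h
      order
  have hmi : m < i + i := by
    rcases hcut with h | h <;> omega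
  have hYm : Y (p + p + m) = Y (p + p + (q + q)) := black _ (by omega) (by omega)
  have hYm1 : Y (p + p + m + 1) = Y (p + p + (q + q)) := black _ (by omega) (by omega)
  have hXm : X (p + p - m) = X (p + p - (q + q)) := white _ (by omega) (by omega)
  have hr' : Reached w b X Y (p + p) (N - (p + p)) m := by
    refine ⟨by omega, by omega, by omega, by rwa [hYm, hXm], fun _ => ?_⟩
    rw [hYm]
    by_cases hqm : m = q + q
    · have h1 := hX.black (p + p - (q + q)) (p + p - m + 1) (by omega)
      order
    · rw [white _ (by omega) (by omega)]
      exact gain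
  rw [← hYm1]
  refine .black m hr' (by omega) (by rwa [hXm, hYm1]) fun hm1 => ?_
  rw [hYm1]
  rcases halt with h | h
  · have := bottom h
    omega
  · rw [white' (p + p - (i + i)) le_rfl (by omega)] at h
    rwa [show p + p - m - 1 = c + c - 1 by omega]

/-- The invariant is preserved: when white matches the next bid `i`, the auction without skips has
arrived at `i - 1`, or black has stopped where white enters the next interval, with the outcome that
white has at `i`. -/
theorem Skipped.continue (hY : Mono w b Y) (oX : ∀ z, Odd z → X z = X (z - 1))
    (oY : ∀ z, Odd z → Y z = Y (z - 1)) (hX : Mono w b X) (hk : Even k) (hj : Even j)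
    (hjk : j ≤ k) (h : Skipped w b X Y k (N - k) j) (hs : Skip X Y k N j i c)
    (le : j + 1 ≤ N - k) (gain : b (X (k - j)) < b (Y (k + j + 1)))
    (hik : i ≤ k) (hw : w (Y (k + j + 1)) < w (X (k - i))) :
    Skipped w b X Y k (N - k) i := by
  obtain ⟨lt, even, leK, even_cut, cut_le, cut_nonneg, white, white', black, bottom⟩ := hs
  have h1 := hX.white (k - i) (k - j) (by omega)
  have h2 := hY.white (k + j) (k + j + 1) (by omega)
  rcases h.reached_or oX oY hk hj hjk le gain with hr | ⟨hle, -⟩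
  swap
  · order
  have := hr.nonneg
  obtain ⟨p, rfl⟩ := hk
  obtain ⟨q, rfl⟩ := hj
  obtain ⟨i, rfl⟩ := even
  obtain ⟨c, rfl⟩ := even_cut
  have hXi : X (p + p - (i + i - 1)) = X (p + p - (i + i)) := by
    rw [oX _ ⟨p - i, by ring⟩]
    congr 1
    ring
  have hY1 := black (p + p + (q + q) + 1) (by omega) (by omega)
  have hYi : Y (p + p + (i + i - 1)) = Y (p + p + (q + q)) := black _ (by omega) (by omega)
  rw [hY1] at gain hw
  by_cases hb : b (X (p + p - (i + i - 1) + 1)) < b (Y (p + p + (q + q)))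
  · exact .before (by omega) ⟨by omega, by omega, by omega, by rwa [hXi, hYi], fun _ => by rwa [hYi]⟩
  · -- black has stopped at the bid with which white enters the next interval
    rw [not_lt] at hb
    have hlt : p + p - (i + i - 1) + 1 < c + c := by
      by_contra hge
      rw [white _ (by omega) (by omega)] at hb
      order
    have hXe := white' (p + p - (i + i)) le_rfl (by omega)
    have hXe' := white' (p + p - (i + i - 1) + 1) (by omega) hlt
    rw [hXe'] at hb
    have hXm : p + p - (p + p - (c + c) + 1) = c + c - 1 := by ring
    have hmono := hY.black (p + p + (q + q)) (p + p + (i + i) + 1) (by omega)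
    refine .stopped (p + p - (c + c) + 1) ⟨by omega, by omega, by omega, ?_, fun _ => ?_⟩
      (fun _ => ?_) ?_ ?_
    · rw [hXm, black _ (by omega) (by omega), ← hXe]
      exact hw
    · rw [hXm, black _ (by omega) (by omega), white _ (by omega) (by omega)]
      exact gain
    · have h3 := hY.black (p + p + (q + q)) (p + p + (p + p - (c + c) + 1) + 1) (by omega)
      rw [hXm]
      order
    · rw [hXm, hXe]
    · rw [hXe]
      order

end

end Auction

/-! ### Tables of step functions -/

namespace Timed

variable {α β : Type}

/-! The following equations are stated with the proof `id rfl`, so that `simp` does not use them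
definitionally: it then also rewrites the conditions of case distinctions. -/

@[simp] theorem bind_val (x : Timed α) (f : α → Timed β) : (x >>= f).val = (f x.val).val := id rfl

@[simp] theorem bind_time (x : Timed α) (f : α → Timed β) :
    (x >>= f).time = x.time + (f x.val).time := id rfl

@[simp] theorem pure_val (a : α) : (pure a : Timed α).val = a := id rfl

@[simp] theorem pure_time (a : α) : (pure a : Timed α).time = 0 := id rfl

@[simp] theorem op_val (a : α) : (op a).val = a := id rfl

@[simp] theorem op_time (a : α) : (op a).time = 1 := id rfl

end Timed

namespace FindPSPEFast

open Timed
open scoped Classical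

variable {S : Type}

theorem locateFrom_val (B : ℝ) (F : List (Row S)) (a best : ℕ) :
    (locateFrom B F a best).val =
      if (F.takeWhile fun r => decide (r.cut ≤ B)).length = 0 then best
      else a + (F.takeWhile fun r => decide (r.cut ≤ B)).length - 1 := by
  induction F generalizing a best with
  | nil => simp [locateFrom]
  | cons r rs ih =>
    by_cases h : r.cut ≤ B
    · simp only [locateFrom, bind_val, op_val, h, decide_true, if_true, ih]
      rw [List.takeWhile_cons_of_pos (by simpa using h), List.length_cons,
        if_neg (Nat.succ_ne_zero _)]
      split_ifs <;> omega
    · simp [locateFrom, h]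

theorem locateFrom_time (B : ℝ) (F : List (Row S)) (a best : ℕ) :
    (locateFrom B F a best).time ≤ 2 * F.length := by
  induction F generalizing a best with
  | nil => simp [locateFrom]
  | cons r rs ih =>
    have := ih (a + 1) a
    by_cases h : r.cut ≤ B
    · simp only [locateFrom, bind_time, op_val, op_time, h, decide_true, if_true, List.length_cons]
      omega
    · simp only [locateFrom, bind_time, op_val, op_time, h, decide_false, Bool.false_eq_true,
        if_false, pure_time, List.length_cons]
      omega

theorem locate_val (F : List (Row S)) (B : ℝ) :
    (locate F B).val = (F.takeWhile fun r => decide (r.cut ≤ B)).length - 1 := by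
  rw [locate, locateFrom_val]
  split_ifs with h
  · rw [h]
  · omega

theorem locate_time (F : List (Row S)) (B : ℝ) : (locate F B).time ≤ 2 * F.length :=
  locateFrom_time B F 0 0

/-- The cutoff with index `a`. -/
noncomputable def cutoff (F : List (Row S)) (a : ℕ) : ℝ := (cutAt F a).val

/-- The value of the step function `F` at `B`. -/
noncomputable def value (d : S) (F : List (Row S)) (B : ℝ) : S :=
  (outAt d F (locate F B).val).val

/-- `F` is the table of a step function on `[0, 1]` with the cutoffs `c 0 = 0, …, c n = N` in units
of the increment `ε`. -/
structure IsTable (N : ℤ) (ε : ℝ) (F : List (Row S)) (c : ℕ → ℤ) (n : ℕ) : Prop where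
  length : F.length = n + 1
  zero : c 0 = 0
  top : c n = N
  lt : ∀ i j, i < j → j ≤ n → c i < c j
  cutoff : ∀ i, i ≤ n → cutoff F i = c i * ε

section

variable {N : ℤ} {ε : ℝ} {F : List (Row S)} {c : ℕ → ℤ} {n : ℕ}

theorem cutoff_eq_getElem {a : ℕ} (h : a < F.length) : cutoff F a = F[a].cut := by
  simp [cutoff, cutAt, h]

/-- The index of the row that is in force at the budget `z`. -/
noncomputable def index (ε : ℝ) (F : List (Row S)) (z : ℤ) : ℕ := (locate F (z * ε)).val

theorem IsTable.le_iff (h : IsTable N ε F c n) (hε : 0 < ε) {i : ℕ} (hi : i ≤ n) (z : ℤ) :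
    (F[i]'(by have := h.length; omega)).cut ≤ z * ε ↔ c i ≤ z := by
  rw [← cutoff_eq_getElem, h.cutoff i hi, mul_le_mul_iff_left₀ hε, Int.cast_le]

theorem IsTable.index_le (h : IsTable N ε F c n) (z : ℤ) : index ε F z ≤ n := by
  have h1 := (List.takeWhile_prefix (l := F) fun r => decide (r.cut ≤ z * ε)).length_le
  have := h.length
  rw [index, locate_val]
  omega

theorem IsTable.cut_index_le (h : IsTable N ε F c n) (hε : 0 < ε) {z : ℤ} (hz : 0 ≤ z) :
    c (index ε F z) ≤ z := by
  have hn := h.index_le z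
  by_cases h0 : index ε F z = 0
  · rw [h0, h.zero]
    exact hz
  · rw [← h.le_iff hε hn]
    set p : Row S → Bool := fun r => decide (r.cut ≤ z * ε) with hp
    have hidx : index ε F z = (F.takeWhile p).length - 1 := locate_val _ _
    have hlt : index ε F z < (F.takeWhile p).length := by omega
    have h1 := List.all_takeWhile (p := p) (l := F)
    rw [List.all_eq_true] at h1
    have h2 := h1 _ (List.getElem_mem hlt)
    rw [List.IsPrefix.getElem (List.takeWhile_prefix p) hlt] at h2
    simpa [hp] using h2

theorem IsTable.lt_cut_index (h : IsTable N ε F c n) (hε : 0 < ε) {z : ℤ}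
    (hn : index ε F z + 1 ≤ n) : z < c (index ε F z + 1) := by
  set p : Row S → Bool := fun r => decide (r.cut ≤ z * ε) with hp
  have hidx : index ε F z = (F.takeWhile p).length - 1 := locate_val _ _
  have hlen := h.length
  -- the first row that the scan does not accept
  have key : ∀ hlt : (F.takeWhile p).length < F.length, z < c (F.takeWhile p).length := by
    intro hlt
    have h1 : ¬ p (F[(F.takeWhile p).length]) = true := by
      have h2 := List.takeWhile_append_dropWhile (p := p) (l := F)
      have hne : F.dropWhile p ≠ [] := by
        intro h0
        rw [h0, List.append_nil] at h2
        rw [h2] at hlt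
        exact lt_irrefl _ hlt
      have h3 := List.head_dropWhile_not p hne
      have h4 : F[(F.takeWhile p).length] = (F.dropWhile p).head hne := by
        have : F[(F.takeWhile p).length]? = (F.dropWhile p).head? := by
          have h5 := List.getElem?_append_right (l₁ := F.takeWhile p) (l₂ := F.dropWhile p) le_rfl
          rwa [h2, Nat.sub_self, ← List.head?_eq_getElem?] at h5
        rw [List.getElem?_eq_getElem hlt, List.head?_eq_some_head hne] at this
        exact Option.some.inj this
      rw [h4, h3]
      simp
    by_contra! hge
    exact h1 (by simpa [hp] using (h.le_iff hε (by omega) z).mpr hge)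
  by_cases h0 : (F.takeWhile p).length = 0
  · have h1 := key (by omega)
    rw [h0, h.zero] at h1
    have := h.lt 0 (index ε F z + 1) (by omega) hn
    rw [h.zero] at this
    omega
  · have h1 := key (by omega)
    rwa [show index ε F z + 1 = (F.takeWhile p).length by omega]

/-- The row in force is the one between whose cutoff and the next one the budget lies. -/
theorem IsTable.index_eq (h : IsTable N ε F c n) (hε : 0 < ε) {z : ℤ} {a : ℕ} (ha : a ≤ n)
    (h1 : a = 0 ∨ c a ≤ z) (h2 : a + 1 ≤ n → z < c (a + 1)) : index ε F z = a := by
  have hn := h.index_le z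
  rcases lt_trichotomy (index ε F z) a with hlt | heq | hgt
  · have h3 := h.lt_cut_index hε (z := z) (by omega)
    have h4 : c a ≤ z := h1.resolve_left (by omega)
    rcases Nat.lt_or_ge (index ε F z + 1) a with h5 | h5
    · have := h.lt _ _ h5 ha
      omega
    · rw [show index ε F z + 1 = a by omega] at h3
      omega
  · exact heq
  · have h3 := h2 (by omega)
    have hz : 0 ≤ z ∨ z < 0 := by omega
    have h0 := h.zero
    rcases hz with hz | hz
    · have h4 := h.cut_index_le hε hz
      rcases Nat.lt_or_ge (a + 1) (index ε F z) with h5 | h5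
      · have := h.lt _ _ h5 hn
        omega
      · rw [show index ε F z = a + 1 by omega] at h4
        omega
    · exfalso
      -- below all cutoffs the scan accepts no row
      have hidx : index ε F z = (F.takeWhile fun r => decide (r.cut ≤ z * ε)).length - 1 :=
        locate_val _ _
      have h6 : F.takeWhile (fun r => decide (r.cut ≤ z * ε)) = [] := by
        rw [List.takeWhile_eq_nil_iff]
        intro hlen h7
        rw [decide_eq_true_eq] at h7
        have h8 := (h.le_iff hε (Nat.zero_le n) z).mp h7
        omega
      rw [h6] at hidx
      simp at hidx
      omega

theorem IsTable.index_of_nonpos (h : IsTable N ε F c n) (hε : 0 < ε) {z : ℤ} (hz : z ≤ 0) :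
    index ε F z = 0 :=
  h.index_eq hε (Nat.zero_le n) (.inl rfl) fun h1 => by
    have := h.lt 0 (0 + 1) (by omega) h1
    have := h.zero
    omega

theorem IsTable.index_mono (h : IsTable N ε F c n) (hε : 0 < ε) {y z : ℤ} (hyz : y ≤ z) :
    index ε F y ≤ index ε F z := by
  by_contra! hlt
  have hn := h.index_le y
  have hy : 0 ≤ y := by
    by_contra! hy
    have h1 := h.index_of_nonpos hε hy.le
    omega
  have h1 := h.cut_index_le hε hy
  have h2 := h.lt_cut_index hε (z := z) (by omega)
  rcases Nat.lt_or_ge (index ε F z + 1) (index ε F y) with h5 | h5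
  · have := h.lt _ _ h5 hn
    omega
  · rw [show index ε F z + 1 = index ε F y by omega] at h2
    omega

theorem IsTable.cut_nonneg (h : IsTable N ε F c n) {i : ℕ} (hi : i ≤ n) : 0 ≤ c i := by
  rcases Nat.eq_zero_or_pos i with rfl | h0
  · exact h.zero.ge
  · have := h.lt 0 i h0 hi
    have := h.zero
    omega

theorem IsTable.cut_le (h : IsTable N ε F c n) {i : ℕ} (hi : i ≤ n) : c i ≤ N := by
  rcases hi.eq_or_lt with rfl | h0
  · exact h.top.le
  · have := h.lt i n h0 le_rfl
    have := h.top
    omega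

/-- The step function in units of the increment. -/
noncomputable def stepFun (ε : ℝ) (d : S) (F : List (Row S)) (z : ℤ) : S := value d F (z * ε)

theorem stepFun_eq_of_index_eq {d : S} {y z : ℤ} (h : index ε F y = index ε F z) :
    stepFun ε d F y = stepFun ε d F z := by
  unfold stepFun value
  unfold index at h
  rw [h]

theorem IsTable.isStep (h : IsTable N ε F c n) (hε : 0 < ε) (d : S) :
    Auction.IsStep N (fun x => ∃ i ≤ n, c i = x) (stepFun ε d F) where
  zero := ⟨0, Nat.zero_le n, h.zero⟩
  top := ⟨n, le_rfl, h.top⟩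
  floor z hz := by
    have hn := h.index_le z
    refine ⟨_, ⟨_, hn, rfl⟩, h.cut_nonneg hn, h.cut_index_le hε hz, fun y hy hyz => ?_⟩
    exact stepFun_eq_of_index_eq (h.index_eq hε hn (.inr hy) fun h1 =>
      hyz.trans_lt (h.lt_cut_index hε h1))
  next z hz := by
    by_cases h1 : index ε F z + 1 ≤ n
    · refine ⟨_, ⟨_, h1, rfl⟩, h.lt_cut_index hε h1, fun y hzy hy => ?_⟩
      refine stepFun_eq_of_index_eq (h.index_eq hε (h.index_le z) ?_ fun _ => hy)
      by_cases h0 : 0 ≤ z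
      · exact .inr ((h.cut_index_le hε h0).trans hzy)
      · left
        exact h.index_of_nonpos hε (by omega)
    · have hn := h.index_le z
      refine ⟨N, ⟨n, le_rfl, h.top⟩, hz, fun y hzy hy => stepFun_eq_of_index_eq ?_⟩
      have := h.index_mono hε hzy
      have := h.index_le y
      omega
  below z hz := by
    exact stepFun_eq_of_index_eq
      ((h.index_of_nonpos hε hz).trans (h.index_of_nonpos hε le_rfl).symm)

end

end FindPSPEFast

/-! ### One round of the accelerated auction -/

namespace FindPSPEFast

open Timed Auction
open scoped Classical

variable {S : Type} {G : BiddingGame S}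

theorem prefersTest_val (i : Player) (t t' : S) :
    (prefersTest G i t t').val = decide (G.score i t' < G.score i t) := by
  rw [Bool.eq_iff_iff, decide_eq_true_eq, ← BiddingGame.prefers_iff, BiddingGame.Prefers]
  unfold prefersTest
  by_cases h1 : G.u i t' < G.u i t
  · simp [h1]
  · by_cases h2 : G.u i t = G.u i t' <;> simp [h1, h2]

theorem prefersTest_time (i : Player) (t t' : S) : (prefersTest G i t t').time ≤ 3 := by
  unfold prefersTest
  by_cases h1 : G.u i t' < G.u i t
  · simp [h1]
  · by_cases h2 : G.u i t = G.u i t' <;> simp [h1, h2]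

theorem outAt_time (d : S) (F : List (Row S)) (a : ℕ) : (outAt d F a).time = 1 := rfl

theorem cutAt_time (F : List (Row S)) (a : ℕ) : (cutAt F a).time = 1 := rfl

/-- The bid of white up to which black raises in one round of the accelerated auction. -/
noncomputable def nextBid (F₁ F₂ : List (Row S)) (B : ℝ) (a₁ a₂ : ℕ) : ℝ :=
  if a₁ = 0 then cutoff F₂ (a₂ + 1) - B
  else min (B - cutoff F₁ (a₁ - 1)) (cutoff F₂ (a₂ + 1) - B)

/-- A bound for the time of one round of an auction. -/
def roundTime (F₁ F₂ : List (Row S)) : ℕ := 4 * F₁.length + 4 * F₂.length + 40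

section

variable {ε B : ℝ} {s₁ s₂ : S} {F₁ F₂ : List (Row S)} (rounds : ℕ) (b₁ : ℝ)

/-- Black does not raise, and white wins. -/
theorem auctionLoop_white
    (h : 1 - B < b₁ + ε ∨
      ¬ G.bScore (value s₁ F₁ (B - b₁)) < G.bScore (value s₂ F₂ (B + (b₁ + ε)))) :
    (auctionLoop G ε B s₁ s₂ F₁ F₂ (rounds + 1) b₁).val.cut = B ∧
    (auctionLoop G ε B s₁ s₂ F₁ F₂ (rounds + 1) b₁).val.out = value s₁ F₁ (B - b₁) ∧
    (auctionLoop G ε B s₁ s₂ F₁ F₂ (rounds + 1) b₁).time ≤ roundTime F₁ F₂ := by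
  have hc : (decide (1 - B < b₁ + ε) || !(prefersTest G Player.black
      (outAt s₂ F₂ (locate F₂ (B + (b₁ + ε))).val).val
      (outAt s₁ F₁ (locate F₁ (B - b₁)).val).val).val) = true := by
    rw [prefersTest_val]
    simpa [value] using h
  rw [auctionLoop]
  simp only [bind_val, bind_time, op_val, op_time, outAt_time, hc, if_true, pure_val, pure_time]
  refine ⟨trivial, rfl, ?_⟩
  have h1 := locate_time F₁ (B - b₁)
  have h2 := locate_time F₂ (B + b₁)
  have h3 := locate_time F₂ (B + (b₁ + ε))
  have h4 := prefersTest_time (G := G) Player.black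
    (outAt s₂ F₂ (locate F₂ (B + (b₁ + ε))).val).val (outAt s₁ F₁ (locate F₁ (B - b₁)).val).val
  unfold roundTime
  omega

/-- Black raises; then either white does not match the next bid, or another round follows. -/
theorem auctionLoop_black_or
    (h : ¬ (1 - B < b₁ + ε ∨
      ¬ G.bScore (value s₁ F₁ (B - b₁)) < G.bScore (value s₂ F₂ (B + (b₁ + ε))))) {b : ℝ}
    (hb : b = nextBid F₁ F₂ B (locate F₁ (B - b₁)).val (locate F₂ (B + b₁)).val) :
    ((B < b ∨ ¬ G.wScore (value s₂ F₂ (B + (b₁ + ε))) < G.wScore (value s₁ F₁ (B - b))) →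
      (auctionLoop G ε B s₁ s₂ F₁ F₂ (rounds + 1) b₁).val.cut = B ∧
      (auctionLoop G ε B s₁ s₂ F₁ F₂ (rounds + 1) b₁).val.out = value s₂ F₂ (B + (b₁ + ε)) ∧
      (auctionLoop G ε B s₁ s₂ F₁ F₂ (rounds + 1) b₁).time ≤ roundTime F₁ F₂) ∧
    (¬ (B < b ∨ ¬ G.wScore (value s₂ F₂ (B + (b₁ + ε))) < G.wScore (value s₁ F₁ (B - b))) →
      (auctionLoop G ε B s₁ s₂ F₁ F₂ (rounds + 1) b₁).val =
        (auctionLoop G ε B s₁ s₂ F₁ F₂ rounds b).val ∧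
      (auctionLoop G ε B s₁ s₂ F₁ F₂ (rounds + 1) b₁).time ≤
        (auctionLoop G ε B s₁ s₂ F₁ F₂ rounds b).time +
          roundTime F₁ F₂) := by
  have hc : (decide (1 - B < b₁ + ε) || !(prefersTest G Player.black
      (outAt s₂ F₂ (locate F₂ (B + (b₁ + ε))).val).val
      (outAt s₁ F₁ (locate F₁ (B - b₁)).val).val).val) = false := by
    rw [prefersTest_val]
    rw [not_or, not_not] at h
    simpa [value] using h
  obtain ⟨a₁, ha₁⟩ : ∃ a₁, (locate F₁ (B - b₁)).val = a₁ := ⟨_, rfl⟩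
  obtain ⟨a₂, ha₂⟩ : ∃ a₂, (locate F₂ (B + b₁)).val = a₂ := ⟨_, rfl⟩
  rw [ha₁] at hc hb
  rw [ha₂] at hb
  -- the computation of the next bid
  obtain ⟨y, hy, hyt, hyv⟩ : ∃ y : Timed ℝ, y = (if decide (a₁ = 0) = true then
        pure ((cutAt F₂ (a₂ + 1)).val - B)
      else do
        let c₁ ← cutAt F₁ (a₁ - 1)
        let y₁ ← op (B - c₁)
        op (min y₁ ((cutAt F₂ (a₂ + 1)).val - B))) ∧ y.time ≤ 3 ∧ y.val = b := by
    refine ⟨_, rfl, ?_, ?_⟩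
    · by_cases h0 : a₁ = 0
      · simp [h0]
      · simp [h0, cutAt]
    · rw [hb, nextBid]
      by_cases h0 : a₁ = 0
      · simp [h0, cutoff]
      · simp [h0, cutoff]
  have h1 := locate_time F₁ (B - b₁)
  have h2 := locate_time F₂ (B + b₁)
  have h3 := locate_time F₂ (B + (b₁ + ε))
  have h4 := prefersTest_time (G := G) Player.black
    (outAt s₂ F₂ (locate F₂ (B + (b₁ + ε))).val).val (outAt s₁ F₁ a₁).val
  have h5 := locate_time F₁ (B - b)
  have h6 := prefersTest_time (G := G) Player.white
    (outAt s₁ F₁ (locate F₁ (B - b)).val).val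
    (outAt s₂ F₂ (locate F₂ (B + (b₁ + ε))).val).val
  constructor
  · intro h'
    have hc' : (decide (B < b) || !(prefersTest G Player.white
        (outAt s₁ F₁ (locate F₁ (B - b)).val).val
        (outAt s₂ F₂ (locate F₂ (B + (b₁ + ε))).val).val).val) = true := by
      rw [prefersTest_val]
      simpa [value] using h'
    rw [auctionLoop]
    simp only [bind_val, bind_time, op_val, op_time, outAt_time, cutAt_time,
      ha₁, ha₂, hc, Bool.false_eq_true, if_false, ← hy, hyv, sub_add_cancel, hc', if_true,
      pure_val, pure_time]
    refine ⟨trivial, rfl, ?_⟩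
    unfold roundTime
    linarith
  · intro h'
    have hc' : (decide (B < b) || !(prefersTest G Player.white
        (outAt s₁ F₁ (locate F₁ (B - b)).val).val
        (outAt s₂ F₂ (locate F₂ (B + (b₁ + ε))).val).val).val) = false := by
      rw [prefersTest_val]
      rw [not_or, not_not] at h'
      simpa [value] using h'
    rw [auctionLoop]
    simp only [bind_val, bind_time, op_val, op_time, outAt_time, cutAt_time,
      ha₁, ha₂, hc, Bool.false_eq_true, if_false, ← hy, hyv, sub_add_cancel, hc']
    refine ⟨trivial, ?_⟩
    unfold roundTime
    linarith

end

end FindPSPEFast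

/-! ### Correctness of the accelerated auction -/

namespace FindPSPEFast

open Timed Auction
open scoped Classical

variable {S : Type} {G : BiddingGame S}

section

variable {N : ℤ} {ε : ℝ} {F : List (Row S)} {c : ℕ → ℤ} {n : ℕ}

theorem IsTable.le_index_iff (h : IsTable N ε F c n) (hε : 0 < ε) {z : ℤ} (hz : 0 ≤ z) {a : ℕ}
    (ha : a ≤ n) : a ≤ index ε F z ↔ c a ≤ z := by
  constructor
  · intro hle
    have h1 := h.cut_index_le hε hz
    rcases hle.eq_or_lt with heq | hlt
    · rwa [heq]
    · have := h.lt _ _ hlt (h.index_le z)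
      omega
  · intro hle
    by_contra! hlt
    have h1 := h.lt_cut_index hε (z := z) (by omega)
    rcases Nat.lt_or_ge (index ε F z + 1) a with h2 | h2
    · have := h.lt _ _ h2 ha
      omega
    · rw [show index ε F z + 1 = a by omega] at h1
      omega

theorem IsTable.lt_of_cut (h : IsTable N ε F c n) (hε : 0 < ε) {z : ℤ} (hz : 0 ≤ z) (hzN : z < N) :
    index ε F z + 1 ≤ n := by
  have h1 := h.index_le z
  have h2 := h.cut_index_le hε hz
  by_contra hn
  rw [show index ε F z = n by omega, h.top] at h2
  omega

end

/-- The situation of an auction at the budget `k`: white wants to move to `s₁` and black to `s₂`. -/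
structure Setting (G : BiddingGame S) (N : ℤ) (ε : ℝ) (s₁ s₂ : S) (F₁ F₂ : List (Row S))
    (c₁ c₂ : ℕ → ℤ) (n₁ n₂ : ℕ) (k : ℤ) : Prop where
  pos : 0 < ε
  unit : N * ε = 1
  table₁ : IsTable N ε F₁ c₁ n₁
  table₂ : IsTable N ε F₂ c₂ n₂
  even₁ : ∀ i ≤ n₁, Even (c₁ i)
  even₂ : ∀ i ≤ n₂, Even (c₂ i)
  mono₁ : G.MonoOutcome (stepFun ε s₁ F₁)
  mono₂ : G.MonoOutcome (stepFun ε s₂ F₂)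
  top : G.wScore (stepFun ε s₂ F₂ N) = G.wScore (stepFun ε s₂ F₂ (N - 1))
  even : Even k
  le : k ≤ N

section

variable {N : ℤ} {ε : ℝ} {s₁ s₂ : S} {F₁ F₂ : List (Row S)} {c₁ c₂ : ℕ → ℤ} {n₁ n₂ : ℕ} {k : ℤ}

/-- In each round of the accelerated auction, white comes at least one interval down or black at
least one interval up. -/
theorem Setting.exists_skip (h : Setting G N ε s₁ s₂ F₁ F₂ c₁ c₂ n₁ n₂ k) {j : ℤ} (hj0 : 0 ≤ j)
    (hjk : j ≤ k) (hjK : j + 1 ≤ N - k) :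
    ∃ i : ℤ, nextBid F₁ F₂ (k * ε) (index ε F₁ (k - j)) (index ε F₂ (k + j)) = i * ε ∧
      Skip (stepFun ε s₁ F₁) (stepFun ε s₂ F₂) k N j i (c₁ (index ε F₁ (k - j))) ∧
      (i ≤ k → index ε F₁ (k - i) + (n₂ - index ε F₂ (k + i)) + 1 ≤
        index ε F₁ (k - j) + (n₂ - index ε F₂ (k + j))) := by
  have t₁ := h.table₁
  have t₂ := h.table₂
  have hε := h.pos
  set i₁ := index ε F₁ (k - j) with hi₁
  set i₂ := index ε F₂ (k + j) with hi₂
  have h1n : i₁ ≤ n₁ := t₁.index_le _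
  have h2n : i₂ + 1 ≤ n₂ := t₂.lt_of_cut hε (by omega) (by omega)
  have hα : c₁ i₁ ≤ k - j := t₁.cut_index_le hε (by omega)
  have hα0 := t₁.cut_nonneg h1n
  have hβ : k + j < c₂ (i₂ + 1) := t₂.lt_cut_index hε h2n
  have hβN := t₂.cut_le h2n
  -- the next bid in units of the increment
  obtain ⟨i, hi, hiβ, hcase, hcut⟩ : ∃ i : ℤ,
      nextBid F₁ F₂ (k * ε) i₁ i₂ = i * ε ∧ i ≤ c₂ (i₂ + 1) - k ∧
      (i = c₂ (i₂ + 1) - k ∨ (i₁ ≠ 0 ∧ i = k - c₁ (i₁ - 1))) ∧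
      (i₁ ≠ 0 → i ≤ k - c₁ (i₁ - 1)) := by
    unfold nextBid
    rw [t₂.cutoff _ h2n]
    by_cases h0 : i₁ = 0
    · refine ⟨c₂ (i₂ + 1) - k, ?_, le_rfl, .inl rfl, fun h => (h h0).elim⟩
      rw [if_pos h0]
      push_cast
      ring
    · refine ⟨min (k - c₁ (i₁ - 1)) (c₂ (i₂ + 1) - k), ?_, min_le_right _ _, ?_,
        fun _ => min_le_left _ _⟩
      · rw [if_neg h0, t₁.cutoff _ (by omega), Int.cast_min, min_mul_of_nonneg _ _ hε.le]
        push_cast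
        congr 1 <;> ring
      · rcases min_choice (k - c₁ (i₁ - 1)) (c₂ (i₂ + 1) - k) with h | h <;> rw [h]
        · exact .inr ⟨h0, rfl⟩
        · exact .inl rfl
  have hαlt : i₁ ≠ 0 → c₁ (i₁ - 1) < c₁ i₁ := fun h0 => t₁.lt _ _ (by omega) h1n
  have hji : j < i := by
    rcases hcase with h | ⟨h0, h⟩
    · omega
    · have := hαlt h0
      omega
  refine ⟨i, hi, ⟨hji, ?_, by omega, h.even₁ _ h1n, hα, hα0, ?_, ?_, ?_, ?_⟩, ?_⟩
  · rcases hcase with h' | ⟨h0, h'⟩ <;> rw [h']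
    · exact (h.even₂ _ h2n).sub h.even
    · exact h.even.sub (h.even₁ _ (by omega))
  · intro z hz hz'
    exact stepFun_eq_of_index_eq (t₁.index_eq hε h1n (.inr hz) fun h =>
      hz'.trans_lt (t₁.lt_cut_index hε h))
  · intro z hz hz'
    apply stepFun_eq_of_index_eq
    by_cases h0 : i₁ = 0
    · rw [h0, t₁.zero] at hz' ⊢
      rw [t₁.index_of_nonpos hε (by omega), t₁.index_of_nonpos hε (by omega)]
    · have h1 := hcut h0
      have h2 := hαlt h0
      have h3 : i₁ - 1 + 1 = i₁ := by omega
      rw [t₁.index_eq hε (a := i₁ - 1) (by omega) (.inr (by omega)) fun _ => by rwa [h3],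
        t₁.index_eq hε (a := i₁ - 1) (by omega) (.inr (by omega)) fun _ => by rw [h3]; omega]
  · intro z hz hz'
    refine stepFun_eq_of_index_eq (t₂.index_eq hε (by omega) (.inr ?_) fun _ => ?_)
    · exact (t₂.cut_index_le hε (by omega)).trans hz
    · have : z < c₂ (i₂ + 1) := by omega
      exact this
  · intro hki
    by_contra h0
    have hi0 : i₁ ≠ 0 := fun h => h0 (by rw [h, t₁.zero])
    have := hcut hi0
    have := t₁.cut_nonneg (i := i₁ - 1) (by omega)
    omega
  · intro hik
    have m₁ := t₁.index_mono hε (show k - i ≤ k - j by omega)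
    have m₂ := t₂.index_mono hε (show k + j ≤ k + i by omega)
    have := t₂.index_le (k + i)
    rcases hcase with h' | ⟨h0, h'⟩
    · have h4 := (t₂.le_index_iff hε (z := k + i) (by omega) h2n).mpr (by omega)
      omega
    · have h4 := hαlt h0
      have h5 : ¬ i₁ ≤ index ε F₁ (k - i) := by
        rw [t₁.le_index_iff hε (by omega) h1n]
        omega
      omega

/-- The accelerated auction computes the outcome of the auction, in as many rounds as there are
intervals. -/
theorem Setting.auctionLoop (h : Setting G N ε s₁ s₂ F₁ F₂ c₁ c₂ n₁ n₂ k)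
    (rounds : ℕ) (j : ℤ) (hj : Even j) (hj0 : 0 ≤ j) (hjk : j ≤ k) (hjK : j ≤ N - k)
    (hr : N + 1 ≤ rounds + j)
    (hinv : Skipped G.wScore G.bScore (stepFun ε s₁ F₁) (stepFun ε s₂ F₂) k (N - k) j) :
    (auctionLoop G ε (k * ε) s₁ s₂ F₁ F₂ rounds (j * ε)).val.cut = k * ε ∧
    Contest G.wScore G.bScore (stepFun ε s₁ F₁) (stepFun ε s₂ F₂) k (N - k)
      (auctionLoop G ε (k * ε) s₁ s₂ F₁ F₂ rounds (j * ε)).val.out ∧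
    (auctionLoop G ε (k * ε) s₁ s₂ F₁ F₂ rounds (j * ε)).time ≤
      (index ε F₁ (k - j) + (n₂ - index ε F₂ (k + j)) + 1) * roundTime F₁ F₂ := by
  have hε := h.pos
  have oX : ∀ z, Odd z → stepFun ε s₁ F₁ z = stepFun ε s₁ F₁ (z - 1) := fun z hz =>
    (h.table₁.isStep hε s₁).odd_eq (by rintro x ⟨i, hi, rfl⟩; exact h.even₁ i hi) hz
  have oY : ∀ z, Odd z → stepFun ε s₂ F₂ z = stepFun ε s₂ F₂ (z - 1) := fun z hz =>
    (h.table₂.isStep hε s₂).odd_eq (by rintro x ⟨i, hi, rfl⟩; exact h.even₂ i hi) hz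
  induction rounds generalizing j with
  | zero => simp at hr; omega
  | succ rounds ih =>
    have e1 : (k : ℝ) * ε - j * ε = ((k - j : ℤ) : ℝ) * ε := by push_cast; ring
    have e2 : (k : ℝ) * ε + (j * ε + ε) = ((k + j + 1 : ℤ) : ℝ) * ε := by push_cast; ring
    have e3 : (1 - (k : ℝ) * ε < j * ε + ε) ↔ ¬ j + 1 ≤ N - k := by
      have : (1 - (k : ℝ) * ε < j * ε + ε) ↔ ((N - k : ℤ) : ℝ) * ε < ((j + 1 : ℤ) : ℝ) * ε := by
        rw [← h.unit]
        push_cast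
        constructor <;> intro h <;> linarith
      rw [this, mul_lt_mul_iff_left₀ hε, Int.cast_lt, not_le]
    have e4 : (k : ℝ) * ε + j * ε = ((k + j : ℤ) : ℝ) * ε := by push_cast; ring
    have hround : roundTime F₁ F₂ ≤
        (index ε F₁ (k - j) + (n₂ - index ε F₂ (k + j)) + 1) * roundTime F₁ F₂ :=
      Nat.le_mul_of_pos_left _ (by omega)
    by_cases h_halt : 1 - (k : ℝ) * ε < j * ε + ε ∨
        ¬ G.bScore (value s₁ F₁ (k * ε - j * ε)) < G.bScore (value s₂ F₂ (k * ε + (j * ε + ε)))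
    · obtain ⟨hcut, hout, htime⟩ := auctionLoop_white rounds (j * ε) h_halt
      refine ⟨hcut, ?_, htime.trans hround⟩
      rw [e1, e2, e3] at h_halt
      rw [hout, e1]
      refine hinv.contest_white oX oY h.top h.even hj hjk hjK fun hle => ?_
      rcases h_halt with h' | h'
      · exact (h' hle).elim
      · exact not_lt.mp h'
    · have hor := fun b => auctionLoop_black_or (s₁ := s₁) (s₂ := s₂) (F₁ := F₁) (F₂ := F₂) rounds
        (j * ε) h_halt (b := b)
      rw [e1, e2, e3, not_or, not_not, not_not] at h_halt
      obtain ⟨hle, hgain⟩ := h_halt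
      obtain ⟨i, hi, hs, hpot⟩ := h.exists_skip hj0 hjk hle
      have hlt := hs.lt
      have e5 : (k : ℝ) * ε - i * ε = ((k - i : ℤ) : ℝ) * ε := by push_cast; ring
      have e6 : (k : ℝ) * ε < i * ε ↔ k < i := by rw [mul_lt_mul_iff_left₀ hε, Int.cast_lt]
      obtain ⟨hblack, hcont⟩ := hor (i * ε) (by rw [← hi, e1, e4]; rfl)
      rw [e2, e5, e6] at hblack hcont
      by_cases h_halt : k < i ∨ ¬ G.wScore (value s₂ F₂ ((k + j + 1 : ℤ) * ε)) <
          G.wScore (value s₁ F₁ ((k - i : ℤ) * ε))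
      · obtain ⟨hcut, hout, htime⟩ := hblack h_halt
        refine ⟨hcut, ?_, htime.trans hround⟩
        rw [hout]
        exact hinv.contest_black h.mono₁ oX oY h.even hj hjk hs hle hgain
          (h_halt.imp_right not_lt.mp)
      · obtain ⟨hval, htime⟩ := hcont h_halt
        rw [not_or, not_not, not_lt] at h_halt
        have hinv' := hinv.continue h.mono₂ oX oY h.mono₁ h.even hj hjk hs hle hgain
          h_halt.1 h_halt.2
        obtain ⟨hcut, hout, htime'⟩ := ih i hs.even (by omega) h_halt.1 hs.leK
          (by push_cast at hr; omega) hinv'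
        rw [hval]
        refine ⟨hcut, hout, htime.trans (le_trans ?_ (Nat.mul_le_mul_right (roundTime F₁ F₂)
          (Nat.add_le_add_right (hpot h_halt.1) 1)))⟩
        rw [Nat.succ_mul]
        exact Nat.add_le_add_right htime' _

end

end FindPSPEFast

/-! ### The auction with the stored step functions -/

namespace FindPSPEFast

open Timed Auction
open scoped Classical

variable {S : Type} {G : BiddingGame S}

section

variable {N : ℤ} {ε : ℝ} {l r : S} {Fl Fr : List (Row S)} {cl cr : ℕ → ℤ} {nl nr : ℕ} {k : ℤ}

theorem Setting.start {s₁ s₂ : S} {F₁ F₂ : List (Row S)} {c₁ c₂ : ℕ → ℤ} {n₁ n₂ : ℕ}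
    (h : Setting G N ε s₁ s₂ F₁ F₂ c₁ c₂ n₁ n₂ k) (hk : 0 ≤ k) {rounds : ℕ}
    (hr : N + 1 ≤ rounds)
    (hw : G.wScore (stepFun ε s₂ F₂ k) < G.wScore (stepFun ε s₁ F₁ k)) :
    (FindPSPEFast.auctionLoop G ε (k * ε) s₁ s₂ F₁ F₂ rounds 0).val.cut = k * ε ∧
    Contest G.wScore G.bScore (stepFun ε s₁ F₁) (stepFun ε s₂ F₂) k (N - k)
      (FindPSPEFast.auctionLoop G ε (k * ε) s₁ s₂ F₁ F₂ rounds 0).val.out ∧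
    (FindPSPEFast.auctionLoop G ε (k * ε) s₁ s₂ F₁ F₂ rounds 0).time ≤
      (F₁.length + F₂.length) * roundTime F₁ F₂ := by
  have hkN := h.le
  have h0 := h.auctionLoop rounds 0 ⟨0, rfl⟩ le_rfl hk (by omega) (by omega)
    (.start rfl ⟨le_rfl, hk, by omega, by simpa using hw, fun h => (lt_irrefl _ h).elim⟩)
  rw [Int.cast_zero, zero_mul] at h0
  refine ⟨h0.1, h0.2.1, h0.2.2.trans (Nat.mul_le_mul_right _ ?_)⟩
  have h1 := h.table₁.length
  have h2 := h.table₂.length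
  have h3 := h.table₁.index_le (k - 0)
  omega

/-- At even multiples of the increment, the auction on the tables of the children gives the outcome
of the turn. -/
theorem ascendingAuction_spec (hε : 0 < ε) (hN : N * ε = 1)
    (tl : IsTable N ε Fl cl nl) (tr : IsTable N ε Fr cr nr)
    (el : ∀ i ≤ nl, Even (cl i)) (er : ∀ i ≤ nr, Even (cr i))
    (ml : G.MonoOutcome (stepFun ε l Fl)) (mr : G.MonoOutcome (stepFun ε r Fr))
    (topl : G.wScore (stepFun ε l Fl N) = G.wScore (stepFun ε l Fl (N - 1)))
    (topr : G.wScore (stepFun ε r Fr N) = G.wScore (stepFun ε r Fr (N - 1)))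
    (hk : Even k) (hk0 : 0 ≤ k) (hkN : k ≤ N) {rounds : ℕ} (hr : N + 1 ≤ rounds) :
    (ascendingAuction G rounds ε l r Fl Fr (k * ε)).val.cut = k * ε ∧
    Turn G.wScore G.bScore (stepFun ε l Fl) (stepFun ε r Fr) k (N - k)
      (ascendingAuction G rounds ε l r Fl Fr (k * ε)).val.out ∧
    (ascendingAuction G rounds ε l r Fl Fr (k * ε)).time ≤
      (Fl.length + Fr.length + 1) * roundTime Fl Fr := by
  have t1 := locate_time Fl (k * ε)
  have t2 := locate_time Fr (k * ε)
  have t3 := prefersTest_time (G := G) Player.white (stepFun ε r Fr k) (stepFun ε l Fl k)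
  have t4 := prefersTest_time (G := G) Player.black (stepFun ε r Fr k) (stepFun ε l Fl k)
  have hl : (outAt l Fl (locate Fl (k * ε)).val).val = stepFun ε l Fl k := rfl
  have hr' : (outAt r Fr (locate Fr (k * ε)).val).val = stepFun ε r Fr k := rfl
  have hbase : (locate Fl (k * ε)).time + (locate Fr (k * ε)).time + 8 ≤ roundTime Fl Fr := by
    unfold roundTime
    omega
  by_cases hw : G.wScore (stepFun ε l Fl k) < G.wScore (stepFun ε r Fr k)
  · by_cases hb : G.bScore (stepFun ε l Fl k) < G.bScore (stepFun ε r Fr k)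
    · have hval : (ascendingAuction G rounds ε l r Fl Fr (k * ε)).val.cut = k * ε ∧
          (ascendingAuction G rounds ε l r Fl Fr (k * ε)).val.out = stepFun ε r Fr k := by
        simp [ascendingAuction, hl, hr', prefersTest_val, hw, hb]
      have htime : (ascendingAuction G rounds ε l r Fl Fr (k * ε)).time ≤ roundTime Fl Fr := by
        simp only [ascendingAuction, bind_time, outAt_time, hl, hr', prefersTest_val, hw, hb,
          decide_true, if_true, pure_time]
        linarith
      refine ⟨hval.1, ?_, htime.trans (Nat.le_mul_of_pos_left _ (by omega))⟩
      rw [hval.2]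
      exact .agree (.inr rfl) hw.le le_rfl hb.le le_rfl
    · have hlt : G.bScore (stepFun ε r Fr k) < G.bScore (stepFun ε l Fl k) := by
        refine (not_lt.mp hb).lt_of_ne fun heq => hw.ne ?_
        exact ((G.wScore_eq_iff _ _).mpr heq).symm
      have hset : Setting G N ε r l Fr Fl cr cl nr nl k :=
        ⟨hε, hN, tr, tl, er, el, mr, ml, topl, hk, hkN⟩
      obtain ⟨h1, h2, h3⟩ := hset.start hk0 hr hw
      have hval : (ascendingAuction G rounds ε l r Fl Fr (k * ε)).val =
          (FindPSPEFast.auctionLoop G ε (k * ε) r l Fr Fl rounds 0).val := by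
        simp [ascendingAuction, hl, hr', prefersTest_val, hw, hb]
      have htime : (ascendingAuction G rounds ε l r Fl Fr (k * ε)).time ≤ roundTime Fl Fr +
          (FindPSPEFast.auctionLoop G ε (k * ε) r l Fr Fl rounds 0).time := by
        simp only [ascendingAuction, bind_time, outAt_time, hl, hr', prefersTest_val, hw, hb,
          decide_true, if_true, decide_false, Bool.false_eq_true, if_false]
        linarith
      rw [hval]
      refine ⟨h1, .right hw hlt h2, htime.trans ?_⟩
      have hcomm : roundTime Fr Fl = roundTime Fl Fr := by unfold roundTime; omega
      rw [hcomm, add_comm Fr.length] at h3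
      rw [Nat.succ_mul]
      omega
  · by_cases hb : G.bScore (stepFun ε l Fl k) < G.bScore (stepFun ε r Fr k)
    · have hlt : G.wScore (stepFun ε r Fr k) < G.wScore (stepFun ε l Fl k) := by
        refine (not_lt.mp hw).lt_of_ne fun heq => hb.ne ?_
        exact ((G.wScore_eq_iff _ _).mp heq).symm
      have hset : Setting G N ε l r Fl Fr cl cr nl nr k :=
        ⟨hε, hN, tl, tr, el, er, ml, mr, topr, hk, hkN⟩
      obtain ⟨h1, h2, h3⟩ := hset.start hk0 hr hlt
      have hval : (ascendingAuction G rounds ε l r Fl Fr (k * ε)).val =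
          (FindPSPEFast.auctionLoop G ε (k * ε) l r Fl Fr rounds 0).val := by
        simp [ascendingAuction, hl, hr', prefersTest_val, hw, hb]
      have htime : (ascendingAuction G rounds ε l r Fl Fr (k * ε)).time ≤ roundTime Fl Fr +
          (FindPSPEFast.auctionLoop G ε (k * ε) l r Fl Fr rounds 0).time := by
        simp only [ascendingAuction, bind_time, outAt_time, hl, hr', prefersTest_val, hw, hb,
          decide_true, if_true, decide_false, Bool.false_eq_true, if_false]
        linarith
      rw [hval]
      refine ⟨h1, .left hlt hb h2, htime.trans ?_⟩
      rw [Nat.succ_mul]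
      omega
    · have hval : (ascendingAuction G rounds ε l r Fl Fr (k * ε)).val.cut = k * ε ∧
          (ascendingAuction G rounds ε l r Fl Fr (k * ε)).val.out = stepFun ε l Fl k := by
        simp [ascendingAuction, hl, hr', prefersTest_val, hw, hb]
      have htime : (ascendingAuction G rounds ε l r Fl Fr (k * ε)).time ≤ roundTime Fl Fr := by
        simp only [ascendingAuction, bind_time, outAt_time, hl, hr', prefersTest_val, hw, hb,
          decide_false, Bool.false_eq_true, if_false, pure_time]
        linarith
      refine ⟨hval.1, ?_, htime.trans (Nat.le_mul_of_pos_left _ (by omega))⟩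
      rw [hval.2]
      exact .agree (.inl rfl) le_rfl (not_lt.mp hw) le_rfl (not_lt.mp hb)

end

/-! ### Critical budgets -/

theorem averagesWith_spec (x : ℝ) (F : List (Row S)) (acc : List ℝ) :
    (∀ z, z ∈ (averagesWith x F acc).val ↔ z ∈ acc ∨ ∃ r ∈ F, z = (x + r.cut) / 2) ∧
    (averagesWith x F acc).val.length = acc.length + F.length ∧
    (averagesWith x F acc).time = 3 * F.length := by
  induction F generalizing acc with
  | nil => simp [averagesWith]
  | cons r rs ih =>
    obtain ⟨h1, h2, h3⟩ := ih ((x + r.cut) / 2 :: acc)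
    simp only [averagesWith, bind_val, bind_time, op_val, op_time, List.length_cons]
    refine ⟨fun z => ?_, by rw [h2, List.length_cons]; omega, by rw [h3]; omega⟩
    rw [h1, List.mem_cons, List.exists_mem_cons_iff]
    tauto

theorem averages_spec (Fr Fl : List (Row S)) (acc : List ℝ) :
    (∀ z, z ∈ (averages Fr Fl acc).val ↔
      z ∈ acc ∨ ∃ r ∈ Fl, ∃ r' ∈ Fr, z = (r.cut + r'.cut) / 2) ∧
    (averages Fr Fl acc).val.length = acc.length + Fl.length * Fr.length ∧
    (averages Fr Fl acc).time = Fl.length * (3 * Fr.length + 1) := by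
  induction Fl generalizing acc with
  | nil => simp [averages]
  | cons r rs ih =>
    obtain ⟨a1, a2, a3⟩ := averagesWith_spec r.cut Fr acc
    obtain ⟨h1, h2, h3⟩ := ih (averagesWith r.cut Fr acc).val
    simp only [averages, bind_val, bind_time, op_val, op_time, List.length_cons]
    refine ⟨fun z => ?_, by rw [h2, a2]; ring, by rw [h3, a3]; ring⟩
    rw [h1, a1, List.exists_mem_cons_iff]
    exact or_assoc

theorem cuts_spec (F : List (Row S)) (acc : List ℝ) :
    (∀ z, z ∈ (cuts F acc).val ↔ z ∈ acc ∨ ∃ r ∈ F, z = r.cut) ∧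
    (cuts F acc).val.length = acc.length + F.length ∧ (cuts F acc).time = F.length := by
  induction F generalizing acc with
  | nil => simp [cuts]
  | cons r rs ih =>
    obtain ⟨h1, h2, h3⟩ := ih (r.cut :: acc)
    simp only [cuts, bind_val, bind_time, op_val, op_time, List.length_cons]
    refine ⟨fun z => ?_, by rw [h2, List.length_cons]; omega, by rw [h3]; omega⟩
    rw [h1, List.mem_cons, List.exists_mem_cons_iff]
    tauto

theorem insertSorted_spec (x : ℝ) (ys : List ℝ) :
    (insertSorted x ys).val.Perm (x :: ys) ∧
    (ys.Pairwise (· ≤ ·) → (insertSorted x ys).val.Pairwise (· ≤ ·)) ∧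
    (insertSorted x ys).time ≤ 2 * ys.length + 1 := by
  induction ys with
  | nil => simp [insertSorted]
  | cons y ys ih =>
    obtain ⟨h1, h2, h3⟩ := ih
    by_cases h : x ≤ y
    · simp only [insertSorted, bind_val, bind_time, op_val, op_time, h, decide_true, if_true]
      refine ⟨List.Perm.refl _, fun hs => ?_, by simp only [List.length_cons]; omega⟩
      refine List.pairwise_cons.mpr ⟨fun z hz => ?_, hs⟩
      rcases List.mem_cons.mp hz with rfl | hz
      · exact h
      · exact h.trans ((List.pairwise_cons.mp hs).1 z hz)
    · simp only [insertSorted, bind_val, bind_time, op_val, op_time, h, decide_false,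
        Bool.false_eq_true, if_false, List.length_cons]
      refine ⟨(h1.cons y).trans (List.Perm.swap x y ys), fun hs => ?_, by omega⟩
      have hs' := List.pairwise_cons.mp hs
      refine List.pairwise_cons.mpr ⟨fun z hz => ?_, h2 hs'.2⟩
      rcases List.mem_cons.mp (h1.mem_iff.mp hz) with rfl | hz
      · exact (not_le.mp h).le
      · exact hs'.1 z hz

theorem sort_spec (xs : List ℝ) :
    (FindPSPEFast.sort xs).val.Perm xs ∧ (FindPSPEFast.sort xs).val.Pairwise (· ≤ ·) ∧
    (FindPSPEFast.sort xs).time ≤ xs.length * (2 * xs.length + 1) := by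
  induction xs with
  | nil => simp [FindPSPEFast.sort]
  | cons x xs ih =>
    obtain ⟨h1, h2, h3⟩ := ih
    obtain ⟨i1, i2, i3⟩ := insertSorted_spec x (FindPSPEFast.sort xs).val
    simp only [FindPSPEFast.sort, bind_val, bind_time, List.length_cons]
    refine ⟨i1.trans (h1.cons x), i2 h2, ?_⟩
    rw [h1.length_eq] at i3
    nlinarith

theorem criticalBudgets_spec (Fl Fr : List (Row S)) {L : ℕ} (hl : Fl.length ≤ L)
    (hr : Fr.length ≤ L) :
    (∀ z, z ∈ (criticalBudgets Fl Fr).val ↔ (∃ r ∈ Fl, z = r.cut) ∨ (∃ r ∈ Fr, z = r.cut) ∨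
      ∃ r ∈ Fl, ∃ r' ∈ Fr, z = (r.cut + r'.cut) / 2) ∧
    (criticalBudgets Fl Fr).val.Pairwise (· ≤ ·) ∧
    (criticalBudgets Fl Fr).val.length ≤ L * L + 2 * L ∧
    (criticalBudgets Fl Fr).time ≤
      L * (3 * L + 3) + (L * L + 2 * L) * (2 * (L * L + 2 * L) + 1) := by
  obtain ⟨a1, a2, a3⟩ := averages_spec Fr Fl []
  obtain ⟨b1, b2, b3⟩ := cuts_spec Fl (averages Fr Fl []).val
  obtain ⟨c1, c2, c3⟩ := cuts_spec Fr (cuts Fl (averages Fr Fl []).val).val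
  obtain ⟨d1, d2, d3⟩ := sort_spec (cuts Fr (cuts Fl (averages Fr Fl []).val).val).val
  have hlen : (cuts Fr (cuts Fl (averages Fr Fl []).val).val).val.length ≤ L * L + 2 * L := by
    rw [c2, b2, a2, List.length_nil]
    have := Nat.mul_le_mul hl hr
    omega
  simp only [criticalBudgets, bind_val, bind_time]
  refine ⟨fun z => ?_, d2, d1.length_eq.trans_le hlen, ?_⟩
  · rw [d1.mem_iff, c1, b1, a1]
    simp only [List.not_mem_nil, false_or]
    constructor
    · rintro ((h | h) | h)
      exacts [.inr (.inr h), .inl h, .inr (.inl h)]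
    · rintro (h | h | h)
      exacts [.inl (.inr h), .inr h, .inl (.inl h)]
  · rw [a3, b3, c3]
    have h1 : Fl.length * (3 * Fr.length + 1) ≤ L * (3 * L + 1) :=
      Nat.mul_le_mul hl (by omega)
    have h2 := d3.trans (Nat.mul_le_mul hlen
      (show 2 * _ + 1 ≤ 2 * (L * L + 2 * L) + 1 by omega))
    have h3 : L * (3 * L + 3) = L * (3 * L + 1) + 2 * L := by ring
    linarith

theorem runAuctions_val (rounds : ℕ) (ε : ℝ) (l r : S) (Fl Fr : List (Row S)) (Bs : List ℝ) :
    (runAuctions G rounds ε l r Fl Fr Bs).val =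
      Bs.map fun B => (ascendingAuction G rounds ε l r Fl Fr B).val := by
  induction Bs with
  | nil => simp [runAuctions]
  | cons B Bs ih => simp only [runAuctions, bind_val, op_val, ih, List.map_cons]

theorem runAuctions_time (rounds : ℕ) (ε : ℝ) (l r : S) (Fl Fr : List (Row S)) (Bs : List ℝ)
    {A : ℕ} (hA : ∀ B ∈ Bs, (ascendingAuction G rounds ε l r Fl Fr B).time ≤ A) :
    (runAuctions G rounds ε l r Fl Fr Bs).time ≤ Bs.length * (A + 1) := by
  induction Bs with
  | nil => simp [runAuctions]
  | cons B Bs ih =>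
    have h1 := hA B (List.mem_cons_self ..)
    have h2 := ih fun B' hB' => hA B' (List.mem_cons_of_mem _ hB')
    simp only [runAuctions, bind_time, op_time, List.length_cons]
    rw [Nat.succ_mul]
    omega

end FindPSPEFast

/-! ### Sorted lists of rows -/

namespace FindPSPEFast

open Timed Auction
open scoped Classical

variable {S : Type} {G : BiddingGame S}

/-- The outcome of the last row with a cutoff up to `B`, in a list of rows with increasing cutoffs;
`t` is the outcome before the first row. -/
noncomputable def valueFrom (B : ℝ) : S → List (Row S) → S
  | t, [] => t
  | t, r :: rs => if r.cut ≤ B then valueFrom B r.out rs else t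

theorem valueFrom_of_lt {B : ℝ} {t : S} {F : List (Row S)} (h : ∀ r ∈ F, B < r.cut) :
    valueFrom B t F = t := by
  cases F with
  | nil => rfl
  | cons r rs => rw [valueFrom, if_neg (not_le.mpr (h r (List.mem_cons_self ..)))]

theorem value_cons (d : S) {r : Row S} {rs : List (Row S)} {B : ℝ} (h : r.cut ≤ B) :
    value d (r :: rs) B = valueFrom B r.out rs := by
  have key : ∀ (r : Row S) (rs : List (Row S)),
      (r :: rs)[(rs.takeWhile fun r => decide (r.cut ≤ B)).length]?.map Row.out =
        some (valueFrom B r.out rs) := by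
    intro r rs
    induction rs generalizing r with
    | nil => simp [valueFrom]
    | cons r' rs ih =>
      by_cases h' : r'.cut ≤ B
      · rw [List.takeWhile_cons_of_pos (by simpa using h'), List.length_cons,
          List.getElem?_cons_succ, ih r', valueFrom, if_pos h']
      · rw [List.takeWhile_cons_of_neg (by simpa using h'), valueFrom, if_neg h']
        simp
  have hidx : (locate (r :: rs) B).val = (rs.takeWhile fun r => decide (r.cut ≤ B)).length := by
    rw [locate_val, List.takeWhile_cons_of_pos (by simpa using h), List.length_cons,
      Nat.add_sub_cancel]
  rw [value, outAt, op_val, hidx, key]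
  rfl

theorem stepValue_cons {r : Row S} {rs : List (Row S)} {B : ℝ} (h : r.cut ≤ B)
    (hs : (r :: rs).Pairwise fun r r' => r.cut < r'.cut) :
    stepValue (r :: rs) B = some (valueFrom B r.out rs) := by
  induction rs generalizing r with
  | nil => simp [stepValue, valueFrom, h]
  | cons r' rs ih =>
    have hs' := List.pairwise_cons.mp hs
    by_cases h' : r'.cut ≤ B
    · have := ih h' hs'.2
      rw [valueFrom, if_pos h', ← this, stepValue, stepValue,
        List.filter_cons_of_pos (by simpa using h), List.filter_cons_of_pos (by simpa using h'),
        List.getLast?_cons_cons]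
    · have hgt : ∀ r'' ∈ r' :: rs, B < r''.cut := by
        intro r'' hr''
        rcases List.mem_cons.mp hr'' with rfl | hr''
        · exact not_le.mp h'
        · exact (not_le.mp h').trans ((List.pairwise_cons.mp hs'.2).1 r'' hr'')
      rw [valueFrom_of_lt hgt, stepValue, List.filter_cons_of_pos (by simpa using h),
        List.filter_eq_nil_iff.mpr fun r'' hr'' => by simpa using hgt r'' hr'']
      rfl

theorem exists_valueFrom_eq {B : ℝ} {p : Row S} {rs : List (Row S)} (h : p.cut ≤ B)
    (hs : (p :: rs).Pairwise fun r r' => r.cut ≤ r'.cut) :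
    ∃ r ∈ p :: rs, r.cut ≤ B ∧ valueFrom B p.out rs = r.out ∧
      ∀ r' ∈ p :: rs, r'.cut ≤ r.cut ∨ B < r'.cut := by
  induction rs generalizing p with
  | nil => exact ⟨p, List.mem_cons_self .., h, rfl, fun r' hr' => by simp_all⟩
  | cons q rs ih =>
    have hs' := List.pairwise_cons.mp hs
    by_cases h' : q.cut ≤ B
    · obtain ⟨r, h1, h2, h3, h4⟩ := ih h' hs'.2
      refine ⟨r, List.mem_cons_of_mem _ h1, h2, by rw [valueFrom, if_pos h', h3], fun r' hr' => ?_⟩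
      rcases List.mem_cons.mp hr' with rfl | hr'
      · exact .inl (hs'.1 r h1)
      · exact h4 r' hr'
    · refine ⟨p, List.mem_cons_self .., h, by rw [valueFrom, if_neg h'], fun r' hr' => ?_⟩
      rcases List.mem_cons.mp hr' with rfl | hr'
      · exact .inl le_rfl
      · right
        rcases List.mem_cons.mp hr' with rfl | hr'
        · exact not_le.mp h'
        · exact (not_le.mp h').trans_le ((List.pairwise_cons.mp hs'.2).1 r' hr')

theorem isChain_of_sorted {Bs : List ℝ} (h : Bs.Pairwise (· ≤ ·)) :
    Bs.IsChain fun x y => x ≤ y ∧ ∀ z ∈ Bs, z ≤ x ∨ y ≤ z := by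
  rw [List.isChain_iff_getElem]
  rw [List.pairwise_iff_getElem] at h
  intro i hi
  refine ⟨h _ _ _ _ (by omega), fun z hz => ?_⟩
  obtain ⟨j, hj, rfl⟩ := List.getElem_of_mem hz
  rcases Nat.lt_trichotomy j i with h1 | rfl | h1
  · exact .inl (h _ _ _ _ h1)
  · exact .inl le_rfl
  · rcases Nat.lt_or_ge (i + 1) j with h2 | h2
    · exact .inr (h _ _ _ _ h2)
    · have : j = i + 1 := by omega
      subst this
      exact .inr le_rfl

/-! ### Filtering the rows -/

theorem differTest_val (t t' : S) :
    (differTest G t t').val = true ↔ G.wScore t ≠ G.wScore t' := by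
  rw [Ne, G.score_eq_iff]
  have hiff : G.SameOutcome t t' ↔
      G.u Player.white t = G.u Player.white t' ∧ G.u Player.black t = G.u Player.black t' :=
    ⟨fun h => ⟨h _, h _⟩, fun h i => by cases i; exacts [h.1, h.2]⟩
  rw [hiff]
  by_cases h1 : G.u Player.white t = G.u Player.white t' <;>
    by_cases h2 : G.u Player.black t = G.u Player.black t' <;>
    simp [differTest, h1, h2]

theorem differTest_time (t t' : S) : (differTest G t t').time ≤ 2 := by
  by_cases h1 : G.u Player.white t = G.u Player.white t' <;>
    by_cases h2 : G.u Player.black t = G.u Player.black t' <;>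
    simp [differTest, h1, h2]

/-- The relation between successive rows on which the filter relies.  The outcome must not change
at the cutoff `1`, since the last row is kept in any case. -/
def Precedes (G : BiddingGame S) (r r' : Row S) : Prop :=
  r.cut ≤ r'.cut ∧ G.wScore r.out ≤ G.wScore r'.out ∧
    (r.cut = r'.cut ∨ r'.cut = 1 → G.wScore r'.out = G.wScore r.out)

/-- The rows `K` are those that the filter keeps of the rows `rows` that come after `p`. -/
structure IsFiltered (G : BiddingGame S) (p : Row S) (rows K : List (Row S)) : Prop where
  sublist : K.Sublist rows
  lt : ∀ x, x ≤ p.cut → x < 1 → ∀ r ∈ K, x < r.cut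
  sorted : K.Pairwise fun r r' => r.cut < r'.cut
  last : (K.map Row.cut).getLast? = some 1
  score_lt : ∀ r ∈ K.dropLast, G.wScore p.out < G.wScore r.out
  score_sorted : K.dropLast.Pairwise fun r r' => G.wScore r.out < G.wScore r'.out
  value : ∀ B t t', G.wScore t = G.wScore p.out → G.wScore t' = G.wScore p.out →
    G.wScore (valueFrom B t K) = G.wScore (valueFrom B t' rows)

theorem filterFrom_time (t : S) (rows : List (Row S)) :
    (filterFrom G t rows).time ≤ 3 * rows.length := by
  induction rows generalizing t with
  | nil => simp [filterFrom]
  | cons row rows ih =>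
    cases rows with
    | nil => simp [filterFrom]
    | cons row' rows =>
      have h1 := differTest_time (G := G) row.out t
      have h2 := ih row.out
      rw [List.length_cons]
      by_cases h : (differTest G row.out t).val = true
      · simp only [filterFrom, bind_time, h, if_true, op_time]
        linarith
      · simp only [filterFrom, bind_time, h, if_false, pure_time, Bool.false_eq_true]
        linarith

theorem isFiltered_filterFrom (p : Row S) (rows : List (Row S)) (hne : rows ≠ [])
    (hchain : (p :: rows).IsChain (Precedes G))
    (hlast : (rows.map Row.cut).getLast? = some 1) :
    IsFiltered G p rows (filterFrom G p.out rows).val := by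
  induction rows generalizing p with
  | nil => exact absurd rfl hne
  | cons row rows ih =>
    obtain ⟨hp, hchain'⟩ := List.isChain_cons_cons.mp hchain
    cases rows with
    | nil =>
      have h1 : row.cut = 1 := by simpa using hlast
      have hval : (filterFrom G p.out [row]).val = [row] := by simp [filterFrom]
      rw [hval]
      refine ⟨List.Sublist.refl _, fun x _ hx r hr => ?_, by simp, hlast, by simp, by simp, ?_⟩
      · rw [List.mem_singleton.mp hr, h1]
        exact hx
      · intro B t t' ht ht'
        simp only [valueFrom]
        split_ifs
        · rfl
        · rw [ht, ht']
    | cons row' rows =>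
      have hlast' : ((row' :: rows).map Row.cut).getLast? = some 1 := by
        rw [List.map_cons, List.map_cons, List.getLast?_cons_cons] at hlast
        exact hlast
      have h := ih row (by simp) hchain' hlast'
      have hKne : (filterFrom G row.out (row' :: rows)).val ≠ [] := by
        intro h0
        have := h.last
        rw [h0] at this
        simp at this
      have hsorted : (row :: row' :: rows).Pairwise fun r r' => r.cut ≤ r'.cut :=
        (hchain'.imp fun _ _ hR => hR.1).pairwise
      by_cases hd : (differTest G row.out p.out).val = true
      · have hval : (filterFrom G p.out (row :: row' :: rows)).val =
            row :: (filterFrom G row.out (row' :: rows)).val := by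
          simp only [filterFrom, bind_val, hd, if_true, op_val]
        rw [hval]
        rw [differTest_val] at hd
        have hlt : G.wScore p.out < G.wScore row.out := lt_of_le_of_ne hp.2.1 (Ne.symm hd)
        have hcut : p.cut < row.cut := lt_of_le_of_ne hp.1 fun h0 => hd (hp.2.2 (.inl h0))
        have hrow1 : row.cut < 1 := by
          refine lt_of_le_of_ne ?_ fun h0 => hd (hp.2.2 (.inr h0))
          obtain ⟨q, hq, hq1⟩ : ∃ q ∈ row' :: rows, q.cut = 1 :=
            List.mem_map.mp (List.mem_of_getLast? hlast')
          rw [← hq1]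
          exact (List.pairwise_cons.mp hsorted).1 q hq
        have hdrop : (row :: (filterFrom G row.out (row' :: rows)).val).dropLast =
            row :: (filterFrom G row.out (row' :: rows)).val.dropLast :=
          List.dropLast_cons_of_ne_nil hKne
        refine ⟨h.sublist.cons_cons _, fun x hx hx1 r hr => ?_, ?_, ?_, ?_, ?_, ?_⟩
        · rcases List.mem_cons.mp hr with rfl | hr
          · exact hx.trans_lt hcut
          · exact h.lt x (hx.trans hp.1) hx1 r hr
        · exact List.pairwise_cons.mpr ⟨h.lt _ le_rfl hrow1, h.sorted⟩
        · obtain ⟨q, qs, hq⟩ := List.exists_cons_of_ne_nil hKne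
          have h1 := h.last
          rw [hq] at h1 ⊢
          rw [List.map_cons, List.map_cons, List.getLast?_cons_cons]
          exact h1
        · rw [hdrop]
          intro r hr
          rcases List.mem_cons.mp hr with rfl | hr
          · exact hlt
          · exact hlt.trans (h.score_lt r hr)
        · rw [hdrop]
          exact List.pairwise_cons.mpr ⟨h.score_lt, h.score_sorted⟩
        · intro B t t' ht ht'
          by_cases hB : row.cut ≤ B
          · rw [valueFrom, if_pos hB, valueFrom, if_pos hB]
            exact h.value B _ _ rfl rfl
          · rw [valueFrom, if_neg hB, valueFrom, if_neg hB, ht, ht']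
      · have hval : (filterFrom G p.out (row :: row' :: rows)).val =
            (filterFrom G row.out (row' :: rows)).val := by
          simp only [filterFrom, bind_val, hd, if_false, pure_val, Bool.false_eq_true]
        rw [hval]
        rw [differTest_val, not_not] at hd
        refine ⟨h.sublist.cons _, fun x hx => h.lt x (hx.trans hp.1), h.sorted, h.last,
          fun r hr => hd ▸ h.score_lt r hr, h.score_sorted, fun B t t' ht ht' => ?_⟩
        rw [← hd] at ht ht'
        by_cases hB : row.cut ≤ B
        · rw [h.value B t row.out ht rfl, valueFrom.eq_2 B t', if_pos hB]
        · have hK : ∀ r ∈ (filterFrom G row.out (row' :: rows)).val, B < r.cut := fun r hr =>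
            (not_le.mp hB).trans_le ((List.pairwise_cons.mp hsorted).1 r (h.sublist.subset hr))
          rw [valueFrom_of_lt hK, valueFrom, if_neg hB, ht, ht']

theorem filterRows_val (p : Row S) (rows : List (Row S)) :
    (filterRows G (p :: rows)).val = p :: (filterFrom G p.out rows).val := by
  simp only [filterRows, bind_val, op_val]

theorem filterRows_time (rows : List (Row S)) :
    (filterRows G rows).time ≤ 3 * rows.length + 1 := by
  cases rows with
  | nil => simp [filterRows]
  | cons p rows =>
    have := filterFrom_time (G := G) p.out rows
    simp only [filterRows, bind_time, op_time, List.length_cons]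
    omega

/-- The outcomes of the rows other than the last one are different outcomes in `T`. -/
theorem IsFiltered.length_le {p : Row S} {rows K : List (Row S)} (h : IsFiltered G p rows K)
    (hp : p.out ∈ G.T) (hT : ∀ r ∈ rows, r.out ∈ G.T) : (p :: K).length ≤ G.T.card + 1 := by
  have h1 : (p :: K.dropLast).Pairwise fun r r' => G.wScore r.out < G.wScore r'.out :=
    List.pairwise_cons.mpr ⟨h.score_lt, h.score_sorted⟩
  have h2 : ((p :: K.dropLast).map Row.out).Nodup := by
    rw [List.Nodup, List.pairwise_map]
    exact h1.imp fun hlt heq => hlt.ne (by rw [heq])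
  have h3 : ((p :: K.dropLast).map Row.out).toFinset ⊆ G.T := by
    intro t ht
    obtain ⟨r, hr, rfl⟩ := List.mem_map.mp (List.mem_toFinset.mp ht)
    rcases List.mem_cons.mp hr with rfl | hr
    · exact hp
    · exact hT r (h.sublist.subset (List.mem_of_mem_dropLast hr))
  have h4 := Finset.card_le_card h3
  rw [List.toFinset_card_of_nodup h2, List.length_map, List.length_cons,
    List.length_dropLast] at h4
  rw [List.length_cons]
  omega

end FindPSPEFast

/-! ### The step function of a state -/

namespace FindPSPEFast

open Timed Auction
open scoped Classical

variable {S : Type} {G : BiddingGame S}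

/-- The table `F` of a state gives a step function with at most `|T|` steps, whose cutoffs are
multiples of `M` increments; it is monotone in the budget, and nothing happens at the right end. -/
structure IsSolved (G : BiddingGame S) (N : ℤ) (ε : ℝ) (M : ℤ) (s : S) (F : List (Row S)) :
    Prop where
  isStepFunction : IsStepFunction F G.T.card
  cut : ∀ r ∈ F, ∃ z : ℤ, M ∣ z ∧ r.cut = z * ε
  mem : ∀ r ∈ F, r.out ∈ G.T
  mono : G.MonoOutcome (stepFun ε s F)
  top : G.wScore (stepFun ε s F N) = G.wScore (stepFun ε s F (N - 1))

theorem IsStepFunction.exists_isTable {F : List (Row S)} {b : ℕ} (h : IsStepFunction F b) {N : ℤ}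
    {ε : ℝ} (hε : 0 < ε) (hN : N * ε = 1) {M : ℤ} (hM : ∀ r ∈ F, ∃ z : ℤ, M ∣ z ∧ r.cut = z * ε) :
    ∃ c n, IsTable N ε F c n ∧ ∀ i ≤ n, M ∣ c i := by
  have hpos : 0 < F.length := by
    have := h.first
    cases F with
    | nil => simp at this
    | cons r rs => simp
  have hc : ∀ i, ∃ z : ℤ, i < F.length → M ∣ z ∧ cutoff F i = z * ε := by
    intro i
    by_cases hi : i < F.length
    · obtain ⟨z, hz⟩ := hM _ (List.getElem_mem hi)
      exact ⟨z, fun _ => ⟨hz.1, by rw [cutoff_eq_getElem hi, hz.2]⟩⟩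
    · exact ⟨0, fun h => absurd h hi⟩
  choose c hc using hc
  have hcast : ∀ {i : ℕ} {z : ℤ}, i < F.length → cutoff F i = z * ε → c i = z := by
    intro i z hi hz
    rw [(hc i hi).2] at hz
    exact_mod_cast mul_right_cancel₀ hε.ne' hz
  refine ⟨c, F.length - 1, ⟨by omega, ?_, ?_, fun i j hij hj => ?_, fun i hi => ?_⟩, fun i hi =>
    (hc i (by omega)).1⟩
  · apply hcast hpos
    have := h.first
    rw [List.head?_map, List.head?_eq_getElem?, List.getElem?_eq_getElem hpos] at this
    rw [cutoff_eq_getElem hpos, Int.cast_zero, zero_mul]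
    simpa using this
  · have hlt : F.length - 1 < F.length := by omega
    apply hcast hlt
    have := h.last
    rw [List.getLast?_map, List.getLast?_eq_getElem?, List.getElem?_eq_getElem hlt] at this
    rw [cutoff_eq_getElem hlt, hN]
    simpa using this
  · have h1 := List.pairwise_iff_getElem.mp (List.pairwise_map.mp h.increasing) i j (by omega)
      (by omega) hij
    rw [← cutoff_eq_getElem, ← cutoff_eq_getElem, (hc i (by omega)).2, (hc j (by omega)).2,
      mul_lt_mul_iff_left₀ hε] at h1
    exact_mod_cast h1
  · exact (hc i (by omega)).2

theorem IsTable.exists_cut_eq {N : ℤ} {ε : ℝ} {F : List (Row S)} {c : ℕ → ℤ} {n : ℕ}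
    (h : IsTable N ε F c n) (z : ℝ) : (∃ r ∈ F, z = r.cut) ↔ ∃ i ≤ n, z = c i * ε := by
  have hlen := h.length
  constructor
  · rintro ⟨r, hr, rfl⟩
    obtain ⟨i, hi, rfl⟩ := List.getElem_of_mem hr
    exact ⟨i, by omega, by rw [← h.cutoff i (by omega), cutoff_eq_getElem hi]⟩
  · rintro ⟨i, hi, rfl⟩
    exact ⟨_, List.getElem_mem (show i < F.length by omega),
      by rw [← h.cutoff i hi, cutoff_eq_getElem]⟩

theorem IsTable.stepFun_mem {N : ℤ} {ε : ℝ} {F : List (Row S)} {c : ℕ → ℤ} {n : ℕ}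
    (h : IsTable N ε F c n) {T : Finset S} (hT : ∀ r ∈ F, r.out ∈ T) (d : S) (z : ℤ) :
    stepFun ε d F z ∈ T := by
  have h1 := h.index_le z
  have hlt : (locate F (z * ε)).val < F.length := by
    rw [h.length]
    exact Nat.lt_succ_of_le h1
  rw [stepFun, value, outAt, op_val, List.getElem?_eq_getElem hlt]
  exact hT _ (List.getElem_mem hlt)

/-- The situation in which the step function of a state is computed: the step functions of its
children `l` and `r` are known, `Bs` is the list of critical budgets, and `f` gives the results of
the auctions. -/
structure IsNode (G : BiddingGame S) (N : ℤ) (ε : ℝ) (M : ℤ) (l r : S) (Fl Fr : List (Row S))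
    (cl cr : ℕ → ℤ) (nl nr : ℕ) (Bs : List ℝ) (f : ℝ → Row S) : Prop where
  pos : 0 < ε
  total : N * ε = 1
  even : Even M
  tableL : IsTable N ε Fl cl nl
  tableR : IsTable N ε Fr cr nr
  dvdL : ∀ i ≤ nl, 2 * M ∣ cl i
  dvdR : ∀ i ≤ nr, 2 * M ∣ cr i
  memL : ∀ r ∈ Fl, r.out ∈ G.T
  memR : ∀ r ∈ Fr, r.out ∈ G.T
  monoL : G.MonoOutcome (stepFun ε l Fl)
  monoR : G.MonoOutcome (stepFun ε r Fr)
  topL : G.wScore (stepFun ε l Fl N) = G.wScore (stepFun ε l Fl (N - 1))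
  topR : G.wScore (stepFun ε r Fr N) = G.wScore (stepFun ε r Fr (N - 1))
  critical : ∀ z, z ∈ Bs ↔ (∃ r ∈ Fl, z = r.cut) ∨ (∃ r ∈ Fr, z = r.cut) ∨
    ∃ r ∈ Fl, ∃ r' ∈ Fr, z = (r.cut + r'.cut) / 2
  sorted : Bs.Pairwise (· ≤ ·)
  auction : ∀ k : ℤ, Even k → 0 ≤ k → k ≤ N → (f (k * ε)).cut = k * ε ∧
    Turn G.wScore G.bScore (stepFun ε l Fl) (stepFun ε r Fr) k (N - k) (f (k * ε)).out

namespace IsNode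

variable {N : ℤ} {ε : ℝ} {M : ℤ} {l r : S} {Fl Fr : List (Row S)} {cl cr : ℕ → ℤ} {nl nr : ℕ}
  {Bs : List ℝ} {f : ℝ → Row S}

theorem cutL (h : IsNode G N ε M l r Fl Fr cl cr nl nr Bs f) {i : ℕ} (hi : i ≤ nl) :
    cl i * ε ∈ Bs :=
  (h.critical _).mpr (.inl ((h.tableL.exists_cut_eq _).mpr ⟨i, hi, rfl⟩))

theorem cutR (h : IsNode G N ε M l r Fl Fr cl cr nl nr Bs f) {i : ℕ} (hi : i ≤ nr) :
    cr i * ε ∈ Bs :=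
  (h.critical _).mpr (.inr (.inl ((h.tableR.exists_cut_eq _).mpr ⟨i, hi, rfl⟩)))

theorem average (h : IsNode G N ε M l r Fl Fr cl cr nl nr Bs f) {i j : ℕ} (hi : i ≤ nl)
    (hj : j ≤ nr) : ∃ k : ℤ, cl i + cr j = 2 * k ∧ M ∣ k ∧ k * ε ∈ Bs := by
  obtain ⟨x, hx⟩ := h.dvdL i hi
  obtain ⟨y, hy⟩ := h.dvdR j hj
  refine ⟨M * x + M * y, by rw [hx, hy]; ring, ⟨x + y, by ring⟩,
    (h.critical _).mpr (.inr (.inr ?_))⟩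
  obtain ⟨p, hp, hpc⟩ := (h.tableL.exists_cut_eq _).mpr ⟨i, hi, rfl⟩
  obtain ⟨q, hq, hqc⟩ := (h.tableR.exists_cut_eq _).mpr ⟨j, hj, rfl⟩
  refine ⟨p, hp, q, hq, ?_⟩
  rw [← hpc, ← hqc, hx, hy]
  push_cast
  ring

theorem exists_units (h : IsNode G N ε M l r Fl Fr cl cr nl nr Bs f) {z : ℝ} (hz : z ∈ Bs) :
    ∃ k : ℤ, z = k * ε ∧ M ∣ k ∧ 0 ≤ k ∧ k ≤ N := by
  rcases (h.critical z).mp hz with hz | hz | ⟨p, hp, q, hq, rfl⟩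
  · obtain ⟨i, hi, rfl⟩ := (h.tableL.exists_cut_eq _).mp hz
    exact ⟨_, rfl, (Dvd.intro_left 2 rfl).trans (h.dvdL i hi), h.tableL.cut_nonneg hi,
      h.tableL.cut_le hi⟩
  · obtain ⟨i, hi, rfl⟩ := (h.tableR.exists_cut_eq _).mp hz
    exact ⟨_, rfl, (Dvd.intro_left 2 rfl).trans (h.dvdR i hi), h.tableR.cut_nonneg hi,
      h.tableR.cut_le hi⟩
  · obtain ⟨i, hi, hpc⟩ := (h.tableL.exists_cut_eq _).mp ⟨p, hp, rfl⟩
    obtain ⟨j, hj, hqc⟩ := (h.tableR.exists_cut_eq _).mp ⟨q, hq, rfl⟩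
    obtain ⟨k, hk, hM, _⟩ := h.average hi hj
    have h1 := h.tableL.cut_nonneg hi
    have h2 := h.tableL.cut_le hi
    have h3 := h.tableR.cut_nonneg hj
    have h4 := h.tableR.cut_le hj
    refine ⟨k, ?_, hM, by omega, by omega⟩
    have hk' : (cl i : ℝ) + cr j = 2 * k := by exact_mod_cast hk
    rw [hpc, hqc, ← add_mul, hk']
    ring

theorem zero_mem (h : IsNode G N ε M l r Fl Fr cl cr nl nr Bs f) : 0 ∈ Bs := by
  have := h.cutL (Nat.zero_le nl)
  rwa [h.tableL.zero, Int.cast_zero, zero_mul] at this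

theorem one_mem (h : IsNode G N ε M l r Fl Fr cl cr nl nr Bs f) : 1 ∈ Bs := by
  have := h.cutL le_rfl
  rwa [h.tableL.top, h.total] at this

theorem even_of_dvd (h : IsNode G N ε M l r Fl Fr cl cr nl nr Bs f) {k : ℤ} (hk : M ∣ k) :
    Even k := by
  rw [even_iff_two_dvd] at *
  exact (even_iff_two_dvd.mp h.even).trans hk

theorem even_size (h : IsNode G N ε M l r Fl Fr cl cr nl nr Bs f) : Even N := by
  rw [← h.tableL.top]
  exact h.even_of_dvd ((Dvd.intro_left 2 rfl).trans (h.dvdL nl le_rfl))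

/-- The result of the auction does not change from one critical budget up to the next one. -/
theorem turn_eq (h : IsNode G N ε M l r Fl Fr cl cr nl nr Bs f) {k k' : ℤ} (hk : 0 ≤ k)
    (hkk : k ≤ k') (hN : k' ≤ N) (hno : ∀ z ∈ Bs, z ≤ k * ε ∨ k' * ε < z) {t t' : S}
    (ht : Turn G.wScore G.bScore (stepFun ε l Fl) (stepFun ε r Fr) k (N - k) t)
    (ht' : Turn G.wScore G.bScore (stepFun ε l Fl) (stepFun ε r Fr) k' (N - k') t') :
    G.wScore t = G.wScore t' := by
  have hno' : ∀ x : ℤ, x * ε ∈ Bs → k < x → k' < x := by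
    intro x hx hlt
    rcases hno _ hx with h1 | h1
    · rw [mul_le_mul_iff_left₀ h.pos, Int.cast_le] at h1
      omega
    · rwa [mul_lt_mul_iff_left₀ h.pos, Int.cast_lt] at h1
  refine Turn.const G.wScore_eq_iff h.monoL h.monoR (h.tableL.isStep h.pos l)
    (h.tableR.isStep h.pos r) ?_ ?_ ⟨?_, ?_, ?_⟩ hk hkk hN ht ht'
  · rintro x ⟨i, hi, rfl⟩
    exact h.even_of_dvd ((Dvd.intro_left 2 rfl).trans (h.dvdL i hi))
  · rintro x ⟨i, hi, rfl⟩
    exact h.even_of_dvd ((Dvd.intro_left 2 rfl).trans (h.dvdR i hi))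
  · rintro x ⟨i, hi, rfl⟩
    exact hno' _ (h.cutL hi)
  · rintro x ⟨i, hi, rfl⟩
    exact hno' _ (h.cutR hi)
  · rintro x y ⟨i, hi, rfl⟩ ⟨j, hj, rfl⟩ hlt
    obtain ⟨m, hm, _, hmem⟩ := h.average hi hj
    have := hno' m hmem (by omega)
    omega

theorem turn_top (h : IsNode G N ε M l r Fl Fr cl cr nl nr Bs f) (hN : 2 ≤ N) {t t' : S}
    (ht : Turn G.wScore G.bScore (stepFun ε l Fl) (stepFun ε r Fr) (N - 1) 1 t)
    (ht' : Turn G.wScore G.bScore (stepFun ε l Fl) (stepFun ε r Fr) N 0 t') :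
    G.wScore t = G.wScore t' := by
  refine Turn.top G.wScore_eq_iff h.monoL h.monoR (h.tableL.isStep h.pos l)
    (h.tableR.isStep h.pos r) ?_ ?_ h.even_size hN h.topL h.topR ht ht'
  · rintro x ⟨i, hi, rfl⟩
    exact h.even_of_dvd ((Dvd.intro_left 2 rfl).trans (h.dvdL i hi))
  · rintro x ⟨i, hi, rfl⟩
    exact h.even_of_dvd ((Dvd.intro_left 2 rfl).trans (h.dvdR i hi))

/-- Successive critical budgets give rows as the filter expects them. -/
theorem precedes (h : IsNode G N ε M l r Fl Fr cl cr nl nr Bs f) (hN : 2 ≤ N) :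
    (Bs.map f).IsChain (Precedes G) := by
  rw [List.isChain_map]
  have h0 := isChain_of_sorted h.sorted
  refine (List.isChain_iff_getElem).mpr fun i hi => ?_
  obtain ⟨hle, hno⟩ := (List.isChain_iff_getElem).mp h0 i hi
  obtain ⟨k, hk, hkM, hk0, hkN⟩ := h.exists_units (List.getElem_mem (show i < Bs.length by omega))
  obtain ⟨k', hk', hkM', hk0', hkN'⟩ := h.exists_units (List.getElem_mem hi)
  rw [hk, hk'] at hle hno ⊢
  obtain ⟨c, ht⟩ := h.auction k (h.even_of_dvd hkM) hk0 hkN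
  obtain ⟨c', ht'⟩ := h.auction k' (h.even_of_dvd hkM') hk0' hkN'
  have hkk : k ≤ k' := by
    rw [mul_le_mul_iff_left₀ h.pos] at hle
    exact_mod_cast hle
  refine ⟨by rw [c, c']; exact hle, (Turn.mono h.monoL h.monoR hk0 hkk hkN' ht ht').1, ?_⟩
  rw [c, c']
  intro hcase
  by_cases heq : k = k'
  · rw [heq]
  · have hN' : k' = N := by
      rcases hcase with h1 | h1
      · exact absurd (by exact_mod_cast mul_right_cancel₀ h.pos.ne' h1) heq
      · rw [← h.total] at h1
        exact_mod_cast mul_right_cancel₀ h.pos.ne' h1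
    subst hN'
    -- the next smaller budget has the outcome of the preceding critical budget
    obtain ⟨t, hmid⟩ := Turn.exists (fun x y => (G.wScore_eq_iff x y).mp)
      (L := stepFun ε l Fl) (R := stepFun ε r Fr) (k := k' - 1) (K := 1) (by omega) (by omega)
    rw [sub_self] at ht'
    rw [← h.turn_top hN hmid ht']
    symm
    have h1 : k' - (k' - 1) = 1 := by ring
    refine h.turn_eq (k' := k' - 1) hk0 (by omega) (by omega) (fun z hz => ?_) ht (by rw [h1]; exact hmid)
    refine (hno z hz).imp_right fun h2 => lt_of_lt_of_le ?_ h2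
    rw [mul_lt_mul_iff_left₀ h.pos]
    push_cast
    linarith

theorem out_mem (h : IsNode G N ε M l r Fl Fr cl cr nl nr Bs f) {z : ℝ} (hz : z ∈ Bs) :
    (f z).out ∈ G.T := by
  obtain ⟨k, rfl, hM, hk0, hkN⟩ := h.exists_units hz
  have hl := h.tableL.stepFun_mem h.memL l
  have hr := h.tableR.stepFun_mem h.memR r
  have key : ∀ t, Turn G.wScore G.bScore (stepFun ε l Fl) (stepFun ε r Fr) k (N - k) t →
      t ∈ G.T := by
    intro t ht
    cases ht with
    | agree mem =>
      rcases mem with rfl | rfl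
      exacts [hl _, hr _]
    | left _ _ c => cases c; exacts [hl _, hr _]
    | right _ _ c => cases c; exacts [hr _, hl _]
  exact key _ (h.auction k (h.even_of_dvd hM) hk0 hkN).2

/-- The rows that the filter keeps describe the step function of the state. -/
theorem solved (h : IsNode G N ε M l r Fl Fr cl cr nl nr Bs f) (hN : 2 ≤ N) (s : S) :
    IsSolved G N ε M s (filterRows G (Bs.map f)).val ∧
    ∀ k, 0 ≤ k → k ≤ N → ∃ t,
      Turn G.wScore G.bScore (stepFun ε l Fl) (stepFun ε r Fr) k (N - k) t ∧
        G.wScore t = G.wScore (stepFun ε s (filterRows G (Bs.map f)).val k) := by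
  have hcut : ∀ z ∈ Bs, (f z).cut = z := by
    intro z hz
    obtain ⟨k, rfl, hM, hk0, hkN⟩ := h.exists_units hz
    exact (h.auction k (h.even_of_dvd hM) hk0 hkN).1
  have hnonneg : ∀ z ∈ Bs, 0 ≤ z := by
    intro z hz
    obtain ⟨k, rfl, _, hk0, _⟩ := h.exists_units hz
    exact mul_nonneg (by exact_mod_cast hk0) h.pos.le
  have hle_one : ∀ z ∈ Bs, z ≤ 1 := by
    intro z hz
    obtain ⟨k, rfl, _, _, hkN⟩ := h.exists_units hz
    rw [← h.total, mul_le_mul_iff_left₀ h.pos]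
    exact_mod_cast hkN
  have hchain := h.precedes hN
  obtain ⟨B₀, Bs', rfl⟩ := List.exists_cons_of_ne_nil (List.ne_nil_of_mem h.zero_mem)
  have hB₀ : B₀ = 0 := by
    refine le_antisymm ?_ (hnonneg _ (List.mem_cons_self ..))
    rcases List.mem_cons.mp h.zero_mem with h0 | h0
    · exact h0.ge
    · exact (List.pairwise_cons.mp h.sorted).1 _ h0
  subst hB₀
  have hone : (1 : ℝ) ∈ Bs' := by
    rcases List.mem_cons.mp h.one_mem with h0 | h0
    · exact absurd h0 one_ne_zero
    · exact h0
  have hne : Bs'.map f ≠ [] := by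
    rw [Ne, List.map_eq_nil_iff]
    exact List.ne_nil_of_mem hone
  have hlast : ((Bs'.map f).map Row.cut).getLast? = some 1 := by
    rw [List.map_map, List.map_congr_left (f := Row.cut ∘ f) (g := id) fun z hz =>
      hcut z (List.mem_cons_of_mem _ hz), List.map_id]
    have hne' := List.ne_nil_of_mem hone
    rw [List.getLast?_eq_some_getLast hne']
    congr 1
    refine le_antisymm (hle_one _ (List.mem_cons_of_mem _ (List.getLast_mem hne'))) ?_
    obtain ⟨i, hi, h1⟩ := List.getElem_of_mem hone
    rw [List.getLast_eq_getElem, ← h1]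
    rcases (show i ≤ Bs'.length - 1 by omega).eq_or_lt with h2 | h2
    · simp [h2]
    · exact List.pairwise_iff_getElem.mp (List.pairwise_cons.mp h.sorted).2 _ _ _ _ h2
  rw [List.map_cons] at hchain
  have hf := isFiltered_filterFrom (f 0) (Bs'.map f) hne hchain hlast
  rw [List.map_cons, filterRows_val]
  set K := (filterFrom G (f 0).out (Bs'.map f)).val with hK
  have hf0 : (f 0).cut = 0 := hcut 0 (List.mem_cons_self ..)
  have hmemK : ∀ q ∈ f 0 :: K, ∃ z ∈ (0 : ℝ) :: Bs', q = f z := by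
    intro q hq
    rcases List.mem_cons.mp hq with rfl | hq
    · exact ⟨0, List.mem_cons_self .., rfl⟩
    · obtain ⟨z, hz, rfl⟩ := List.mem_map.mp (hf.sublist.subset hq)
      exact ⟨z, List.mem_cons_of_mem _ hz, rfl⟩
  have hsorted : (f 0 :: Bs'.map f).Pairwise fun q q' => q.cut ≤ q'.cut :=
    (hchain.imp fun _ _ hR => hR.1).pairwise
  -- the filtered rows have the value of the auction at every budget
  have hturn : ∀ k : ℤ, 0 ≤ k → k ≤ N → ∀ t,
      Turn G.wScore G.bScore (stepFun ε l Fl) (stepFun ε r Fr) k (N - k) t →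
        G.wScore t = G.wScore (stepFun ε s (f 0 :: K) k) := by
    intro k hk0 hkN t ht
    have hB : (f 0).cut ≤ k * ε := by
      rw [hf0]
      exact mul_nonneg (by exact_mod_cast hk0) h.pos.le
    rw [stepFun, value_cons s hB, hf.value _ _ (f 0).out rfl rfl]
    obtain ⟨q, hq, hqB, hval, hmax⟩ := exists_valueFrom_eq hB hsorted
    rw [hval]
    rw [← List.map_cons (f := f)] at hq
    obtain ⟨z, hz, rfl⟩ := List.mem_map.mp hq
    obtain ⟨k₀, hzk, hM, h0, hN0⟩ := h.exists_units hz
    have hcz := hcut z hz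
    rw [hcz, hzk, mul_le_mul_iff_left₀ h.pos, Int.cast_le] at hqB
    have ht₀ := (h.auction k₀ (h.even_of_dvd hM) h0 hN0).2
    rw [← hzk] at ht₀
    symm
    refine h.turn_eq h0 hqB hkN (fun y hy => ?_) ht₀ ht
    have h1 := hmax (f y) (by rw [← List.map_cons (f := f)]; exact List.mem_map_of_mem hy)
    rwa [hcut y hy, hcz, hzk] at h1
  have hex : ∀ k : ℤ, 0 ≤ k → k ≤ N → ∃ t,
      Turn G.wScore G.bScore (stepFun ε l Fl) (stepFun ε r Fr) k (N - k) t ∧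
        G.wScore t = G.wScore (stepFun ε s (f 0 :: K) k) := by
    intro k hk0 hkN
    obtain ⟨t, ht⟩ := Turn.exists (fun x y => (G.wScore_eq_iff x y).mp)
      (L := stepFun ε l Fl) (R := stepFun ε r Fr) (k := k) (K := N - k) hk0 (by omega)
    exact ⟨t, ht, hturn k hk0 hkN t ht⟩
  have hstep : IsStepFunction (f 0 :: K) G.T.card := by
    refine ⟨List.pairwise_map.mpr (List.pairwise_cons.mpr
      ⟨hf.lt _ le_rfl (by rw [hf0]; exact one_pos), hf.sorted⟩), by simp [hf0], ?_, ?_⟩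
    · have h1 := hf.last
      rw [List.map_cons]
      cases hKc : K.map Row.cut with
      | nil => rw [hKc] at h1; simp at h1
      | cons q qs =>
        rw [hKc] at h1
        rw [List.getLast?_cons_cons, h1]
    · refine hf.length_le (h.out_mem (List.mem_cons_self ..)) fun q hq => ?_
      obtain ⟨z, hz, rfl⟩ := List.mem_map.mp hq
      exact h.out_mem (List.mem_cons_of_mem _ hz)
  have hcuts : ∀ q ∈ f 0 :: K, ∃ z : ℤ, M ∣ z ∧ q.cut = z * ε := by
    intro q hq
    obtain ⟨z, hz, rfl⟩ := hmemK q hq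
    obtain ⟨k, hk, hM, _⟩ := h.exists_units hz
    exact ⟨k, hM, (hcut z hz).trans hk⟩
  obtain ⟨c, n, htab, _⟩ := hstep.exists_isTable h.pos h.total hcuts
  have hmonoW : ∀ x y : ℤ, x ≤ y →
      G.wScore (stepFun ε s (f 0 :: K) x) ≤ G.wScore (stepFun ε s (f 0 :: K) y) ∧
      G.bScore (stepFun ε s (f 0 :: K) y) ≤ G.bScore (stepFun ε s (f 0 :: K) x) := by
    -- outside the range of budgets the step function is constant
    have hclamp : ∀ x : ℤ, stepFun ε s (f 0 :: K) x =
        stepFun ε s (f 0 :: K) (max 0 (min x N)) := by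
      intro x
      refine stepFun_eq_of_index_eq ?_
      rcases le_total x 0 with hx | hx
      · rw [max_eq_left ((min_le_left x N).trans hx), htab.index_of_nonpos h.pos hx,
          htab.index_of_nonpos h.pos le_rfl]
      · rcases le_total x N with hxN | hxN
        · rw [min_eq_left hxN, max_eq_right hx]
        · rw [min_eq_right hxN, max_eq_right (by omega)]
          have h1 : ∀ y, N ≤ y → index ε (f 0 :: K) y = n := fun y hy =>
            htab.index_eq h.pos le_rfl (.inr (by rw [htab.top]; exact hy)) fun h2 => by omega
          rw [h1 x hxN, h1 N le_rfl]
    intro x y hxy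
    rw [hclamp x, hclamp y]
    obtain ⟨t, ht, hts⟩ := hex (max 0 (min x N)) (by omega) (by omega)
    obtain ⟨t', ht', hts'⟩ := hex (max 0 (min y N)) (by omega) (by omega)
    have hm := Turn.mono h.monoL h.monoR (by omega) (by omega) (by omega) ht ht'
    rw [← hts, ← hts', ← (G.wScore_eq_iff _ _).mp hts, ← (G.wScore_eq_iff _ _).mp hts']
    exact hm
  refine ⟨⟨hstep, hcuts, ?_, ⟨fun x y hxy => (hmonoW x y hxy).1, fun x y hxy =>
    (hmonoW x y hxy).2⟩, ?_⟩, hex⟩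
  · intro q hq
    obtain ⟨z, hz, rfl⟩ := hmemK q hq
    exact h.out_mem hz
  · obtain ⟨t, ht, hts⟩ := hex N (by omega) le_rfl
    obtain ⟨t', ht', hts'⟩ := hex (N - 1) (by omega) (by omega)
    rw [← hts, ← hts']
    rw [sub_self] at ht
    rw [show N - (N - 1) = 1 by ring] at ht'
    exact (h.turn_top hN ht' ht).symm

end IsNode

/-- A bound for the time that the main loop spends on one state, when the tables of its children
have at most `L` rows. -/
def nodeTime (L : ℕ) : ℕ :=
  L * (3 * L + 3) + (L * L + 2 * L) * (2 * (L * L + 2 * L) + 1) +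
    (L * L + 2 * L) * ((2 * L + 1) * (8 * L + 40) + 1) + 3 * (L * L + 2 * L) + 1

/-- The computation of the step function of a state from those of its children. -/
theorem node_spec {N : ℤ} {ε : ℝ} {M : ℤ} {l r : S} {Fl Fr : List (Row S)} (s : S) (hε : 0 < ε)
    (hN : N * ε = 1) (hN2 : 2 ≤ N) (hM : Even M) {rounds : ℕ} (hr : N + 1 ≤ rounds)
    (hl : IsSolved G N ε (2 * M) l Fl) (hr' : IsSolved G N ε (2 * M) r Fr) :
    let all := runAuctions G rounds ε l r Fl Fr (criticalBudgets Fl Fr).val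
    (IsSolved G N ε M s (filterRows G all.val).val ∧
      ∀ k, 0 ≤ k → k ≤ N → ∃ t,
        Turn G.wScore G.bScore (stepFun ε l Fl) (stepFun ε r Fr) k (N - k) t ∧
          G.wScore t = G.wScore (stepFun ε s (filterRows G all.val).val k)) ∧
    (criticalBudgets Fl Fr).time + all.time + (filterRows G all.val).time ≤
      nodeTime (G.T.card + 1) := by
  intro all
  obtain ⟨cl, nl, tl, dl⟩ := hl.isStepFunction.exists_isTable hε hN hl.cut
  obtain ⟨cr, nr, tr, dr⟩ := hr'.isStepFunction.exists_isTable hε hN hr'.cut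
  obtain ⟨b1, b2, b3, b4⟩ := criticalBudgets_spec Fl Fr hl.isStepFunction.length_le
    hr'.isStepFunction.length_le
  have heven : ∀ x, 2 * M ∣ x → Even x := fun x hx =>
    even_iff_two_dvd.mpr ((Dvd.intro M rfl).trans hx)
  have ha := fun k hk h0 hkN => ascendingAuction_spec hε hN tl tr (fun i hi => heven _ (dl i hi))
    (fun i hi => heven _ (dr i hi)) hl.mono hr'.mono hl.top hr'.top (k := k) hk h0 hkN hr
  have hnode : IsNode G N ε M l r Fl Fr cl cr nl nr (criticalBudgets Fl Fr).val
      fun B => (ascendingAuction G rounds ε l r Fl Fr B).val :=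
    ⟨hε, hN, hM, tl, tr, dl, dr, hl.mem, hr'.mem, hl.mono, hr'.mono, hl.top, hr'.top, b1, b2,
      fun k hk h0 hkN => ⟨(ha k hk h0 hkN).1, (ha k hk h0 hkN).2.1⟩⟩
  have hall : all.val = (criticalBudgets Fl Fr).val.map
      fun B => (ascendingAuction G rounds ε l r Fl Fr B).val := runAuctions_val ..
  refine ⟨?_, ?_⟩
  · rw [hall]
    exact hnode.solved hN2 s
  · have hA : ∀ B ∈ (criticalBudgets Fl Fr).val, (ascendingAuction G rounds ε l r Fl Fr B).time ≤
        (2 * (G.T.card + 1) + 1) * (8 * (G.T.card + 1) + 40) := by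
      intro B hB
      obtain ⟨k, rfl, hkM, h0, hkN⟩ := hnode.exists_units hB
      refine (ha k (hnode.even_of_dvd hkM) h0 hkN).2.2.trans (Nat.mul_le_mul ?_ ?_)
      · have h1 := hl.isStepFunction.length_le
        have h2 := hr'.isStepFunction.length_le
        omega
      · have h1 := hl.isStepFunction.length_le
        have h2 := hr'.isStepFunction.length_le
        unfold roundTime
        omega
    have h1 := (runAuctions_time rounds ε l r Fl Fr _ hA).trans (Nat.mul_le_mul_right _ b3)
    have h2 := filterRows_time (G := G) all.val
    have h3 : all.val.length = (criticalBudgets Fl Fr).val.length := by rw [hall, List.length_map]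
    unfold nodeTime
    linarith

end FindPSPEFast

/-! ### The traversal of the states -/

namespace BiddingGame

variable {S : Type} {G : BiddingGame S}

theorem not_reflTransGen_of_mem {s c : S} (hc : c ∈ G.g s) :
    ¬ Relation.ReflTransGen (fun a b => b ∈ G.g a) c s := fun h =>
  G.acyclic s (Relation.TransGen.head' hc h)

theorem height_le_of_reflTransGen [Finite S] {s t : S}
    (h : Relation.ReflTransGen (fun a b => b ∈ G.g a) s t) : G.height t ≤ G.height s := by
  induction h with
  | refl => exact le_rfl
  | tail _ hc ih => exact (height_lt hc).le.trans ih

theorem height_lt_card [Fintype S] (s : S) : G.height s < Fintype.card S := by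
  classical
  -- a longest path from `s` visits `height s + 1` descendants of `s`
  suffices h : G.height s < (Finset.univ.filter fun t =>
      Relation.ReflTransGen (fun a b => b ∈ G.g a) s t).card from
    h.trans_le (Finset.card_le_univ _)
  induction s using G.wellFounded.induction with
  | _ s ih =>
    rw [G.height_eq s,
      Finset.sup_lt_iff (Finset.card_pos.mpr ⟨s, by simp [Relation.ReflTransGen.refl]⟩)]
    intro c hc
    refine lt_of_le_of_lt (ih c hc) (Finset.card_lt_card ?_)
    rw [Finset.ssubset_iff]
    refine ⟨s, by simpa using not_reflTransGen_of_mem hc, ?_⟩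
    intro t ht
    rw [Finset.mem_insert] at ht
    rw [Finset.mem_filter]
    refine ⟨Finset.mem_univ _, ?_⟩
    rcases ht with rfl | ht
    · exact Relation.ReflTransGen.refl
    · exact Relation.ReflTransGen.head hc (Finset.mem_filter.mp ht).2

end BiddingGame

namespace FindPSPEFast

open Timed Auction BiddingGame
open scoped Classical

variable {S : Type} {G : BiddingGame S} {D : Children G}

/-- In the list, every state occurs only once, and after its children. -/
inductive PostOrdered (D : Children G) : List S → Prop
  | nil : PostOrdered D []
  | snoc {ss : List S} {s : S} (init : PostOrdered D ss) (new : s ∉ ss)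
      (children : s ∉ G.T → D.left s ∈ ss ∧ D.right s ∈ ss) : PostOrdered D (ss ++ [s])

theorem PostOrdered.nodup {ss : List S} (h : PostOrdered D ss) : ss.Nodup := by
  induction h with
  | nil => exact List.nodup_nil
  | snoc _ new _ ih => exact List.nodup_append_comm.mp (List.nodup_cons.mpr ⟨new, ih⟩)

theorem PostOrdered.children_mem {ss : List S} (h : PostOrdered D ss) :
    ∀ s ∈ ss, s ∉ G.T → D.left s ∈ ss ∧ D.right s ∈ ss := by
  induction h with
  | nil => simp
  | @snoc ss s _ _ children ih =>
    intro x hx hxT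
    have h1 : D.left x ∈ ss ∧ D.right x ∈ ss := by
      rcases List.mem_append.mp hx with hx | hx
      · exact ih x hx hxT
      · rw [List.mem_singleton.mp hx] at hxT ⊢
        exact children hxT
    exact ⟨List.mem_append_left _ h1.1, List.mem_append_left _ h1.2⟩

theorem Children.left_mem (D : Children G) {s : S} (hs : s ∉ G.T) : D.left s ∈ G.g s :=
  (D.mem_iff s hs _).mpr (.inl rfl)

theorem Children.right_mem (D : Children G) {s : S} (hs : s ∉ G.T) : D.right s ∈ G.g s :=
  (D.mem_iff s hs _).mpr (.inr rfl)

/-- The state of the depth-first search while the states in `active` are being expanded. -/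
structure IsSearch (D : Children G) (active : S → Prop) (σ : (S → Bool) × List S) : Prop where
  visited : ∀ x, σ.1 x = true ↔ x ∈ σ.2 ∨ active x
  postOrdered : PostOrdered D σ.2

/-- The active states have `s` as a proper descendant, so there are no cycles through them, and a
marked descendant of `s` is always a finished one. -/
theorem visit_spec [Finite S] (depth : ℕ) (s : S) (hd : G.height s < depth) (active : S → Prop)
    (hact : ∀ x, active x → Relation.TransGen (fun a b => b ∈ G.g a) x s)
    (σ : (S → Bool) × List S) (hσ : IsSearch D active σ) :
    ∃ new, (visit G D depth s σ).val.2 = σ.2 ++ new ∧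
      IsSearch D active (visit G D depth s σ).val ∧ s ∈ (visit G D depth s σ).val.2 ∧
      (∀ x ∈ new, Relation.ReflTransGen (fun a b => b ∈ G.g a) s x) ∧
      (visit G D depth s σ).time ≤ 1 + 8 * new.length := by
  induction depth generalizing s active σ with
  | zero => exact absurd hd (Nat.not_lt_zero _)
  | succ depth ih =>
    have hs : ¬ active s := fun h => G.acyclic s (hact s h)
    by_cases hseen : σ.1 s = true
    · have hval : (visit G D (depth + 1) s σ).val = σ := by
        simp only [visit, bind_val, op_val, hseen, if_true, pure_val]
      have htime : (visit G D (depth + 1) s σ).time = 1 := by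
        simp only [visit, bind_time, op_val, op_time, hseen, if_true, pure_time]
      rw [hval, htime]
      exact ⟨[], by simp, hσ, ((hσ.visited s).mp hseen).resolve_right hs, by simp, by simp⟩
    · have hsσ : s ∉ σ.2 := fun h => hseen ((hσ.visited s).mpr (.inl h))
      set visited := Function.update σ.1 s true with hv
      have hvis : ∀ x, visited x = true ↔ x ∈ σ.2 ∨ active x ∨ x = s := by
        intro x
        by_cases hx : x = s
        · simp [hv, hx]
        · rw [hv, Function.update_of_ne hx, hσ.visited]
          simp [hx]
      by_cases hT : s ∈ G.T
      · have hval : (visit G D (depth + 1) s σ).val = (visited, σ.2 ++ [s]) := by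
          simp only [visit, bind_val, op_val, hseen, hT, decide_true, if_true, pure_val, if_false,
            Bool.false_eq_true, hv]
        have htime : (visit G D (depth + 1) s σ).time = 4 := by
          simp only [visit, bind_time, op_val, op_time, hseen, hT, decide_true, if_true, pure_time,
            if_false, Bool.false_eq_true]
        rw [hval, htime]
        refine ⟨[s], rfl, ⟨fun x => ?_, .snoc hσ.postOrdered hsσ fun h => absurd hT h⟩, by simp,
          fun x hx => ?_, by simp⟩
        · rw [hvis, List.mem_append, List.mem_singleton]
          constructor
          · rintro (h | h | h)
            exacts [.inl (.inl h), .inr h, .inl (.inr h)]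
          · rintro ((h | h) | h)
            exacts [.inl h, .inr (.inr h), .inr (.inl h)]
        · rw [List.mem_singleton.mp hx]
      · have hl := D.left_mem hT
        have hr := D.right_mem hT
        have hact' : ∀ c ∈ G.g s, ∀ x, (active x ∨ x = s) →
            Relation.TransGen (fun a b => b ∈ G.g a) x c := by
          rintro c hc x (hx | rfl)
          · exact (hact x hx).tail hc
          · exact .single hc
        obtain ⟨new₁, a1, a2, a3, a4, a5⟩ := ih (D.left s) (by have := height_lt hl; omega)
          (fun x => active x ∨ x = s) (hact' _ hl) (visited, σ.2) ⟨hvis, hσ.postOrdered⟩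
        set τ := visit G D depth (D.left s) (visited, σ.2) with hτ
        obtain ⟨new₂, b1, b2, b3, b4, b5⟩ := ih (D.right s) (by have := height_lt hr; omega)
          (fun x => active x ∨ x = s) (hact' _ hr) τ.val a2
        set ρ := visit G D depth (D.right s) τ.val with hρ
        have hval : (visit G D (depth + 1) s σ).val = (ρ.val.1, ρ.val.2 ++ [s]) := by
          simp only [visit, bind_val, op_val, hseen, hT, decide_false, if_false, pure_val,
            Bool.false_eq_true, hρ, hτ, hv]
        have htime : (visit G D (depth + 1) s σ).time = 6 + τ.time + ρ.time := by
          simp only [visit, bind_val, bind_time, op_val, op_time, hseen, hT, decide_false, if_false,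
            pure_time, Bool.false_eq_true, hρ, hτ, hv]
          ring
        rw [hval, htime]
        have hnew : ∀ x ∈ new₁ ++ new₂, ∃ c ∈ G.g s,
            Relation.ReflTransGen (fun a b => b ∈ G.g a) c x := by
          intro x hx
          rcases List.mem_append.mp hx with hx | hx
          · exact ⟨_, hl, a4 x hx⟩
          · exact ⟨_, hr, b4 x hx⟩
        have hord : ρ.val.2 = σ.2 ++ (new₁ ++ new₂) := by rw [b1, a1, List.append_assoc]
        have hsρ : s ∉ ρ.val.2 := by
          rw [hord, List.mem_append]
          rintro (h | h)
          · exact hsσ h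
          · obtain ⟨c, hc, h⟩ := hnew s h
            exact not_reflTransGen_of_mem hc h
        refine ⟨new₁ ++ new₂ ++ [s], by rw [hord, List.append_assoc],
          ⟨fun x => ?_, .snoc b2.postOrdered hsρ fun _ => ⟨?_, b3⟩⟩, by simp, fun x hx => ?_, ?_⟩
        · rw [b2.visited, List.mem_append, List.mem_singleton]
          constructor
          · rintro (h | h | h)
            exacts [.inl (.inl h), .inr h, .inl (.inr h)]
          · rintro ((h | h) | h)
            exacts [.inl h, .inr (.inr h), .inr (.inl h)]
        · rw [b1]
          exact List.mem_append_left _ a3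
        · rcases List.mem_append.mp hx with hx | hx
          · obtain ⟨c, hc, h⟩ := hnew x hx
            exact .head hc h
          · rw [List.mem_singleton.mp hx]
        · simp only [List.length_append, List.length_singleton]
          omega

theorem heights_append (ss ss' : List S) (H : S → ℕ) :
    (heights G D (ss ++ ss') H).val = (heights G D ss' (heights G D ss H).val).val ∧
    (heights G D (ss ++ ss') H).time =
      (heights G D ss H).time + (heights G D ss' (heights G D ss H).val).time := by
  induction ss generalizing H with
  | nil => simp [heights]
  | cons s ss ih =>
    simp only [List.cons_append, heights, bind_val, bind_time, ih, true_and]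
    ring

theorem height_eq_max [Finite S] {s : S} (hs : s ∉ G.T) :
    G.height s = max (G.height (D.left s)) (G.height (D.right s)) + 1 := by
  apply le_antisymm
  · rw [G.height_eq s, Finset.sup_le_iff]
    intro c hc
    rcases (D.mem_iff s hs c).mp hc with rfl | rfl <;> omega
  · have := height_lt (D.left_mem hs)
    have := height_lt (D.right_mem hs)
    omega

theorem height_of_mem_T [Finite S] {s : S} (hs : s ∈ G.T) : G.height s = 0 := by
  rw [G.height_eq s, (G.mem_T_iff s).mp hs, Finset.sup_empty, Nat.bot_eq_zero]

theorem heights_spec [Finite S] {ss : List S} (h : PostOrdered D ss) (H : S → ℕ) :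
    (∀ s ∈ ss, (heights G D ss H).val s = G.height s) ∧
      (heights G D ss H).time ≤ 8 * ss.length := by
  induction h with
  | nil => simp [heights]
  | @snoc ss s _ new children ih =>
    obtain ⟨h1, h2⟩ := ih
    rw [(heights_append ss [s] H).1, (heights_append ss [s] H).2]
    set H' := (heights G D ss H).val with hH'
    have hstep : (heights G D [s] H').val = Function.update H' s (G.height s) ∧
        (heights G D [s] H').time ≤ 8 := by
      by_cases hT : s ∈ G.T
      · simp only [heights, bind_val, bind_time, op_val, op_time, pure_val, pure_time, hT,
          decide_true, if_true, height_of_mem_T hT]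
        exact ⟨trivial, by norm_num⟩
      · obtain ⟨hl, hr⟩ := children hT
        simp only [heights, bind_val, bind_time, op_val, op_time, pure_val, pure_time, hT,
          decide_false, if_false, Bool.false_eq_true, h1 _ hl, h1 _ hr, height_eq_max (D := D) hT]
        exact ⟨trivial, by norm_num⟩
    rw [hstep.1]
    refine ⟨fun x hx => ?_, ?_⟩
    · by_cases hxs : x = s
      · rw [hxs, Function.update_self]
      · rw [Function.update_of_ne hxs]
        exact h1 x ((List.mem_append.mp hx).resolve_right fun h0 => hxs (List.mem_singleton.mp h0))
    · have := hstep.2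
      simp only [List.length_append, List.length_singleton]
      omega

theorem halve_spec (k : ℕ) (x : ℝ) : (halve k x).val = x * (1 / 2) ^ k ∧ (halve k x).time = k := by
  induction k generalizing x with
  | zero => simp [halve]
  | succ k ih =>
    simp only [halve, bind_val, bind_time, op_val, op_time, ih]
    exact ⟨by rw [pow_succ]; ring, by omega⟩

/-! ### The main loop -/

theorem process_append (rounds : ℕ) (ε : ℝ) (ss ss' : List S) (F : S → List (Row S)) :
    (process G D rounds ε (ss ++ ss') F).val =
      (process G D rounds ε ss' (process G D rounds ε ss F).val).val ∧
    (process G D rounds ε (ss ++ ss') F).time = (process G D rounds ε ss F).time +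
      (process G D rounds ε ss' (process G D rounds ε ss F).val).time := by
  induction ss generalizing F with
  | nil => simp [process]
  | cons s ss ih =>
    simp only [List.cons_append, process, bind_val, bind_time, ih, true_and]
    ring

theorem IsSolved.of_dvd {N : ℤ} {ε : ℝ} {M M' : ℤ} {s : S} {F : List (Row S)}
    (h : IsSolved G N ε M s F) (hM : M' ∣ M) : IsSolved G N ε M' s F :=
  ⟨h.isStepFunction, fun r hr => (h.cut r hr).imp fun _ hz => ⟨hM.trans hz.1, hz.2⟩, h.mem, h.mono,
    h.top⟩

/-- The tables `F` are correct at the state `s`, given the tables of its children. -/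
structure IsEntry [Finite S] (D : Children G) (F : S → List (Row S)) (s : S) : Prop where
  solved : IsSolved G G.gridSize G.increment (2 ^ (G.height G.s₀ + 2 - G.height s)) s (F s)
  terminal : s ∈ G.T → ∀ z, stepFun G.increment s (F s) z = s
  turn : s ∉ G.T → ∀ k, 0 ≤ k → k ≤ G.gridSize → ∃ t,
    Turn G.wScore G.bScore (stepFun G.increment (D.left s) (F (D.left s)))
      (stepFun G.increment (D.right s) (F (D.right s))) k (G.gridSize - k) t ∧
      G.wScore t = G.wScore (stepFun G.increment s (F s) k)

theorem two_le_gridSize [Finite S] : 2 ≤ G.gridSize := by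
  obtain ⟨x, hx⟩ := G.gridSize_even
  have := G.gridSize_pos
  omega

theorem terminal_solved [Finite S] {s : S} (hs : s ∈ G.T) :
    IsSolved G G.gridSize G.increment (2 ^ (G.height G.s₀ + 2)) s
      [⟨0, s, (s, 0), (s, 0)⟩, ⟨1, s, (s, 1), (s, 1)⟩] ∧
    ∀ z, stepFun G.increment s [⟨0, s, (s, 0), (s, 0)⟩, ⟨1, s, (s, 1), (s, 1)⟩] z = s := by
  have hval : ∀ z, stepFun G.increment s
      [⟨0, s, (s, 0), (s, 0)⟩, ⟨1, s, (s, 1), (s, 1)⟩] z = s := by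
    intro z
    rw [stepFun, value, outAt, op_val]
    rcases (locate _ _).val with _ | _ | n <;> simp
  refine ⟨⟨⟨by simp, by simp, by simp, ?_⟩, ?_, ?_, ?_, ?_⟩, hval⟩
  · have := Finset.card_pos.mpr ⟨s, hs⟩
    simp only [List.length_cons, List.length_nil]
    omega
  · intro r hr
    simp only [List.mem_cons, List.not_mem_nil, or_false] at hr
    rcases hr with rfl | rfl
    · exact ⟨0, dvd_zero _, by simp⟩
    · exact ⟨G.gridSize, dvd_rfl, G.gridSize_mul_increment.symm⟩
  · intro r hr
    simp only [List.mem_cons, List.not_mem_nil, or_false] at hr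
    rcases hr with rfl | rfl <;> exact hs
  · exact ⟨fun x y _ => by rw [hval, hval], fun x y _ => by rw [hval, hval]⟩
  · rw [hval, hval]

/-- The tables that the main loop computes are correct.
The heights of the children are smaller, so their cutoffs are multiples of a larger power of
two; this leaves room for halving in the critical budgets. -/
theorem process_spec [Finite S] {ss : List S} (h : PostOrdered D ss)
    (hreach : ∀ s ∈ ss, G.Reachable s) {rounds : ℕ} (hr : G.gridSize + 1 ≤ rounds)
    (F : S → List (Row S)) :
    (∀ s ∈ ss, IsEntry D (process G D rounds G.increment ss F).val s) ∧
      (process G D rounds G.increment ss F).time ≤ ss.length * (nodeTime (G.T.card + 1) + 6) := by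
  induction h with
  | nil => simp [process]
  | @snoc ss s hss new children ih =>
    obtain ⟨h1, h2⟩ := ih fun x hx => hreach x (List.mem_append_left _ hx)
    rw [(process_append rounds G.increment ss [s] F).1,
      (process_append rounds G.increment ss [s] F).2]
    set F' := (process G D rounds G.increment ss F).val with hF'
    have hstep : ∃ rows, (process G D rounds G.increment [s] F').val = Function.update F' s rows ∧
        (process G D rounds G.increment [s] F').time ≤ nodeTime (G.T.card + 1) + 6 ∧
        IsSolved G G.gridSize G.increment (2 ^ (G.height G.s₀ + 2 - G.height s)) s rows ∧
        (s ∈ G.T → ∀ z, stepFun G.increment s rows z = s) ∧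
        (s ∉ G.T → ∀ k, 0 ≤ k → k ≤ G.gridSize → ∃ t,
          Turn G.wScore G.bScore (stepFun G.increment (D.left s) (F' (D.left s)))
            (stepFun G.increment (D.right s) (F' (D.right s))) k (G.gridSize - k) t ∧
            G.wScore t = G.wScore (stepFun G.increment s rows k)) := by
      by_cases hT : s ∈ G.T
      · refine ⟨[⟨0, s, (s, 0), (s, 0)⟩, ⟨1, s, (s, 1), (s, 1)⟩], ?_, ?_, ?_,
          fun _ => (terminal_solved hT).2, fun h => absurd hT h⟩
        · simp only [process, bind_val, op_val, hT, decide_true, if_true, pure_val]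
        · simp only [process, bind_time, op_val, op_time, hT, decide_true, if_true, pure_time]
          omega
        · rw [height_of_mem_T hT]
          exact (terminal_solved hT).1
      · obtain ⟨hl, hr'⟩ := children hT
        have hs := height_le_of_reflTransGen (hreach s (by simp))
        have hdvd : ∀ c ∈ G.g s, (2 : ℤ) * 2 ^ (G.height G.s₀ + 2 - G.height s) ∣
            2 ^ (G.height G.s₀ + 2 - G.height c) := by
          intro c hc
          have := height_lt hc
          rw [← pow_succ']
          exact pow_dvd_pow _ (by omega)
        have hn := node_spec s G.increment_pos G.gridSize_mul_increment two_le_gridSize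
          ((Int.even_pow.mpr ⟨even_two, by omega⟩ :
            Even ((2 : ℤ) ^ (G.height G.s₀ + 2 - G.height s)))) hr
          ((h1 _ hl).solved.of_dvd (hdvd _ (D.left_mem hT)))
          ((h1 _ hr').solved.of_dvd (hdvd _ (D.right_mem hT)))
        refine ⟨_, ?_, ?_, hn.1.1, fun h => absurd h hT, fun _ => hn.1.2⟩
        · simp only [process, bind_val, op_val, hT, decide_false, if_false, Bool.false_eq_true,
            pure_val]
        · have h3 := hn.2
          simp only [process, bind_val, bind_time, op_val, op_time, hT, decide_false, if_false,
            Bool.false_eq_true, pure_time]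
          linarith
    obtain ⟨rows, e1, e2, e3, e4, e5⟩ := hstep
    rw [e1]
    have hne : ∀ x ∈ ss, Function.update F' s rows x = F' x := fun x hx =>
      Function.update_of_ne (by rintro rfl; exact new hx) _ _
    refine ⟨fun x hx => ?_, ?_⟩
    · rcases List.mem_append.mp hx with hx | hx
      · have hx' := h1 x hx
        refine ⟨by rw [hne x hx]; exact hx'.solved, fun hT => by rw [hne x hx]; exact hx'.terminal hT,
          fun hT => ?_⟩
        obtain ⟨hl, hr'⟩ := hss.children_mem x hx hT
        rw [hne x hx, hne _ hl, hne _ hr']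
        exact hx'.turn hT
      · rw [List.mem_singleton.mp hx]
        refine ⟨by rw [Function.update_self]; exact e3, fun hT => by
          rw [Function.update_self]; exact e4 hT, fun hT => ?_⟩
        obtain ⟨hl, hr'⟩ := children hT
        rw [Function.update_self, hne _ hl, hne _ hr']
        exact e5 hT
    · rw [List.length_append, List.length_singleton, Nat.add_mul, one_mul]
      omega

end FindPSPEFast

/-! ### The algorithm computes the Lower PSPE -/

namespace FindPSPEFast

open Timed Auction BiddingGame
open scoped Classical

variable {S : Type} {G : BiddingGame S}

theorem valueFrom_congr {B B' : ℝ} {t : S} {F : List (Row S)}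
    (h : ∀ r ∈ F, r.cut ≤ B ↔ r.cut ≤ B') : valueFrom B t F = valueFrom B' t F := by
  induction F generalizing t with
  | nil => rfl
  | cons r rs ih =>
    rw [valueFrom, valueFrom, ih fun r' hr' => h r' (List.mem_cons_of_mem _ hr')]
    simp only [h r (List.mem_cons_self ..)]

theorem IsSolved.stepValue_eq [Finite S] {M : ℤ} {s : S} {F : List (Row S)}
    (h : IsSolved G G.gridSize G.increment M s F) {B : ℝ} (hB : 0 ≤ B) :
    stepValue F B = some (stepFun G.increment s F (G.units B)) := by
  have hfirst := h.isStepFunction.first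
  cases F with
  | nil => simp at hfirst
  | cons r rs =>
    have hr : r.cut = 0 := by simpa using hfirst
    have hu := mul_nonneg (Int.cast_nonneg (R := ℝ) (units_nonneg (G := G) hB)) G.increment_pos.le
    rw [stepValue_cons (hr ▸ hB) (List.pairwise_map.mp h.isStepFunction.increasing), stepFun,
      value_cons s (hr ▸ hu)]
    congr 1
    refine valueFrom_congr fun q hq => ?_
    obtain ⟨z, _, hz⟩ := h.cut q (List.mem_cons_of_mem _ hq)
    rw [hz, ← le_units, mul_le_mul_iff_left₀ G.increment_pos, Int.cast_le]

theorem isValuation [Finite S] (D : Children G) {F : S → List (Row S)}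
    (h : ∀ s, G.Reachable s → IsEntry D F s) :
    G.IsValuation fun s => stepFun G.increment s (F s) where
  terminal t ht hT z := (h t ht).terminal hT z
  mono s hs := (h s hs).solved.mono
  step s hs hT c hc := by
    have hc' := (h c (hs.child hc)).solved
    obtain ⟨f, n, htab, hdvd⟩ :=
      hc'.isStepFunction.exists_isTable G.increment_pos G.gridSize_mul_increment hc'.cut
    refine ⟨_, htab.isStep G.increment_pos c, ?_⟩
    rintro x ⟨i, hi, rfl⟩
    have h1 := height_le_of_reflTransGen (hs.child hc)
    rw [even_iff_two_dvd]
    exact (dvd_pow_self 2 (by omega)).trans (hdvd i hi)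
  top s hs := (h s hs).solved.top
  turn s hs hT := ⟨D.left s, D.right s, D.mem_iff s hT, (h s hs).turn hT⟩

/-- The tables that the algorithm returns are correct at all states that can occur, and the running
time is at most the number of states times a polynomial in the number of terminal states. -/
theorem run_spec [Fintype S] (G : BiddingGame S) (D : Children G) :
    (∀ s, G.Reachable s → IsEntry D (run G D).val s) ∧
    (run G D).time ≤ Fintype.card S * (nodeTime (G.T.card + 1) + 30) := by
  obtain ⟨new, a1, a2, a3, a4, a5⟩ := visit_spec (D := D) (Fintype.card S) G.s₀
    (height_lt_card _) (fun _ => False) (fun _ h => h.elim) (fun _ : S => false, [])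
    ⟨by simp, .nil⟩
  set σ := visit G D (Fintype.card S) G.s₀ (fun _ : S => false, []) with hσ
  rw [List.nil_append] at a1
  obtain ⟨b1, b2⟩ := heights_spec a2.postOrdered (fun _ : S => (0 : ℕ))
  obtain ⟨c1, c2⟩ := halve_spec (G.height G.s₀ + 2) 1
  rw [one_mul] at c1
  have hall : ∀ s, G.Reachable s → s ∈ σ.val.2 := by
    intro s hs
    induction hs with
    | refl => exact a3
    | @tail x y _ hy ih =>
      have hx : x ∉ G.T := fun h0 => by
        rw [(G.mem_T_iff x).mp h0] at hy
        exact absurd hy (Finset.notMem_empty _)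
      have h1 := a2.postOrdered.children_mem x ih hx
      rcases (D.mem_iff x hx y).mp hy with rfl | rfl
      exacts [h1.1, h1.2]
  obtain ⟨d1, d2⟩ := process_spec a2.postOrdered (fun s hs => a4 s (a1 ▸ hs))
    (rounds := 2 ^ (G.height G.s₀ + 2) + 1) (by unfold gridSize; push_cast; exact le_rfl)
    (fun _ : S => ([] : List (Row S)))
  have hval : (run G D).val = (process G D (2 ^ (G.height G.s₀ + 2) + 1) G.increment σ.val.2
      (fun _ : S => ([] : List (Row S)))).val := by
    simp only [run, newTable, bind_val, op_val, ← hσ, b1 _ a3, c1]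
    rfl
  have htime : (run G D).time = 3 * Fintype.card S + σ.time +
      (heights G D σ.val.2 fun _ => 0).time + (G.height G.s₀ + 4) +
      (process G D (2 ^ (G.height G.s₀ + 2) + 1) G.increment σ.val.2
        (fun _ : S => ([] : List (Row S)))).time := by
    simp only [run, newTable, bind_time, op_val, op_time, ← hσ, b1 _ a3, c1, c2]
    rw [show ((1 : ℝ) / 2) ^ (G.height G.s₀ + 2) = G.increment from rfl]
    ring
  refine ⟨fun s hs => hval ▸ d1 s (hall s hs), ?_⟩
  have hlen : σ.val.2.length ≤ Fintype.card S := a2.postOrdered.nodup.length_le_card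
  have hh := height_lt_card (G := G) G.s₀
  have h1 := d2.trans (Nat.mul_le_mul_right _ hlen)
  rw [← a1] at a5
  rw [Nat.mul_add] at h1 ⊢
  rw [htime]
  omega

theorem nodeTime_mono {L L' : ℕ} (h : L ≤ L') : nodeTime L ≤ nodeTime L' := by
  unfold nodeTime
  gcongr

theorem exists_polynomial_nodeTime : ∃ p : Polynomial ℕ, ∀ n, p.eval n = nodeTime (n + 1) + 30 := by
  let L : Polynomial ℕ := Polynomial.X + 1
  refine ⟨L * (3 * L + 3) + (L * L + 2 * L) * (2 * (L * L + 2 * L) + 1) +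
    (L * L + 2 * L) * ((2 * L + 1) * (8 * L + 40) + 1) + 3 * (L * L + 2 * L) + 1 + 30, fun n => ?_⟩
  simp [L, nodeTime]

end FindPSPEFast

theorem mainTheorem6 :
    ∃ p q : Polynomial ℕ, ∀ (S : Type) [Fintype S] (G : BiddingGame S),
      G.IsBinary → ∀ D : FindPSPEFast.Children G,
        -- the Lower PSPE exists,
        (∃ γ : BiddingGame.Profile S, G.IsLowerPSPE γ) ∧
        -- its budget-to-outcome map is the step function that the algorithm returns at the root,
        (∀ γ : BiddingGame.Profile S, G.IsLowerPSPE γ → ∀ B ∈ Set.Icc (0 : ℝ) 1,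
          ∃ t ∈ G.T, FindPSPEFast.stepValue ((FindPSPEFast.run G D).val G.s₀) B = some t ∧
            G.SameOutcome t (G.outcomeMap γ B)) ∧
        -- and likewise for the subgame at any state that can occur;
        (∀ γ : BiddingGame.Profile S, G.IsLowerPSPE γ → ∀ s, G.Reachable s →
          ∀ B ∈ Set.Icc (0 : ℝ) 1,
            ∃ t ∈ G.T, FindPSPEFast.stepValue ((FindPSPEFast.run G D).val s) B = some t ∧
              G.SameOutcome t (γ.outcome s B)) ∧
        -- each of these step functions has at most `|T|` intervals,
        (∀ s, G.Reachable s →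
          FindPSPEFast.IsStepFunction ((FindPSPEFast.run G D).val s) G.T.card) ∧
        -- and the running time is `|S| * poly(|T|)`, hence `poly(|S|)`.
        (FindPSPEFast.run G D).time ≤ Fintype.card S * p.eval G.T.card ∧
        (FindPSPEFast.run G D).time ≤ q.eval (Fintype.card S) := by
  obtain ⟨p, hp⟩ := FindPSPEFast.exists_polynomial_nodeTime
  refine ⟨p, Polynomial.X * p, fun S _ G _ D => ?_⟩
  obtain ⟨hentry, htime⟩ := FindPSPEFast.run_spec G D
  have hV := FindPSPEFast.isValuation D hentry
  have houtcome : ∀ γ : BiddingGame.Profile S, G.IsLowerPSPE γ → ∀ s, G.Reachable s →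
      ∀ B ∈ Set.Icc (0 : ℝ) 1,
        ∃ t ∈ G.T, FindPSPEFast.stepValue ((FindPSPEFast.run G D).val s) B = some t ∧
          G.SameOutcome t (γ.outcome s B) := by
    intro γ hγ s hs B hB
    have hsolved := (hentry s hs).solved
    obtain ⟨c, n, htab, _⟩ := hsolved.isStepFunction.exists_isTable BiddingGame.increment_pos
      BiddingGame.gridSize_mul_increment hsolved.cut
    refine ⟨_, htab.stepFun_mem hsolved.mem s _, hsolved.stepValue_eq hB.1, ?_⟩
    have hrep := BiddingGame.represents_of_isLowerPSPE hV hγ s hs B hB Player.white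
    exact (G.score_eq_iff _ _ _).mp hrep.symm
  refine ⟨BiddingGame.exists_isLowerPSPE hV, fun γ hγ => houtcome γ hγ _ Relation.ReflTransGen.refl,
    houtcome, fun s hs => (hentry s hs).solved.isStepFunction, by rw [hp]; exact htime, ?_⟩
  rw [Polynomial.eval_mul, Polynomial.eval_X, hp]
  refine htime.trans (Nat.mul_le_mul_left _ (Nat.add_le_add_right ?_ _))
  exact FindPSPEFast.nodeTime_mono (Nat.add_le_add_right (Finset.card_le_univ _) _)
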